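/- A flow network $\mathcal N=(D,s,t,c)$ consists of a finite digraph $D$ (no loops, no parallel arcs), two distinct vertices $s,t$ of $D$, and a capacity $c(uv)\in\mathbb N$ for every arc $uv$ of $D$. A flow on $\mathcal N$ is a function $x\colon A(D)\to\mathbb N$ with $x(uv)\le c(uv)$ for every arc $uv$ and $\sum_{u} x(uv)=\sum_{w} x(vw)$ for every vertex $v\notin\{s,t\}$ (sums over the arcs entering, respectively leaving, $v$). Its value is $|x|=\sum_{v}x(sv)-\sum_{u}x(us)$, and its support $D_x$ is the digraph on $V(D)$ whose arcs are the arcs $uv$ of $D$ with $x(uv)>0$. $\Delta^+(D_x)$ denotes the maximum out-degree of $D_x$. Theorem. The problem "$(\Delta^+\le k)$-flow of value $k+1$", that is, given a flow network $\mathcal N$ and an integer $k\ge 0$, to decide whether $\mathcal N$ has a flow $x$ of value at least $k+1$ with $\Delta^+(D_x)\le k$, is solvable in polynomial time. More precisely, there is a single algorithm which decides it for all $\mathcal N$ and all $k$ in $O(n^4)$ steps, where $n=|V(D)|$ and the implied constant depends neither on $k$ nor on the capacities. Here the model of computation is the word RAM: the input consists of $n,s,t,k$ and of the adjacency matrix and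 the capacity matrix of $\mathcal N$; additions, truncated subtractions, multiplications, comparisons and memory accesses on words of $O(\log(n+k+U))$ bits take one step each, where $U$ is the largest capacity of an arc. -/

import Mathlib

/-! ## Flow networks and flows -/

/-- A flow network `(D, s, t, c)` on the vertex set `{0, …, n-1}`: a digraph without loops or
parallel arcs, two distinct terminals, and integer capacities. Only the values of `cap` on arcs of
`D` matter. Arcs entering `s` or leaving `t` are allowed. -/
structure FlowNetwork (n : ℕ) where
  D : Digraph (Fin n)
  loopless : ∀ v, ¬ D.Adj v v
  s : Fin n
  t : Fin n
  s_ne_t : s ≠ t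
  cap : Fin n → Fin n → ℕ

namespace FlowNetwork

variable {n : ℕ}

/-- `x` is an (integer valued) `(s,t)`-flow on `N`. -/
structure IsFlow (N : FlowNetwork n) (x : Fin n → Fin n → ℕ) : Prop where
  eq_zero_of_not_adj : ∀ u v, ¬ N.D.Adj u v → x u v = 0
  le_cap : ∀ u v, N.D.Adj u v → x u v ≤ N.cap u v
  conservation : ∀ v, v ≠ N.s → v ≠ N.t → ∑ u, x u v = ∑ w, x v w

/-- The value `|x|`: the net amount of flow leaving `s`. -/
def value (N : FlowNetwork n) (x : Fin n → Fin n → ℕ) : ℤ :=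
  (∑ v, (x N.s v : ℤ)) - ∑ u, (x u N.s : ℤ)

/-- The support `D_x`: the digraph formed by the arcs of `D` that carry flow. -/
def support (N : FlowNetwork n) (x : Fin n → Fin n → ℕ) : Digraph (Fin n) where
  Adj u v := N.D.Adj u v ∧ 0 < x u v

end FlowNetwork

/-- The maximum out-degree `Δ⁺(D)`. -/
noncomputable def maxOutDegree {n : ℕ} (D : Digraph (Fin n)) : ℕ :=
  Finset.univ.sup fun v => {w | D.Adj v w}.ncard

/-- The answer to the problem "`(Δ⁺ ≤ k)`-flow of value `k + ℓ`" on the network `N`. -/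
def HasDegreeBoundedFlow {n : ℕ} (N : FlowNetwork n) (k ℓ : ℕ) : Prop :=
  ∃ x, N.IsFlow x ∧ maxOutDegree (N.support x) ≤ k ∧ ((k + ℓ : ℕ) : ℤ) ≤ N.value x

/-! ## A word RAM with a step count -/

namespace WordRAM

/-- A memory configuration: registers, and random access memory organised in banks. A program is a
finite text, so that it uses finitely many registers and finitely many banks. -/
@[ext] structure State where
  reg : ℕ → ℕ
  mem : ℕ → ℕ → ℕ

/-- The elementary instructions; `r`, `a`, `b` name registers and `m` names a memory bank. -/
inductive Instr where
  /-- `r := c` -/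
  | const (r c : ℕ)
  /-- `r := a` -/
  | move (r a : ℕ)
  /-- `r := a + b` -/
  | add (r a b : ℕ)
  /-- `r := a - b`, or `0` if `a < b` -/
  | sub (r a b : ℕ)
  /-- `r := a * b` -/
  | mul (r a b : ℕ)
  /-- `r := m[a]` -/
  | load (r m a : ℕ)
  /-- `m[a] := b` -/
  | store (m a b : ℕ)

/-- The word that an instruction computes. -/
def Instr.result : Instr → State → ℕ
  | .const _ c, _ => c
  | .move _ a, σ => σ.reg a
  | .add _ a b, σ => σ.reg a + σ.reg b
  | .sub _ a b, σ => σ.reg a - σ.reg b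
  | .mul _ a b, σ => σ.reg a * σ.reg b
  | .load _ m a, σ => σ.mem m (σ.reg a)
  | .store _ _ b, σ => σ.reg b

/-- Put the word `y` into register `r`. -/
def State.setReg (σ : State) (r y : ℕ) : State :=
  { σ with reg := Function.update σ.reg r y }

/-- Put the word `y` into cell `i` of bank `m`. -/
def State.setMem (σ : State) (m i y : ℕ) : State :=
  { σ with mem := Function.update σ.mem m (Function.update (σ.mem m) i y) }

/-- The effect of an instruction: the computed word is written to its destination. -/
def Instr.next (i : Instr) (σ : State) : State :=
  match i with
  | .const r _ => σ.setReg r (i.result σ)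
  | .move r _ => σ.setReg r (i.result σ)
  | .add r _ _ => σ.setReg r (i.result σ)
  | .sub r _ _ => σ.setReg r (i.result σ)
  | .mul r _ _ => σ.setReg r (i.result σ)
  | .load r _ _ => σ.setReg r (i.result σ)
  | .store m a _ => σ.setMem m (σ.reg a) (i.result σ)

/-- Comparison of two registers. -/
inductive Test where
  | lt (a b : ℕ)
  | eq (a b : ℕ)

def Test.Holds : Test → State → Prop
  | .lt a b, σ => σ.reg a < σ.reg b
  | .eq a b, σ => σ.reg a = σ.reg b

/-- Programs with structured control flow. -/
inductive Prog where
  | instr (i : Instr)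
  | seq (p q : Prog)
  | ite (b : Test) (p q : Prog)
  | while (b : Test) (p : Prog)

/-- `Exec w p σ T τ`: on a machine with `w`-bit words, the program `p` started in `σ` halts in `τ`
after exactly `T` steps. Every instruction and every evaluation of a test is one step. An
instruction whose result does not fit into a word has no execution, so that an overflow is fatal. -/
inductive Exec (w : ℕ) : Prog → State → ℕ → State → Prop where
  | instr (i : Instr) (σ : State) (h : i.result σ < 2 ^ w) :
      Exec w (.instr i) σ 1 (i.next σ)
  | seq {p q : Prog} {σ τ υ : State} {T T' : ℕ} :
      Exec w p σ T τ → Exec w q τ T' υ → Exec w (.seq p q) σ (T + T') υ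
  | ite_true {b : Test} {p q : Prog} {σ τ : State} {T : ℕ} :
      b.Holds σ → Exec w p σ T τ → Exec w (.ite b p q) σ (T + 1) τ
  | ite_false {b : Test} {p q : Prog} {σ τ : State} {T : ℕ} :
      ¬ b.Holds σ → Exec w q σ T τ → Exec w (.ite b p q) σ (T + 1) τ
  | while_true {b : Test} {p : Prog} {σ τ υ : State} {T T' : ℕ} :
      b.Holds σ → Exec w p σ T τ → Exec w (.while b p) τ T' υ →
        Exec w (.while b p) σ (T + 1 + T') υ
  | while_false {b : Test} {p : Prog} {σ : State} :
      ¬ b.Holds σ → Exec w (.while b p) σ 1 σ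

end WordRAM

/-! ## The input of the decision problem -/

namespace FlowNetwork

variable {n : ℕ}

open Classical in
/-- The adjacency matrix of `D`. -/
noncomputable def adjEntry (N : FlowNetwork n) (u v : Fin n) : ℕ :=
  if N.D.Adj u v then 1 else 0

open Classical in
/-- The capacity matrix, with entry `0` where there is no arc. -/
noncomputable def capEntry (N : FlowNetwork n) (u v : Fin n) : ℕ :=
  if N.D.Adj u v then N.cap u v else 0

/-- The largest capacity of an arc. -/
noncomputable def maxCap (N : FlowNetwork n) : ℕ :=
  Finset.univ.sup fun e : Fin n × Fin n => N.capEntry e.1 e.2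

/-- Row-major storage of a matrix: entry `(u, v)` is in cell `v + n * u`; all other cells are `0`. -/
def rowMajor (A : Fin n → Fin n → ℕ) (a : ℕ) : ℕ :=
  if h : a < n * n then
    A (finProdFinEquiv.symm ⟨a, h⟩).1 (finProdFinEquiv.symm ⟨a, h⟩).2
  else 0

/-- The initial configuration on input `(N, k)`: registers `0, 1, 2, 3` hold `n, s, t, k`, bank `0`
holds the adjacency matrix, bank `1` the capacity matrix, and everything else is `0`. -/
noncomputable def input (N : FlowNetwork n) (k : ℕ) : WordRAM.State where
  reg r := if r = 0 then n else if r = 1 then (N.s : ℕ) else if r = 2 then (N.t : ℕ)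
    else if r = 3 then k else 0
  mem m := if m = 0 then rowMajor N.adjEntry else if m = 1 then rowMajor N.capEntry else fun _ => 0

/-- The number of bits of the largest number in the input, up to a constant factor:
`⌈log₂ (n + k + U + 1)⌉`, where `U` is the largest capacity. -/
noncomputable def bitSize (N : FlowNetwork n) (k : ℕ) : ℕ :=
  Nat.size (n + k + N.maxCap)

end FlowNetwork

/-! For `k = 0` the answer is always no. For `k = 1` the support of a flow of value at least 2
leaves each vertex along at most one arc, so such a flow exists iff `t` can be reached from `s`
along arcs of capacity at least 2.

For `k ≥ 2` the characterization (`hasDegreeBoundedFlow_iff`) is: every `(s,t)`-cut has capacity at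
least `k + 1`, and every vertex `a ≠ t` that lies on all `(s,t)`-paths (`s` included) has an arc
`aw` of capacity at least 2 from which two units can reach `t` in `D - a`. Necessity
(`hasDoubleArc_of_flow`): all flow passes through `a`, which has at most `k` support arcs. If each
of its heavy arcs were followed by a cut of capacity at most 1, every support arc at `a` would
account for at most one unit across a common cut, giving at most `k` units. Sufficiency
(`exists_isDegreeBoundedFlow`): a separating vertex `b` other than `s, t` splits the network into a
part from `s` to `b` and a part from `b` to `t`, with disjoint sets of tails, so that flows of the
parts can be added. When there is no such vertex, bound the outflow of every vertex by `k`, except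
at `s`: there one double arc `sw` takes two units for a single support arc and all other arcs
together take `k - 1`. Max-flow min-cut in the network with split vertices yields the flow.

The algorithm checks these conditions. The minimum cut comes from a push-relabel method with labels
at most `n`, run for `3n²` passes over all vertices; a potential argument (`wp_pass`) shows that no
active vertex is left. For each `a` a backward search in `D - a` tells whether `a` separates. Two
units can reach `t` from `w` iff `w` reaches `t` and still does after deletion of any single tree
arc of capacity 1, since every cut is crossed by a tree arc; hence `n` further searches of `O(n²)`
steps suffice for each `a`.

Paths never occur in the formalization: reachability, separation and pairs of disjoint paths are all
expressed by cuts. The program is written in a small language whose only loop has `n` rounds, so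
that its running time is a power of `n` given by the nesting depth, here 4; a verified compiler
transfers correctness and step count to the word RAM. -/

/-! ## A small imperative language with two-dimensional arrays and loops of length `n` -/

namespace WordRAM

/-- Registers from `tempBase` on hold intermediate results. -/
def tempBase : ℕ := 30

/-- The variables and the two-dimensional arrays. The variable `0` holds `n`. -/
structure Env where
  var : ℕ → ℕ
  mat : ℕ → ℕ → ℕ → ℕ

def Env.setVar (S : Env) (r y : ℕ) : Env :=
  { S with var := Function.update S.var r y }

def Env.setMat (S : Env) (m i j y : ℕ) : Env :=
  { S with mat := fun m' i' j' => if m' = m ∧ i' = i ∧ j' = j then y else S.mat m' i' j' }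

inductive Exp where
  | lit (k : ℕ)
  | var (r : ℕ)
  | plus (a b : Exp)
  | minus (a b : Exp)
  | get (m : ℕ) (i j : Exp)
  | ifEq (a b x y : Exp)
  | ifLt (a b x y : Exp)

namespace Exp

def eval (S : Env) : Exp → ℕ
  | lit k => k
  | var r => S.var r
  | plus a b => a.eval S + b.eval S
  | minus a b => a.eval S - b.eval S
  | get m i j => S.mat m (i.eval S) (j.eval S)
  | ifEq a b x y => if a.eval S = b.eval S then x.eval S else y.eval S
  | ifLt a b x y => if a.eval S < b.eval S then x.eval S else y.eval S

/-- The evaluation causes no overflow and no access out of bounds. -/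
def Fits (w : ℕ) (S : Env) : Exp → Prop
  | lit k => k < 2 ^ w
  | var _ => True
  | plus a b => a.Fits w S ∧ b.Fits w S ∧ a.eval S + b.eval S < 2 ^ w
  | minus a b => a.Fits w S ∧ b.Fits w S
  | get _ i j => i.Fits w S ∧ j.Fits w S ∧ i.eval S < S.var 0 ∧ j.eval S < S.var 0
  | ifEq a b x y => a.Fits w S ∧ b.Fits w S ∧
      if a.eval S = b.eval S then x.Fits w S else y.Fits w S
  | ifLt a b x y => a.Fits w S ∧ b.Fits w S ∧
      if a.eval S < b.eval S then x.Fits w S else y.Fits w S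

/-- All variables are below `tempBase`. -/
def WF : Exp → Bool
  | lit _ => true
  | var r => r < tempBase
  | plus a b => a.WF && b.WF
  | minus a b => a.WF && b.WF
  | get _ i j => i.WF && j.WF
  | ifEq a b x y => a.WF && b.WF && x.WF && y.WF
  | ifLt a b x y => a.WF && b.WF && x.WF && y.WF

/-- Code that leaves the value in register `r` and uses no other register below `r`. -/
def compile : Exp → ℕ → Prog
  | lit k, r => .instr (.const r k)
  | var x, r => .instr (.move r x)
  | plus a b, r => .seq (a.compile r) (.seq (b.compile (r + 1)) (.instr (.add r r (r + 1))))
  | minus a b, r => .seq (a.compile r) (.seq (b.compile (r + 1)) (.instr (.sub r r (r + 1))))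
  | get m i j, r => .seq (i.compile r) (.seq (.instr (.mul r 0 r)) (.seq (j.compile (r + 1))
      (.seq (.instr (.add r (r + 1) r)) (.instr (.load r m r)))))
  | ifEq a b x y, r => .seq (a.compile r) (.seq (b.compile (r + 1))
      (.ite (.eq r (r + 1)) (x.compile r) (y.compile r)))
  | ifLt a b x y, r => .seq (a.compile r) (.seq (b.compile (r + 1))
      (.ite (.lt r (r + 1)) (x.compile r) (y.compile r)))

/-- Both branches of a conditional are charged, so that the bound depends on the syntax alone. -/
def cost : Exp → ℕ
  | lit _ => 1
  | var _ => 1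
  | plus a b => a.cost + b.cost + 1
  | minus a b => a.cost + b.cost + 1
  | get _ i j => i.cost + j.cost + 3
  | ifEq a b x y => a.cost + b.cost + x.cost + y.cost + 1
  | ifLt a b x y => a.cost + b.cost + x.cost + y.cost + 1

end Exp

/-- With a fixed number of rounds as the only form of iteration, every command terminates and has a
semantics that is a plain function on states. -/
inductive Cmd where
  | skip
  | set (r : ℕ) (e : Exp)
  | put (m : ℕ) (i j e : Exp)
  | seq (p q : Cmd)
  | ifEq (a b : Exp) (p q : Cmd)
  | ifLt (a b : Exp) (p q : Cmd)
  | loop (r : ℕ) (p : Cmd)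

infixr:60 " ;; " => Cmd.seq

namespace Cmd

/-- The state after `j` rounds of a loop with counter `r`. -/
def rounds (f : Env → Env) (r : ℕ) (S : Env) : ℕ → Env
  | 0 => S.setVar r 0
  | j + 1 => (f (rounds f r S j)).setVar r (j + 1)

def eval : Cmd → Env → Env
  | skip, S => S
  | set r e, S => S.setVar r (e.eval S)
  | put m i j e, S => S.setMat m (i.eval S) (j.eval S) (e.eval S)
  | seq p q, S => q.eval (p.eval S)
  | ifEq a b p q, S => if a.eval S = b.eval S then p.eval S else q.eval S
  | ifLt a b p q, S => if a.eval S < b.eval S then p.eval S else q.eval S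
  | loop r p, S => rounds p.eval r S (S.var 0)

/-- The execution causes no overflow and no access out of bounds. -/
def Fits (w : ℕ) : Cmd → Env → Prop
  | skip, _ => True
  | set _ e, S => e.Fits w S
  | put _ i j e, S => i.Fits w S ∧ j.Fits w S ∧ e.Fits w S ∧ i.eval S < S.var 0 ∧
      j.eval S < S.var 0
  | seq p q, S => p.Fits w S ∧ q.Fits w (p.eval S)
  | ifEq a b p q, S => a.Fits w S ∧ b.Fits w S ∧
      if a.eval S = b.eval S then p.Fits w S else q.Fits w S
  | ifLt a b p q, S => a.Fits w S ∧ b.Fits w S ∧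
      if a.eval S < b.eval S then p.Fits w S else q.Fits w S
  | loop r p, S => ∀ j < S.var 0, p.Fits w (rounds p.eval r S j)

/-- The variables that may be changed. -/
def writes : Cmd → List ℕ
  | skip => []
  | set r _ => [r]
  | put _ _ _ _ => []
  | seq p q => p.writes ++ q.writes
  | ifEq _ _ p q => p.writes ++ q.writes
  | ifLt _ _ p q => p.writes ++ q.writes
  | loop r p => r :: p.writes

/-- The arrays that may be changed. -/
def banks : Cmd → List ℕ
  | skip => []
  | set _ _ => []
  | put m _ _ _ => [m]
  | seq p q => p.banks ++ q.banks
  | ifEq _ _ p q => p.banks ++ q.banks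
  | ifLt _ _ p q => p.banks ++ q.banks
  | loop _ p => p.banks

/-- All variables are below `tempBase`, the variable `0` is not changed, and no loop changes its
counter. -/
def WF : Cmd → Bool
  | skip => true
  | set r e => r != 0 && r < tempBase && e.WF
  | put _ i j e => i.WF && j.WF && e.WF
  | seq p q => p.WF && q.WF
  | ifEq a b p q => a.WF && b.WF && p.WF && q.WF
  | ifLt a b p q => a.WF && b.WF && p.WF && q.WF
  | loop r p => r != 0 && r < tempBase && p.WF && !(p.writes.contains r)

def compile : Cmd → Prog
  | skip => .instr (.move 0 0)
  | set r e => .seq (e.compile tempBase) (.instr (.move r tempBase))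
  | put m i j e => .seq (e.compile tempBase) (.seq (i.compile (tempBase + 1))
      (.seq (.instr (.mul (tempBase + 1) 0 (tempBase + 1))) (.seq (j.compile (tempBase + 2))
      (.seq (.instr (.add (tempBase + 1) (tempBase + 2) (tempBase + 1)))
      (.instr (.store m (tempBase + 1) tempBase))))))
  | seq p q => .seq p.compile q.compile
  | ifEq a b p q => .seq (a.compile tempBase) (.seq (b.compile (tempBase + 1))
      (.ite (.eq tempBase (tempBase + 1)) p.compile q.compile))
  | ifLt a b p q => .seq (a.compile tempBase) (.seq (b.compile (tempBase + 1))
      (.ite (.lt tempBase (tempBase + 1)) p.compile q.compile))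
  | loop r p => .seq (.instr (.const r 0)) (.while (.lt r 0) (.seq p.compile
      (.seq (.instr (.const tempBase 1)) (.instr (.add r r tempBase)))))

/-- In a loop, each round pays 3 for the test and the two instructions of the increment; the final 2
pays for the initialization and the failing test. -/
def cost (n : ℕ) : Cmd → ℕ
  | skip => 1
  | set _ e => e.cost + 1
  | put _ i j e => e.cost + i.cost + j.cost + 3
  | seq p q => p.cost n + q.cost n
  | ifEq a b p q => a.cost + b.cost + p.cost n + q.cost n + 1
  | ifLt a b p q => a.cost + b.cost + p.cost n + q.cost n + 1
  | loop _ p => n * (p.cost n + 3) + 2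

/-- The nesting depth of loops. -/
def depth : Cmd → ℕ
  | skip => 0
  | set _ _ => 0
  | put _ _ _ _ => 0
  | seq p q => max p.depth q.depth
  | ifEq _ _ p q => max p.depth q.depth
  | ifLt _ _ p q => max p.depth q.depth
  | loop _ p => p.depth + 1

/-- The leading constant of the running time. -/
def coeff : Cmd → ℕ
  | skip => 1
  | set _ e => e.cost + 1
  | put _ i j e => e.cost + i.cost + j.cost + 3
  | seq p q => p.coeff + q.coeff
  | ifEq a b p q => a.cost + b.cost + p.coeff + q.coeff + 1
  | ifLt a b p q => a.cost + b.cost + p.coeff + q.coeff + 1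
  | loop _ p => p.coeff + 5

/-- All lower powers of `n` are absorbed into the highest one because `n ≥ 1`; the constants 3 and 2
of a loop become the 5 in `coeff`. -/
theorem cost_le (c : Cmd) {n : ℕ} (hn : 1 ≤ n) : c.cost n ≤ c.coeff * n ^ c.depth := by
  have mono : ∀ {a b e : ℕ}, b ≤ e → a * n ^ b ≤ a * n ^ e := fun h =>
    Nat.mul_le_mul_left _ (Nat.pow_le_pow_right hn h)
  have key : ∀ {x p q a b d e : ℕ}, p ≤ a * n ^ d → q ≤ b * n ^ e →
      x + p + q ≤ (x + a + b) * n ^ max d e := by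
    intro x p q a b d e hp hq
    have h1 : a * n ^ d ≤ a * n ^ max d e := mono (le_max_left _ _)
    have h2 : b * n ^ e ≤ b * n ^ max d e := mono (le_max_right _ _)
    have h3 : x * 1 ≤ x * n ^ max d e := Nat.mul_le_mul_left _ (Nat.one_le_pow _ _ hn)
    rw [add_mul, add_mul]
    omega
  induction c with
  | skip => simp [cost, coeff, depth]
  | set => simp [cost, coeff, depth]
  | put => simp [cost, coeff, depth]
  | seq p q ihp ihq =>
    have := key (x := 0) ihp ihq
    simpa only [cost, coeff, depth, zero_add] using this
  | ifEq a b p q ihp ihq =>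
    have := key (x := a.cost + b.cost + 1) ihp ihq
    simp only [cost, coeff, depth]
    convert this using 1
    · ring
    · ring
  | ifLt a b p q ihp ihq =>
    have := key (x := a.cost + b.cost + 1) ihp ihq
    simp only [cost, coeff, depth]
    convert this using 1
    · ring
    · ring
  | loop r p ih =>
    simp only [cost, coeff, depth]
    have h1 : 1 ≤ n ^ p.depth := Nat.one_le_pow _ _ hn
    have h2 : n * (p.cost n + 3) ≤ n * (p.coeff * n ^ p.depth + 3 * n ^ p.depth) :=
      Nat.mul_le_mul_left _ (by omega)
    have h3 : 1 * 1 ≤ n * n ^ p.depth := Nat.mul_le_mul hn h1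
    rw [pow_succ]
    nlinarith

/-! ### What a command leaves unchanged. -/

theorem rounds_var_counter (f : Env → Env) (r : ℕ) (S : Env) (j : ℕ) :
    (rounds f r S j).var r = j := by
  cases j <;> simp [rounds, Env.setVar]

theorem eval_var_of_notMem (c : Cmd) {r : ℕ} (h : r ∉ c.writes) (S : Env) :
    (c.eval S).var r = S.var r := by
  induction c generalizing S with
  | skip => rfl
  | set x e =>
    have : r ≠ x := by simpa [writes] using h
    simp [eval, Env.setVar, this]
  | put => rfl
  | seq p q ihp ihq =>
    simp only [writes, List.mem_append, not_or] at h
    simp [eval, ihp h.1, ihq h.2]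
  | ifEq a b p q ihp ihq =>
    simp only [writes, List.mem_append, not_or] at h
    simp only [eval]
    split <;> simp [ihp h.1, ihq h.2]
  | ifLt a b p q ihp ihq =>
    simp only [writes, List.mem_append, not_or] at h
    simp only [eval]
    split <;> simp [ihp h.1, ihq h.2]
  | loop x p ih =>
    simp only [writes, List.mem_cons, not_or] at h
    have : ∀ j, (rounds p.eval x S j).var r = S.var r := by
      intro j
      induction j with
      | zero => simp [rounds, Env.setVar, h.1]
      | succ j ihj => simp [rounds, Env.setVar, h.1, ih h.2, ihj]
    exact this _

theorem eval_mat_of_notMem (c : Cmd) {m : ℕ} (h : m ∉ c.banks) (S : Env) :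
    (c.eval S).mat m = S.mat m := by
  induction c generalizing S with
  | skip => rfl
  | set x e => rfl
  | put m' =>
    have : m ≠ m' := by simpa [banks] using h
    simp [eval, Env.setMat, this]
  | seq p q ihp ihq =>
    simp only [banks, List.mem_append, not_or] at h
    simp [eval, ihp h.1, ihq h.2]
  | ifEq a b p q ihp ihq =>
    simp only [banks, List.mem_append, not_or] at h
    simp only [eval]
    split <;> simp [ihp h.1, ihq h.2]
  | ifLt a b p q ihp ihq =>
    simp only [banks, List.mem_append, not_or] at h
    simp only [eval]
    split <;> simp [ihp h.1, ihq h.2]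
  | loop x p ih =>
    simp only [banks] at h
    have : ∀ j, (rounds p.eval x S j).mat m = S.mat m := by
      intro j
      induction j with
      | zero => rfl
      | succ j ihj => simp [rounds, Env.setVar, ih h, ihj]
    exact this _

theorem zero_notMem_writes {c : Cmd} (h : c.WF = true) : 0 ∉ c.writes := by
  induction c with
  | skip => simp [writes]
  | set x e => simp [WF] at h; simp [writes]; omega
  | put => simp [writes]
  | seq p q ihp ihq => simp_all [WF, writes]
  | ifEq a b p q ihp ihq => simp_all [WF, writes]
  | ifLt a b p q ihp ihq => simp_all [WF, writes]
  | loop x p ih => simp [WF] at h; simp_all [writes]; omega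

end Cmd

/-! ### Correctness of the translation -/

/-- The machine state `σ` represents `S`, up to the temporary registers. -/
structure Rep (n : ℕ) (S : Env) (σ : State) : Prop where
  reg : ∀ r < tempBase, σ.reg r = S.var r
  mem : ∀ m i j, i < n → j < n → σ.mem m (j + n * i) = S.mat m i j

/-- All words fit into `w` bits. -/
structure State.Fits (w : ℕ) (σ : State) : Prop where
  reg : ∀ r, σ.reg r < 2 ^ w
  mem : ∀ m i, σ.mem m i < 2 ^ w

theorem State.Fits.setReg {w : ℕ} {σ : State} (h : σ.Fits w) (r : ℕ) {y : ℕ} (hy : y < 2 ^ w) :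
    (σ.setReg r y).Fits w := by
  refine ⟨fun x => ?_, h.mem⟩
  by_cases hx : x = r
  · subst hx; simpa [State.setReg] using hy
  · simpa [State.setReg, hx] using h.reg x

theorem State.Fits.setMem {w : ℕ} {σ : State} (h : σ.Fits w) (m i : ℕ) {y : ℕ} (hy : y < 2 ^ w) :
    (σ.setMem m i y).Fits w := by
  refine ⟨h.reg, fun m' i' => ?_⟩
  have h1 := h.mem m' i'
  by_cases hm : m' = m
  · subst hm
    by_cases hi : i' = i
    · subst hi; simpa [State.setMem] using hy
    · simpa [State.setMem, hi] using h1
  · simpa [State.setMem, hm] using h1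

theorem Rep.setTemp {n : ℕ} {S : Env} {σ : State} (h : Rep n S σ) {r : ℕ} (hr : tempBase ≤ r)
    (y : ℕ) : Rep n S (σ.setReg r y) := by
  refine ⟨fun x hx => ?_, h.mem⟩
  have : x ≠ r := by omega
  simpa [State.setReg, this] using h.reg x hx

theorem Rep.setVar {n : ℕ} {S : Env} {σ : State} (h : Rep n S σ) (r y : ℕ) :
    Rep n (S.setVar r y) (σ.setReg r y) := by
  refine ⟨fun x hx => ?_, h.mem⟩
  simp only [State.setReg, Env.setVar, Function.update_apply, h.reg x hx]

theorem index_inj {n i j i' j' : ℕ} (hj : j < n) (hj' : j' < n)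
    (h : j + n * i = j' + n * i') : i = i' ∧ j = j' := by
  have hn : 0 < n := by omega
  have h1 := congrArg (· / n) h
  have h2 := congrArg (· % n) h
  simp only [Nat.add_mul_div_left _ _ hn, Nat.add_mul_mod_self_left, Nat.div_eq_of_lt hj,
    Nat.div_eq_of_lt hj', Nat.mod_eq_of_lt hj, Nat.mod_eq_of_lt hj'] at h1 h2
  omega

theorem Rep.setMat {n : ℕ} {S : Env} {σ : State} (h : Rep n S σ) (m : ℕ) {i j : ℕ}
    (hj : j < n) (y : ℕ) : Rep n (S.setMat m i j y) (σ.setMem m (j + n * i) y) := by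
  refine ⟨h.reg, fun m' i' j' hi' hj' => ?_⟩
  have := h.mem m' i' j' hi' hj'
  simp only [State.setMem, Env.setMat, Function.update_apply]
  by_cases hm : m' = m
  · subst hm
    by_cases h1 : j' + n * i' = j + n * i
    · obtain ⟨rfl, rfl⟩ := index_inj hj' hj h1
      simp
    · have : ¬ (i' = i ∧ j' = j) := by rintro ⟨rfl, rfl⟩; exact h1 rfl
      simp [*]
  · simp [hm, this]

/-- What running the code of an expression achieves. -/
structure ExpPost (w n : ℕ) (S : Env) (σ τ : State) (r y : ℕ) : Prop where
  rep : Rep n S τ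
  fits : τ.Fits w
  value : τ.reg r = y
  keep : ∀ x < r, τ.reg x = σ.reg x

theorem index_lt {n i j w : ℕ} (hn : n * n < 2 ^ w) (hi : i < n) (hj : j < n) :
    n * i < 2 ^ w ∧ j + n * i < 2 ^ w := by
  have : n * i + n ≤ n * n := by nlinarith
  omega

/-- The registers from `r` on serve as a stack: the code of the second operand, with target `r + 1`,
keeps everything below it, so the first operand survives in `r`. The claim is therefore proved for
all `r ≥ tempBase` at once. -/
theorem Exp.exec_compile {w n : ℕ} (hn : n * n < 2 ^ w) {S : Env} (hS : S.var 0 = n) (e : Exp)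
    (hwf : e.WF = true) (hfit : e.Fits w S) {r : ℕ} (hr : tempBase ≤ r) {σ : State}
    (hrep : Rep n S σ) (hσ : σ.Fits w) :
    ∃ T ≤ e.cost, ∃ τ, Exec w (e.compile r) σ T τ ∧ ExpPost w n S σ τ r (e.eval S) := by
  have h0 : ∀ {σ : State}, Rep n S σ → σ.reg 0 = n := fun h => by
    rw [h.reg 0 (by decide), hS]
  induction e generalizing r σ with
  | lit k =>
    refine ⟨1, le_rfl, _, .instr _ _ hfit, ?_⟩
    refine ⟨hrep.setTemp hr _, hσ.setReg _ hfit, by simp [Instr.next, State.setReg, Instr.result,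
      Exp.eval], fun x hx => ?_⟩
    simp [Instr.next, State.setReg, hx.ne]
  | var x =>
    simp only [WF, decide_eq_true_eq] at hwf
    refine ⟨1, le_rfl, _, .instr _ _ (hσ.reg x), ?_⟩
    refine ⟨hrep.setTemp hr _, hσ.setReg _ (hσ.reg x), ?_, fun x hx => ?_⟩
    · simp [Instr.next, State.setReg, Instr.result, Exp.eval, hrep.reg x hwf]
    · simp [Instr.next, State.setReg, hx.ne]
  | plus a b iha ihb =>
    simp only [WF, Bool.and_eq_true] at hwf
    obtain ⟨Ta, hTa, τa, ea, pa⟩ := iha hwf.1 hfit.1 hr hrep hσ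
    obtain ⟨Tb, hTb, τb, eb, pb⟩ := ihb hwf.2 hfit.2.1 (by omega : tempBase ≤ r + 1) pa.rep pa.fits
     
    have hv : τb.reg r + τb.reg (r + 1) = a.eval S + b.eval S := by
      rw [pb.value, pb.keep r (by omega), pa.value]
    have hlt := hfit.2.2
    rw [← hv] at hlt
    refine ⟨Ta + (Tb + 1), by simp only [cost]; omega, _, .seq ea (.seq eb (.instr _ _ hlt)), ?_⟩
    refine ⟨pb.rep.setTemp hr _, pb.fits.setReg _ hlt, ?_, fun x hx => ?_⟩
    · simp [Instr.next, State.setReg, Instr.result, Exp.eval, hv]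
    · simp [Instr.next, State.setReg, hx.ne, pb.keep x (by omega), pa.keep x hx]
  | minus a b iha ihb =>
    simp only [WF, Bool.and_eq_true] at hwf
    obtain ⟨Ta, hTa, τa, ea, pa⟩ := iha hwf.1 hfit.1 hr hrep hσ
    obtain ⟨Tb, hTb, τb, eb, pb⟩ := ihb hwf.2 hfit.2 (by omega : tempBase ≤ r + 1) pa.rep pa.fits
     
    have hv : τb.reg r - τb.reg (r + 1) = a.eval S - b.eval S := by
      rw [pb.value, pb.keep r (by omega), pa.value]
    have hlt : τb.reg r - τb.reg (r + 1) < 2 ^ w := lt_of_le_of_lt (Nat.sub_le _ _) (pb.fits.reg r)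
    refine ⟨Ta + (Tb + 1), by simp only [cost]; omega, _, .seq ea (.seq eb (.instr _ _ hlt)), ?_⟩
    refine ⟨pb.rep.setTemp hr _, pb.fits.setReg _ hlt, ?_, fun x hx => ?_⟩
    · simp [Instr.next, State.setReg, Instr.result, Exp.eval, hv]
    · simp [Instr.next, State.setReg, hx.ne, pb.keep x (by omega), pa.keep x hx]
  | get m i j ihi ihj =>
    simp only [WF, Bool.and_eq_true] at hwf
    obtain ⟨fi, fj, li, lj⟩ := hfit
    rw [hS] at li lj
    obtain ⟨l1, l2⟩ := index_lt hn li lj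
    obtain ⟨Ti, hTi, τi, ei, pi⟩ := ihi hwf.1 fi hr hrep hσ
    have v1 : (Instr.mul r 0 r).result τi = n * i.eval S := by
      simp [Instr.result, h0 pi.rep, pi.value]
    have rep1 : Rep n S ((Instr.mul r 0 r).next τi) := pi.rep.setTemp hr _
    have fit1 : ((Instr.mul r 0 r).next τi).Fits w := pi.fits.setReg _ (by rw [v1]; exact l1)
    obtain ⟨Tj, hTj, τj, ej, pj⟩ := ihj hwf.2 fj (by omega : tempBase ≤ r + 1) rep1 fit1
     
    have v2 : (Instr.add r (r + 1) r).result τj = j.eval S + n * i.eval S := by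
      simp [Instr.result, pj.value, pj.keep r (by omega), Instr.next, State.setReg, h0 pi.rep,
        pi.value]
    have rep2 : Rep n S ((Instr.add r (r + 1) r).next τj) := pj.rep.setTemp hr _
    have fit2 : ((Instr.add r (r + 1) r).next τj).Fits w := pj.fits.setReg _ (by rw [v2]; exact l2)
    have v3 : (Instr.load r m r).result ((Instr.add r (r + 1) r).next τj) =
        S.mat m (i.eval S) (j.eval S) := by
      rw [← rep2.mem m _ _ li lj, ← v2]
      simp [Instr.result, Instr.next, State.setReg]
    have lt3 : (Instr.load r m r).result ((Instr.add r (r + 1) r).next τj) < 2 ^ w :=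
      fit2.mem _ _
    refine ⟨Ti + (1 + (Tj + (1 + 1))), by simp only [cost]; omega, _,
      .seq ei (.seq (.instr _ _ (by rw [v1]; exact l1)) (.seq ej
        (.seq (.instr _ _ (by rw [v2]; exact l2)) (.instr _ _ lt3)))), ?_⟩
    refine ⟨rep2.setTemp hr _, fit2.setReg _ lt3, ?_, fun x hx => ?_⟩
    · rw [Exp.eval, ← v3]
      simp [Instr.next, State.setReg]
    · have : x ≠ r := by omega
      simp [Instr.next, State.setReg, this, pj.keep x (by omega), pi.keep x hx]
  | ifEq a b x y iha ihb ihx ihy =>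
    simp only [WF, Bool.and_eq_true] at hwf
    obtain ⟨fa, fb, fc⟩ := hfit
    obtain ⟨Ta, hTa, τa, ea, pa⟩ := iha hwf.1.1.1 fa hr hrep hσ
    obtain ⟨Tb, hTb, τb, eb, pb⟩ := ihb hwf.1.1.2 fb (by omega : tempBase ≤ r + 1) pa.rep pa.fits
     
    have ha : τb.reg r = a.eval S := by rw [pb.keep r (by omega), pa.value]
    have ht : (Test.eq r (r + 1)).Holds τb ↔ a.eval S = b.eval S := by
      simp [Test.Holds, ha, pb.value]
    by_cases hc : a.eval S = b.eval S
    · rw [if_pos hc] at fc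
      obtain ⟨Tx, hTx, τx, ex, px⟩ := ihx hwf.1.2 fc hr pb.rep pb.fits
      refine ⟨Ta + (Tb + (Tx + 1)), by simp only [cost]; omega, _,
        .seq ea (.seq eb (.ite_true (ht.2 hc) ex)), px.rep, px.fits, ?_, fun z hz => ?_⟩
      · simp [Exp.eval, hc, px.value]
      · rw [px.keep z hz, pb.keep z (by omega), pa.keep z hz]
    · rw [if_neg hc] at fc
      obtain ⟨Tx, hTx, τx, ex, px⟩ := ihy hwf.2 fc hr pb.rep pb.fits
      refine ⟨Ta + (Tb + (Tx + 1)), by simp only [cost]; omega, _,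
        .seq ea (.seq eb (.ite_false (mt ht.1 hc) ex)), px.rep, px.fits, ?_, fun z hz => ?_⟩
      · simp [Exp.eval, hc, px.value]
      · rw [px.keep z hz, pb.keep z (by omega), pa.keep z hz]
  | ifLt a b x y iha ihb ihx ihy =>
    simp only [WF, Bool.and_eq_true] at hwf
    obtain ⟨fa, fb, fc⟩ := hfit
    obtain ⟨Ta, hTa, τa, ea, pa⟩ := iha hwf.1.1.1 fa hr hrep hσ
    obtain ⟨Tb, hTb, τb, eb, pb⟩ := ihb hwf.1.1.2 fb (by omega : tempBase ≤ r + 1) pa.rep pa.fits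
     
    have ha : τb.reg r = a.eval S := by rw [pb.keep r (by omega), pa.value]
    have ht : (Test.lt r (r + 1)).Holds τb ↔ a.eval S < b.eval S := by
      simp [Test.Holds, ha, pb.value]
    by_cases hc : a.eval S < b.eval S
    · rw [if_pos hc] at fc
      obtain ⟨Tx, hTx, τx, ex, px⟩ := ihx hwf.1.2 fc hr pb.rep pb.fits
      refine ⟨Ta + (Tb + (Tx + 1)), by simp only [cost]; omega, _,
        .seq ea (.seq eb (.ite_true (ht.2 hc) ex)), px.rep, px.fits, ?_, fun z hz => ?_⟩
      · simp [Exp.eval, hc, px.value]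
      · rw [px.keep z hz, pb.keep z (by omega), pa.keep z hz]
    · rw [if_neg hc] at fc
      obtain ⟨Tx, hTx, τx, ex, px⟩ := ihy hwf.2 fc hr pb.rep pb.fits
      refine ⟨Ta + (Tb + (Tx + 1)), by simp only [cost]; omega, _,
        .seq ea (.seq eb (.ite_false (mt ht.1 hc) ex)), px.rep, px.fits, ?_, fun z hz => ?_⟩
      · simp [Exp.eval, hc, px.value]
      · rw [px.keep z hz, pb.keep z (by omega), pa.keep z hz]

theorem Cmd.exec_compile {w n : ℕ} (hn : n * n < 2 ^ w) (h1 : 1 < 2 ^ w) (c : Cmd)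
    (hwf : c.WF = true) {S : Env} (hS : S.var 0 = n) (hfit : c.Fits w S) {σ : State}
    (hrep : Rep n S σ) (hσ : σ.Fits w) :
    ∃ T ≤ c.cost n, ∃ τ, Exec w c.compile σ T τ ∧ Rep n (c.eval S) τ ∧ τ.Fits w := by
  have ht : tempBase ≤ tempBase := le_rfl
  have ht1 : tempBase ≤ tempBase + 1 := by omega
  have ht2 : tempBase ≤ tempBase + 2 := by omega
  have h0 : ∀ {S : Env} {σ : State}, S.var 0 = n → Rep n S σ → σ.reg 0 = n := fun hS h => by
    rw [h.reg 0 (by decide), hS]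
  induction c generalizing S σ with
  | skip =>
    refine ⟨1, le_rfl, _, .instr _ _ (hσ.reg 0), ?_⟩
    have : (Instr.move 0 0).next σ = σ := by simp [Instr.next, Instr.result, State.setReg]
    rw [this]
    exact ⟨hrep, hσ⟩
  | set r e =>
    simp only [WF, Bool.and_eq_true] at hwf
    obtain ⟨T, hT, τ, ex, p⟩ := e.exec_compile hn hS hwf.2 hfit ht hrep hσ
    refine ⟨T + 1, by simp only [cost]; omega, _, .seq ex (.instr _ _ (p.fits.reg _)), ?_,
      p.fits.setReg _ (p.fits.reg _)⟩
    change Rep n (S.setVar r (e.eval S)) (τ.setReg r (τ.reg tempBase))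
    rw [p.value]
    exact p.rep.setVar _ _
  | put m i j e =>
    simp only [WF, Bool.and_eq_true] at hwf
    obtain ⟨fi, fj, fe, li, lj⟩ := hfit
    rw [hS] at li lj
    obtain ⟨l1, l2⟩ := index_lt hn li lj
    obtain ⟨Te, hTe, τe, ee, pe⟩ := e.exec_compile hn hS hwf.2 fe ht hrep hσ
    obtain ⟨Ti, hTi, τi, ei, pi⟩ := i.exec_compile hn hS hwf.1.1 fi ht1 pe.rep pe.fits
    have v1 : (Instr.mul (tempBase + 1) 0 (tempBase + 1)).result τi = n * i.eval S := by
      simp [Instr.result, h0 hS pi.rep, pi.value]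
    have rep1 : Rep n S ((Instr.mul (tempBase + 1) 0 (tempBase + 1)).next τi) :=
      pi.rep.setTemp ht1 _
    have fit1 : ((Instr.mul (tempBase + 1) 0 (tempBase + 1)).next τi).Fits w :=
      pi.fits.setReg _ (by rw [v1]; exact l1)
    obtain ⟨Tj, hTj, τj, ej, pj⟩ := j.exec_compile hn hS hwf.1.2 fj ht2 rep1 fit1
    have v2 : (Instr.add (tempBase + 1) (tempBase + 2) (tempBase + 1)).result τj =
        j.eval S + n * i.eval S := by
      simp [Instr.result, pj.value, pj.keep (tempBase + 1) (by omega), Instr.next, State.setReg,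
        h0 hS pi.rep, pi.value]
    have rep2 : Rep n S ((Instr.add (tempBase + 1) (tempBase + 2) (tempBase + 1)).next τj) :=
      pj.rep.setTemp ht1 _
    have fit2 : ((Instr.add (tempBase + 1) (tempBase + 2) (tempBase + 1)).next τj).Fits w :=
      pj.fits.setReg _ (by rw [v2]; exact l2)
    have v3 : ((Instr.add (tempBase + 1) (tempBase + 2) (tempBase + 1)).next τj).reg tempBase =
        e.eval S := by
      have : tempBase ≠ tempBase + 1 := by omega
      simp [Instr.next, State.setReg, pj.keep tempBase (by omega), pi.keep tempBase (by omega),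
        pe.value]
    have v4 : ((Instr.add (tempBase + 1) (tempBase + 2) (tempBase + 1)).next τj).reg
        (tempBase + 1) = j.eval S + n * i.eval S := by
      rw [← v2]; simp [Instr.next, State.setReg]
    refine ⟨Te + (Ti + (1 + (Tj + (1 + 1)))), by simp only [cost]; omega, _,
      .seq ee (.seq ei (.seq (.instr _ _ (by rw [v1]; exact l1)) (.seq ej
        (.seq (.instr _ _ (by rw [v2]; exact l2)) (.instr _ _ (fit2.reg _)))))), ?_,
      fit2.setMem _ _ (fit2.reg _)⟩
    change Rep n (S.setMat m (i.eval S) (j.eval S) (e.eval S)) (State.setMem _ m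
      (State.reg _ (tempBase + 1)) (State.reg _ tempBase))
    rw [v3, v4]
    exact rep2.setMat m lj _
  | seq p q ihp ihq =>
    simp only [WF, Bool.and_eq_true] at hwf
    obtain ⟨Tp, hTp, τp, ep, rp, fp⟩ := ihp hwf.1 hS hfit.1 hrep hσ
    obtain ⟨Tq, hTq, τq, eq, rq, fq⟩ := ihq hwf.2
      (by rw [eval_var_of_notMem _ (zero_notMem_writes hwf.1), hS]) hfit.2 rp fp
    exact ⟨Tp + Tq, by simp only [cost]; omega, τq, .seq ep eq, rq, fq⟩
  | ifEq a b p q ihp ihq =>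
    simp only [WF, Bool.and_eq_true] at hwf
    obtain ⟨fa, fb, fc⟩ := hfit
    obtain ⟨Ta, hTa, τa, ea, pa⟩ := a.exec_compile hn hS hwf.1.1.1 fa ht hrep hσ
    obtain ⟨Tb, hTb, τb, eb, pb⟩ := b.exec_compile hn hS hwf.1.1.2 fb ht1 pa.rep pa.fits
    have ha : τb.reg tempBase = a.eval S := by rw [pb.keep _ (by omega), pa.value]
    have hh : (Test.eq tempBase (tempBase + 1)).Holds τb ↔ a.eval S = b.eval S := by
      simp [Test.Holds, ha, pb.value]
    by_cases hc : a.eval S = b.eval S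
    · rw [if_pos hc] at fc
      obtain ⟨Tx, hTx, τx, ex, rx, fx⟩ := ihp hwf.1.2 hS fc pb.rep pb.fits
      exact ⟨Ta + (Tb + (Tx + 1)), by simp only [cost]; omega, τx,
        .seq ea (.seq eb (.ite_true (hh.2 hc) ex)), by simpa only [eval, if_pos hc] using rx, fx⟩
    · rw [if_neg hc] at fc
      obtain ⟨Tx, hTx, τx, ex, rx, fx⟩ := ihq hwf.2 hS fc pb.rep pb.fits
      exact ⟨Ta + (Tb + (Tx + 1)), by simp only [cost]; omega, τx,
        .seq ea (.seq eb (.ite_false (mt hh.1 hc) ex)), by simpa only [eval, if_neg hc] using rx,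
        fx⟩
  | ifLt a b p q ihp ihq =>
    simp only [WF, Bool.and_eq_true] at hwf
    obtain ⟨fa, fb, fc⟩ := hfit
    obtain ⟨Ta, hTa, τa, ea, pa⟩ := a.exec_compile hn hS hwf.1.1.1 fa ht hrep hσ
    obtain ⟨Tb, hTb, τb, eb, pb⟩ := b.exec_compile hn hS hwf.1.1.2 fb ht1 pa.rep pa.fits
    have ha : τb.reg tempBase = a.eval S := by rw [pb.keep _ (by omega), pa.value]
    have hh : (Test.lt tempBase (tempBase + 1)).Holds τb ↔ a.eval S < b.eval S := by
      simp [Test.Holds, ha, pb.value]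
    by_cases hc : a.eval S < b.eval S
    · rw [if_pos hc] at fc
      obtain ⟨Tx, hTx, τx, ex, rx, fx⟩ := ihp hwf.1.2 hS fc pb.rep pb.fits
      exact ⟨Ta + (Tb + (Tx + 1)), by simp only [cost]; omega, τx,
        .seq ea (.seq eb (.ite_true (hh.2 hc) ex)), by simpa only [eval, if_pos hc] using rx, fx⟩
    · rw [if_neg hc] at fc
      obtain ⟨Tx, hTx, τx, ex, rx, fx⟩ := ihq hwf.2 hS fc pb.rep pb.fits
      exact ⟨Ta + (Tb + (Tx + 1)), by simp only [cost]; omega, τx,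
        .seq ea (.seq eb (.ite_false (mt hh.1 hc) ex)), by simpa only [eval, if_neg hc] using rx,
        fx⟩
  | loop r p ih =>
    simp only [WF, Bool.and_eq_true, bne_iff_ne, ne_eq, decide_eq_true_eq, Bool.not_eq_eq_eq_not,
      Bool.not_true, List.contains_eq_mem, decide_eq_false_iff_not] at hwf
    obtain ⟨⟨⟨hr0, hrt⟩, hwfp⟩, hrp⟩ := hwf
    simp only [Fits, hS] at hfit
    have hv0 : ∀ j, (rounds p.eval r S j).var 0 = n := by
      intro j
      induction j with
      | zero => simp [rounds, Env.setVar, Ne.symm hr0, hS]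
      | succ j ihj =>
        simp [rounds, Env.setVar, Ne.symm hr0, eval_var_of_notMem _ (zero_notMem_writes hwfp), ihj]
    have hnw : n < 2 ^ w := by
      rcases Nat.eq_zero_or_pos n with h | h
      · omega
      · nlinarith
    -- Induction on the number `d` of rounds that remain, so that the final state, the one after `n`
    -- rounds, stays fixed.
    have main : ∀ d j, j + d = n → ∀ σ, Rep n (rounds p.eval r S j) σ → σ.Fits w →
        ∃ T ≤ d * (p.cost n + 3) + 1, ∃ τ, Exec w (.while (.lt r 0) (.seq p.compile
          (.seq (.instr (.const tempBase 1)) (.instr (.add r r tempBase))))) σ T τ ∧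
          Rep n (rounds p.eval r S n) τ ∧ τ.Fits w := by
      intro d
      induction d with
      | zero =>
        intro j hj σ hrep hσ
        obtain rfl : j = n := by omega
        refine ⟨1, by omega, σ, .while_false ?_, hrep, hσ⟩
        simp [Test.Holds, h0 (hv0 _) hrep, hrep.reg r hrt, rounds_var_counter]
      | succ d ihd =>
        intro j hj σ hrep hσ
        have hreg : σ.reg r = j := by rw [hrep.reg r hrt, rounds_var_counter]
        have hlt : (Test.lt r 0).Holds σ := by
          simp only [Test.Holds, h0 (hv0 _) hrep, hreg]; omega
        obtain ⟨T1, hT1, τ1, e1, r1, f1⟩ := ih hwfp (hv0 j) (hfit j (by omega)) hrep hσ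
        have r2 : Rep n (p.eval (rounds p.eval r S j)) ((Instr.const tempBase 1).next τ1) :=
          r1.setTemp le_rfl _
        have f2 : ((Instr.const tempBase 1).next τ1).Fits w := f1.setReg _ h1
        have v3 : (Instr.add r r tempBase).result ((Instr.const tempBase 1).next τ1) = j + 1 := by
          have : r ≠ tempBase := by omega
          simp [Instr.result, Instr.next, State.setReg, this, r1.reg r hrt,
            eval_var_of_notMem _ hrp, rounds_var_counter]
        have l3 : (Instr.add r r tempBase).result ((Instr.const tempBase 1).next τ1) < 2 ^ w := by
          rw [v3]; omega
        have r3 : Rep n (rounds p.eval r S (j + 1))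
            ((Instr.add r r tempBase).next ((Instr.const tempBase 1).next τ1)) := by
          change Rep n ((p.eval (rounds p.eval r S j)).setVar r (j + 1)) (State.setReg _ r
            ((Instr.add r r tempBase).result _))
          rw [v3]
          exact r2.setVar r (j + 1)
        have f3 := f2.setReg r l3
        obtain ⟨T2, hT2, τ2, e2, r4, f4⟩ := ihd (j + 1) (by omega) _ r3 f3
        refine ⟨(T1 + (1 + 1)) + 1 + T2, ?_, τ2,
          .while_true hlt (.seq e1 (.seq (.instr _ _ h1) (.instr _ _ l3))) e2, r4, f4⟩
        rw [add_mul]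
        omega
    have hpos : (0 : ℕ) < 2 ^ w := by positivity
    have r0 : Rep n (rounds p.eval r S 0) ((Instr.const r 0).next σ) := hrep.setVar r 0
    have f0 : ((Instr.const r 0).next σ).Fits w := hσ.setReg r hpos
    obtain ⟨T, hT, τ, ex, rx, fx⟩ := main n 0 (by omega) _ r0 f0
    refine ⟨1 + T, by simp only [cost]; omega, τ, .seq (.instr _ _ hpos) ex, ?_, fx⟩
    simpa only [eval, hS] using rx

/-! ### Weakest preconditions -/

/-- From `S` the command runs without error and ends in a state with property `Q`. -/
def WP (w : ℕ) (c : Cmd) (S : Env) (Q : Env → Prop) : Prop :=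
  c.Fits w S ∧ Q (c.eval S)

/-- Only variables in `vs` and arrays in `ms` differ. -/
structure Frame (vs ms : List ℕ) (S S' : Env) : Prop where
  var : ∀ r, r ∉ vs → S'.var r = S.var r
  mat : ∀ m, m ∉ ms → S'.mat m = S.mat m

theorem Cmd.frame (c : Cmd) (S : Env) : Frame c.writes c.banks S (c.eval S) :=
  ⟨fun _ h => c.eval_var_of_notMem h S, fun _ h => c.eval_mat_of_notMem h S⟩

namespace WP

variable {w : ℕ} {S : Env} {Q R : Env → Prop}

theorem mono {c : Cmd} (h : WP w c S Q) (hQ : ∀ S', Frame c.writes c.banks S S' → Q S' → R S') :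
    WP w c S R :=
  ⟨h.1, hQ _ (c.frame S) h.2⟩

@[simp] theorem skip : WP w .skip S Q ↔ Q S := by simp [WP, Cmd.Fits, Cmd.eval]

@[simp] theorem set {r : ℕ} {e : Exp} :
    WP w (.set r e) S Q ↔ e.Fits w S ∧ Q (S.setVar r (e.eval S)) := Iff.rfl

@[simp] theorem put {m : ℕ} {i j e : Exp} :
    WP w (.put m i j e) S Q ↔ (i.Fits w S ∧ j.Fits w S ∧ e.Fits w S ∧ i.eval S < S.var 0 ∧
      j.eval S < S.var 0) ∧ Q (S.setMat m (i.eval S) (j.eval S) (e.eval S)) := Iff.rfl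

@[simp] theorem seq {p q : Cmd} : WP w (p ;; q) S Q ↔ WP w p S (fun S' => WP w q S' Q) := by
  simp [WP, Cmd.Fits, Cmd.eval, and_assoc]

@[simp] theorem ifEq {a b : Exp} {p q : Cmd} : WP w (.ifEq a b p q) S Q ↔ a.Fits w S ∧ b.Fits w S ∧
    ((a.eval S = b.eval S → WP w p S Q) ∧ (a.eval S ≠ b.eval S → WP w q S Q)) := by
  simp only [WP, Cmd.Fits, Cmd.eval]
  split_ifs with h <;> simp [h, and_assoc]

@[simp] theorem ifLt {a b : Exp} {p q : Cmd} : WP w (.ifLt a b p q) S Q ↔ a.Fits w S ∧ b.Fits w S ∧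
    ((a.eval S < b.eval S → WP w p S Q) ∧ (¬ a.eval S < b.eval S → WP w q S Q)) := by
  simp only [WP, Cmd.Fits, Cmd.eval]
  split_ifs with h <;> simp [h, and_assoc]

/-- The invariant only has to describe what the body changes: that everything else agrees with the
state before the loop is supplied by the frame. -/
theorem loop (I : ℕ → Env → Prop) {r : ℕ} {p : Cmd} (h0 : I 0 (S.setVar r 0))
    (hstep : ∀ j S', j < S.var 0 → S'.var r = j → Frame (r :: p.writes) p.banks S S' → I j S' →
      WP w p S' (fun S'' => I (j + 1) (S''.setVar r (j + 1))))
    (hQ : ∀ S', S'.var r = S.var 0 → Frame (r :: p.writes) p.banks S S' → I (S.var 0) S' → Q S') :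
    WP w (.loop r p) S Q := by
  have hfr : ∀ j, Frame (r :: p.writes) p.banks S (Cmd.rounds p.eval r S j) := by
    intro j
    induction j with
    | zero =>
      refine ⟨fun x hx => ?_, fun _ _ => rfl⟩
      simp only [List.mem_cons, not_or] at hx
      simp [Cmd.rounds, Env.setVar, hx.1]
    | succ j ih =>
      refine ⟨fun x hx => ?_, fun m hm => ?_⟩
      · have := ih.var x hx
        simp only [List.mem_cons, not_or] at hx
        simp [Cmd.rounds, Env.setVar, hx.1, p.eval_var_of_notMem hx.2, this]
      · simp [Cmd.rounds, Env.setVar, p.eval_mat_of_notMem hm, ih.mat m hm]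
  have hI : ∀ j, j ≤ S.var 0 → I j (Cmd.rounds p.eval r S j) := by
    intro j
    induction j with
    | zero => intro _; exact h0
    | succ j ih =>
      intro hj
      exact (hstep j _ (by omega) (Cmd.rounds_var_counter _ _ _ _) (hfr j) (ih (by omega))).2
  exact ⟨fun j hj => (hstep j _ hj (Cmd.rounds_var_counter _ _ _ _) (hfr j) (hI j hj.le)).1,
    hQ _ (Cmd.rounds_var_counter _ _ _ _) (hfr _) (hI _ le_rfl)⟩

end WP

end WordRAM

/-! ## Cuts and flows -/

open Finset in
/-- The capacity of the arcs leaving `X`. -/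
def cutCap {V : Type*} [Fintype V] [DecidableEq V] (c : V → V → ℕ) (X : Finset V) : ℕ :=
  ∑ u ∈ X, ∑ v ∈ Xᶜ, c u v

/-- The net amount of `f` leaving `v`. -/
def netOut {V : Type*} [Fintype V] (f : V → V → ℤ) (v : V) : ℤ :=
  ∑ u, f v u - ∑ u, f u v

/-- This replaces the growing of a path: `P Z` says how far one has come, and maximality yields the
contradiction or the saturated cut. -/
theorem exists_maximal_insert {V : Type*} [Fintype V] [DecidableEq V] (P : Finset V → Prop) {Z : Finset V} (h : P Z) :
    ∃ Z, P Z ∧ ∀ u ∉ Z, ¬ P (insert u Z) := by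
  by_contra! hc
  have : ∀ m, ∃ Z, P Z ∧ m ≤ Z.card := by
    intro m
    induction m with
    | zero => exact ⟨Z, h, by omega⟩
    | succ m ih =>
      obtain ⟨Z, hZ, hm⟩ := ih
      obtain ⟨u, hu, hP⟩ := hc Z hZ
      exact ⟨_, hP, by rw [Finset.card_insert_of_notMem hu]; omega⟩
  obtain ⟨Z, -, hZ⟩ := this (Fintype.card V + 1)
  have := Z.card_le_univ
  omega

theorem netOut_add {V : Type*} [Fintype V] (f g : V → V → ℤ) (v : V) :
    netOut (fun a b => f a b + g a b) v = netOut f v + netOut g v := by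
  simp only [netOut, Finset.sum_add_distrib]
  ring

theorem netOut_sub {V : Type*} [Fintype V] (f g : V → V → ℤ) (v : V) :
    netOut (fun a b => f a b - g a b) v = netOut f v - netOut g v := by
  simp only [netOut, Finset.sum_sub_distrib]
  ring

section Cuts

variable {V : Type*} [Fintype V] [DecidableEq V]

theorem cutCap_eq (c : V → V → ℕ) (X : Finset V) :
    cutCap c X = ∑ u, ∑ v, if u ∈ X ∧ v ∉ X then c u v else 0 := by
  rw [cutCap, ← Finset.sum_filter_add_sum_filter_not Finset.univ (· ∈ X)]
  have h0 : ∑ u with u ∉ X, ∑ v, (if u ∈ X ∧ v ∉ X then c u v else 0) = 0 := by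
    refine Finset.sum_eq_zero fun u hu => ?_
    have : u ∉ X := by simpa using hu
    simp [this]
  rw [h0, add_zero]
  have : Finset.univ.filter (· ∈ X) = X := by ext; simp
  rw [this]
  refine Finset.sum_congr rfl fun u hu => ?_
  rw [← Finset.sum_filter]
  simp only [hu, true_and]
  congr 1
  ext; simp

/-- A comparison term by term, in which arcs of capacity zero can be ignored; it transports cuts
between a network and its parts. -/
theorem cutCap_le {c c' : V → V → ℕ} {A B : Finset V}
    (h : ∀ u ∈ A, ∀ v ∉ A, 0 < c u v → u ∈ B ∧ v ∉ B ∧ c u v ≤ c' u v) :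
    cutCap c A ≤ cutCap c' B := by
  rw [cutCap_eq, cutCap_eq]
  refine Finset.sum_le_sum fun u _ => Finset.sum_le_sum fun v _ => ?_
  split_ifs with h1 h2
  · rcases Nat.eq_zero_or_pos (c u v) with h0 | h0
    · omega
    · exact (h u h1.1 v h1.2 h0).2.2
  · rcases Nat.eq_zero_or_pos (c u v) with h0 | h0
    · omega
    · have := h u h1.1 v h1.2 h0
      exact absurd ⟨this.1, this.2.1⟩ h2
  · exact Nat.zero_le _
  · exact Nat.zero_le _

theorem exists_of_cutCap_pos {c : V → V → ℕ} {A : Finset V} (h : 0 < cutCap c A) :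
    ∃ u ∈ A, ∃ v ∉ A, 0 < c u v := by
  by_contra! hc
  have : cutCap c A ≤ cutCap (fun _ _ => 0) A :=
    cutCap_le fun u hu v hv h0 => absurd (hc u hu v hv) (by omega)
  simp only [cutCap, Finset.sum_const_zero] at this h
  omega

theorem le_cutCap (c : V → V → ℕ) {A : Finset V} {u v : V} (hu : u ∈ A) (hv : v ∉ A) :
    c u v ≤ cutCap c A := by
  calc c u v ≤ ∑ v ∈ Aᶜ, c u v :=
        Finset.single_le_sum (f := fun v => c u v) (fun _ _ => Nat.zero_le _) (by simpa using hv)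
    _ ≤ _ := Finset.single_le_sum (f := fun u => ∑ v ∈ Aᶜ, c u v) (fun _ _ => Nat.zero_le _) hu

/-- The sum of the net outflows over a set counts the arcs leaving and entering the set. -/
theorem sum_netOut (f : V → V → ℤ) (X : Finset V) :
    ∑ v ∈ X, netOut f v = ∑ u ∈ X, ∑ v ∈ Xᶜ, f u v - ∑ u ∈ Xᶜ, ∑ v ∈ X, f u v := by
  simp only [netOut, Finset.sum_sub_distrib]
  have h1 : ∀ v, ∑ u, f v u = ∑ u ∈ X, f v u + ∑ u ∈ Xᶜ, f v u := fun v =>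
    (Finset.sum_add_sum_compl X _).symm
  have h2 : ∀ v, ∑ u, f u v = ∑ u ∈ X, f u v + ∑ u ∈ Xᶜ, f u v := fun v =>
    (Finset.sum_add_sum_compl X _).symm
  simp only [h1, h2, Finset.sum_add_distrib]
  rw [Finset.sum_comm (s := X) (t := X), Finset.sum_comm (s := Xᶜ) (t := X)]
  ring

def unitArc (a b : V) (u v : V) : ℤ := if u = a ∧ v = b then 1 else 0

theorem netOut_unitArc (a b v : V) :
    netOut (unitArc a b) v = (if v = a then 1 else 0) - (if v = b then 1 else 0) := by
  simp only [netOut, unitArc]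
  congr 1
  · by_cases h : v = a <;> simp [h]
  · by_cases h : v = b <;> simp [h]

/-- Max-flow min-cut: a flow of value `m` exists if every cut has capacity at least `m`. -/
theorem exists_flow_of_le_cutCap (c : V → V → ℕ) {s t : V} (m : ℕ)
    (h : ∀ X, s ∈ X → t ∉ X → m ≤ cutCap c X) :
    ∃ f : V → V → ℤ, (∀ u v, 0 ≤ f u v ∧ f u v ≤ c u v) ∧
      ∀ v, netOut f v = m * (if v = s then 1 else 0) - m * (if v = t then 1 else 0) := by
  induction m with
  | zero => exact ⟨fun _ _ => 0, fun u v => ⟨le_rfl, by positivity⟩, fun v => by simp [netOut]⟩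
  | succ m ih =>
    obtain ⟨f, hf, hdiv⟩ := ih fun X hs ht => (Nat.le_succ m).trans (h X hs ht)
    -- `Z` plays the role of the vertices reachable from `s` in the residual network: one more unit
    -- can be sent from `s` to each `z ∈ Z`. The last clause, that only arcs inside `Z` change,
    -- leaves the residual arcs on the boundary of `Z` intact.
    obtain ⟨Z, ⟨hsZ, hZ⟩, hmax⟩ := exists_maximal_insert (fun Z => s ∈ Z ∧ ∀ z ∈ Z,
      ∃ g : V → V → ℤ, (∀ u v, 0 ≤ g u v ∧ g u v ≤ c u v) ∧
        (∀ v, netOut g v = netOut f v + (if v = s then 1 else 0) - (if v = z then 1 else 0)) ∧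
        ∀ a b, a ∉ Z ∨ b ∉ Z → g a b = f a b) (Z := {s})
      ⟨by simp, fun z hz => ⟨f, hf, fun v => by
        rw [Finset.mem_singleton.1 hz]; ring, fun _ _ _ => rfl⟩⟩
    by_cases ht : t ∈ Z
    · obtain ⟨g, hg, hgd, -⟩ := hZ t ht
      refine ⟨g, hg, fun v => ?_⟩
      rw [hgd, hdiv]
      push_cast
      ring
    · exfalso
      have sat : ∀ u ∈ Z, ∀ v ∉ Z, f u v = c u v ∧ f v u = 0 := by
        intro u hu v hv
        have hvu : ¬ (v = u) := fun e => hv (e ▸ hu)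
        obtain ⟨g, hg, hgd, hgf⟩ := hZ u hu
        have e1 := hgf u v (.inr hv)
        have e2 := hgf v u (.inl hv)
        -- If the extra unit at `u` could be moved on to `v`, then `v` could be added to `Z`.
        have step : ∀ g' : V → V → ℤ, (∀ a b, 0 ≤ g' a b ∧ g' a b ≤ c a b) →
            (∀ x, netOut g' x = netOut g x + (if x = u then 1 else 0) - if x = v then 1 else 0) →
            (∀ a b, a ∉ insert v Z ∨ b ∉ insert v Z → g' a b = g a b) → False := by
          intro g' h1 h2 h3
          refine hmax v hv ⟨Finset.mem_insert_of_mem hsZ, fun z hz => ?_⟩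
          rcases Finset.mem_insert.1 hz with rfl | hz
          · refine ⟨g', h1, fun x => by rw [h2, hgd]; ring, fun a b hab => ?_⟩
            rw [h3 a b hab, hgf a b]
            simp only [Finset.mem_insert, not_or] at hab
            tauto
          · obtain ⟨g₀, k1, k2, k3⟩ := hZ z hz
            refine ⟨g₀, k1, k2, fun a b hab => k3 a b ?_⟩
            simp only [Finset.mem_insert, not_or] at hab
            tauto
        constructor
        · by_contra hne
          refine step (fun a b => g a b + unitArc u v a b) (fun a b => ?_) (fun x => ?_)
            fun a b hab => ?_
          · have := hg a b
            have := hf u v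
            simp only [unitArc]
            split_ifs with hab
            · obtain ⟨rfl, rfl⟩ := hab
              omega
            · omega
          · rw [netOut_add, netOut_unitArc]; ring
          · have : ¬ (a = u ∧ b = v) := by
              rintro ⟨rfl, rfl⟩
              simp [hu] at hab
            simp [unitArc, this]
        · by_contra hne
          refine step (fun a b => g a b - unitArc v u a b) (fun a b => ?_) (fun x => ?_)
            fun a b hab => ?_
          · have := hg a b
            have := hf v u
            simp only [unitArc]
            split_ifs with hab
            · obtain ⟨rfl, rfl⟩ := hab
              omega
            · omega
          · rw [netOut_sub, netOut_unitArc]; ring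
          · have : ¬ (a = v ∧ b = u) := by
              rintro ⟨rfl, rfl⟩
              simp [hu] at hab
            simp [unitArc, this]
      -- Arcs out of `Z` are saturated and arcs into `Z` are empty, so the cut has capacity exactly
      -- `m`.
      have hsum := sum_netOut f Z
      have e1 : ∑ u ∈ Z, ∑ v ∈ Zᶜ, f u v = (cutCap c Z : ℤ) := by
        rw [cutCap]
        push_cast
        exact Finset.sum_congr rfl fun u hu => Finset.sum_congr rfl fun v hv =>
          (sat u hu v (by simpa using hv)).1
      have e2 : ∑ u ∈ Zᶜ, ∑ v ∈ Z, f u v = 0 :=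
        Finset.sum_eq_zero fun u hu => Finset.sum_eq_zero fun v hv =>
          (sat v hv u (by simpa using hu)).2
      have e3 : ∑ v ∈ Z, netOut f v = m := by
        simp [hdiv, Finset.sum_sub_distrib, hsZ, ht]
      have := h Z hsZ ht
      rw [e1, e2, e3] at hsum
      omega

/-- Max-flow min-cut with capacities `κ` of the vertices and an additional arc of capacity `δ` from
`s` to `w` that does not use the capacity of `s`. -/
theorem exists_flow_of_vertex_capacities (c : V → V → ℕ) (κ : V → ℕ) {s t w : V}
    (δ m : ℕ)
    (h : ∀ A B : Finset V, s ∈ A → t ∉ A → m ≤ (if w ∈ A then 0 else δ) +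
      (∑ v ∈ A \ B, κ v + ∑ u ∈ B, ∑ v ∈ Aᶜ, c u v)) :
    ∃ (y : V → V → ℕ) (d : ℕ), (∀ u v, y u v ≤ c u v) ∧ d ≤ δ ∧ (∀ v, ∑ u, y v u ≤ κ v) ∧
      ∀ v, netOut (fun a b => (y a b : ℤ) + d * unitArc s w a b) v =
        m * (if v = s then 1 else 0) - m * (if v = t then 1 else 0) := by
  -- Vertex splitting: `(v, false)` receives the arcs into `v`, `(v, true)` emits the arcs out of
  -- `v`, and the arc between the copies has capacity `κ v`. The additional arc joins the receiving
  -- copies of `s` and `w` and so bypasses `κ s`.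
  let C : V × Bool → V × Bool → ℕ := fun p q =>
    if p.2 then (if q.2 then 0 else c p.1 q.1)
    else (if q.2 then (if p.1 = q.1 then κ p.1 else 0) else if p.1 = s ∧ q.1 = w then δ else 0)
  obtain ⟨f, hf, hdiv⟩ := exists_flow_of_le_cutCap C (s := (s, false)) (t := (t, false)) m (by
    intro X hs ht
    let A : Finset V := Finset.univ.filter fun v => (v, false) ∈ X
    let B : Finset V := Finset.univ.filter fun v => (v, true) ∈ X
    have hsA : s ∈ A := by simpa [A] using hs
    refine (h A B hsA (by simpa [A] using ht)).trans ?_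
    rw [cutCap_eq, Fintype.sum_prod_type]
    simp only [Fintype.sum_bool, Fintype.sum_prod_type, C]
    simp only [if_true, Bool.false_eq_true, if_false, ite_self, zero_add,
      Finset.sum_add_distrib]
    have e1 : (if w ∈ A then 0 else δ) ≤ ∑ x : V, ∑ y : V,
        (if (x, false) ∈ X ∧ (y, false) ∉ X then (if x = s ∧ y = w then δ else 0) else 0) := by
      refine le_trans ?_ (Finset.single_le_sum (f := fun x => ∑ y : V,
        (if (x, false) ∈ X ∧ (y, false) ∉ X then (if x = s ∧ y = w then δ else 0) else 0))
        (fun _ _ => Nat.zero_le _) (Finset.mem_univ s))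
      refine le_trans ?_ (Finset.single_le_sum (f := fun y =>
        (if (s, false) ∈ X ∧ (y, false) ∉ X then (if s = s ∧ y = w then δ else 0) else 0))
        (fun _ _ => Nat.zero_le _) (Finset.mem_univ w))
      simp [A, hs]
    have e2 : ∑ v ∈ A \ B, κ v ≤ ∑ x : V, ∑ y : V,
        (if (x, false) ∈ X ∧ (y, true) ∉ X then (if x = y then κ x else 0) else 0) := by
      refine le_trans ?_ (Finset.sum_le_sum_of_subset (Finset.subset_univ (A \ B)))
      refine Finset.sum_le_sum fun v hv => ?_
      refine le_trans ?_ (Finset.single_le_sum (f := fun y =>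
        (if (v, false) ∈ X ∧ (y, true) ∉ X then (if v = y then κ v else 0) else 0))
        (fun _ _ => Nat.zero_le _) (Finset.mem_univ v))
      have : (v, false) ∈ X ∧ (v, true) ∉ X := by simpa [A, B] using hv
      simp [this]
    have e3 : ∑ u ∈ B, ∑ v ∈ Aᶜ, c u v ≤ ∑ x : V, ∑ y : V,
        (if (x, true) ∈ X ∧ (y, false) ∉ X then c x y else 0) := by
      refine le_trans ?_ (Finset.sum_le_sum_of_subset (Finset.subset_univ B))
      refine Finset.sum_le_sum fun u hu => ?_
      refine le_trans ?_ (Finset.sum_le_sum_of_subset (Finset.subset_univ Aᶜ))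
      refine Finset.sum_le_sum fun v hv => ?_
      have h1 : (u, true) ∈ X := by simpa [B] using hu
      have h2 : (v, false) ∉ X := by simpa [A] using hv
      simp [h1, h2]
    omega)
  have z1 : ∀ u v, f (u, true) (v, true) = 0 := fun u v => by
    have := hf (u, true) (v, true); simp [C] at this; omega
  have z2 : ∀ u v, u ≠ v → f (u, false) (v, true) = 0 := fun u v huv => by
    have := hf (u, false) (v, true); simp [C, huv] at this; omega
  have z3 : ∀ u v, ¬ (u = s ∧ v = w) → f (u, false) (v, false) = 0 := fun u v huv => by
    have := hf (u, false) (v, false)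
    simp only [C, Bool.false_eq_true, if_false, huv] at this
    omega
  have hd := hf (s, false) (w, false)
  have hy := fun u v => hf (u, true) (v, false)
  simp only [C, Bool.false_eq_true, if_false, if_true, and_self] at hd hy
  have s2 : ∀ v, ∑ u, f (v, false) (u, true) = f (v, false) (v, true) := fun v =>
    Finset.sum_eq_single v (fun u _ hu => z2 v u hu.symm) (by simp)
  have s2' : ∀ v, ∑ u, f (u, false) (v, true) = f (v, false) (v, true) := fun v =>
    Finset.sum_eq_single v (fun u _ hu => z2 u v hu) (by simp)
  obtain ⟨D, hD⟩ : ∃ D, D = f (s, false) (w, false) := ⟨_, rfl⟩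
  rw [← hD] at hd
  have s3 : ∀ u v, f (u, false) (v, false) = D * unitArc s w u v := by
    intro u v
    by_cases huv : u = s ∧ v = w
    · simp [unitArc, huv, hD]
    · simp [unitArc, huv, z3 u v huv]
  -- Conservation at the emitting copy; this is what bounds the outflow of `v` by `κ v`.
  have dout : ∀ v, ∑ u, f (v, true) (u, false) = f (v, false) (v, true) := by
    intro v
    have := hdiv (v, true)
    simp only [netOut, Fintype.sum_prod_type, Fintype.sum_bool, Finset.sum_add_distrib, z1, s2',
      Prod.mk.injEq, Bool.true_eq_false, and_false, if_false, Finset.sum_const_zero] at this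
    linarith
  refine ⟨fun u v => (f (u, true) (v, false)).toNat, D.toNat, ?_, ?_, ?_,
    ?_⟩
  · intro u v
    have := hy u v
    simp only
    omega
  · omega
  · intro v
    simp only
    have h1 := dout v
    have h2 := hf (v, false) (v, true)
    simp only [C, Bool.false_eq_true, if_false, if_true] at h2
    have : ((∑ u, (f (v, true) (u, false)).toNat : ℕ) : ℤ) = f (v, false) (v, true) := by
      rw [← h1]
      push_cast
      exact Finset.sum_congr rfl fun u _ => by simp [(hy v u).1]
    omega
  · intro v
    have := hdiv (v, false)
    simp only [netOut, Fintype.sum_prod_type, Fintype.sum_bool, Finset.sum_add_distrib, s2, s3,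
      Prod.mk.injEq, and_true] at this
    rw [← this, netOut, Int.toNat_of_nonneg hd.1]
    simp only [Int.toNat_of_nonneg (hy _ _).1, Finset.sum_add_distrib, dout]

end Cuts

/-! ## Which networks have a degree bounded flow -/

section Characterization

/-- Each positive integer is at least 1; hence a bound on the outflow of a vertex is a bound on its
out-degree in the support. -/
theorem card_pos_le_sum {V : Type*} [Fintype V] (x : V → ℕ) : (Finset.univ.filter fun u => 0 < x u).card ≤ ∑ u, x u := by
  rw [Finset.card_filter]
  refine Finset.sum_le_sum fun u _ => ?_
  split_ifs <;> omega

variable {V : Type*} [Fintype V] [DecidableEq V]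

/-- `x` is a flow of value `k + 1` below `c` with at most `k` support arcs leaving any vertex. -/
structure IsDegreeBoundedFlow (c : V → V → ℕ) (s t : V) (k : ℕ) (x : V → V → ℕ) : Prop where
  le : ∀ u v, x u v ≤ c u v
  netOut_eq : ∀ v, netOut (fun a b => (x a b : ℤ)) v =
    ((k + 1 : ℕ) : ℤ) * (if v = s then 1 else 0) - ((k + 1 : ℕ) : ℤ) * (if v = t then 1 else 0)
  degree_le : ∀ v, (Finset.univ.filter fun u => 0 < x v u).card ≤ k

/-- The vertex `a` is on all paths from `s` to `t`. -/
def Separates (c : V → V → ℕ) (s t a : V) : Prop :=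
  ∃ X : Finset V, s ∈ X ∧ a ∈ X ∧ t ∉ X ∧ ∀ u ∈ X, u ≠ a → ∀ v ∉ X, c u v = 0

/-- Deletion of the vertex `a`. -/
def deleteVertex (c : V → V → ℕ) (a u v : V) : ℕ := if u = a ∨ v = a then 0 else c u v

/-- Some arc `aw` can carry two units on their way to `t`. -/
def HasDoubleArc (c : V → V → ℕ) (t a : V) : Prop :=
  ∃ w, 2 ≤ c a w ∧ ∀ Y : Finset V, w ∈ Y → t ∉ Y → 2 ≤ cutCap (deleteVertex c a) Y

/-- Two units of the arc `sw` are reserved for an extra arc that does not count towards the capacity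
`k - 1` of `s`; the other vertices get capacity `k`. A flow of value `k + 1` then has at most `(k -
1) + 1` support arcs at `s` and at most `k` elsewhere. -/
theorem exists_isDegreeBoundedFlow_of_not_separates {c : V → V → ℕ} {s t : V} {k : ℕ} (hk : 2 ≤ k)
    (hst : s ≠ t) (hcut : ∀ X, s ∈ X → t ∉ X → k + 1 ≤ cutCap c X) (hs : HasDoubleArc c t s)
    (hsep : ∀ a, a ≠ s → a ≠ t → ¬ Separates c s t a) : ∃ x, IsDegreeBoundedFlow c s t k x := by
  obtain ⟨w, hw, hwcut⟩ := hs
  let c' : V → V → ℕ := fun u v => if u = s ∧ v = w then c u v - 2 else c u v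
  let κ : V → ℕ := fun v => if v = s then k - 1 else k
  have hc' : ∀ u v, u ≠ s ∨ v ≠ w → c' u v = c u v := by
    intro u v h
    simp only [c']
    rw [if_neg]
    tauto
  have hcut' : ∀ X, s ∈ X → t ∉ X → k + 1 ≤ cutCap c' X + if w ∈ X then 0 else 2 := by
    intro X hsX htX
    refine (hcut X hsX htX).trans ?_
    split_ifs with hwX
    · refine cutCap_le fun u hu v hv _ => ⟨hu, hv, (hc' u v (.inr ?_)).ge⟩
      rintro rfl
      exact hv hwX
    · rw [cutCap_eq, cutCap_eq]
      have h2 : (2 : ℕ) = ∑ u, ∑ v, if u = s ∧ v = w then 2 else 0 := by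
        rw [Finset.sum_eq_single s, Finset.sum_eq_single w] <;> simp +contextual
      conv_rhs => rw [h2]
      rw [← Finset.sum_add_distrib]
      refine Finset.sum_le_sum fun u _ => ?_
      rw [← Finset.sum_add_distrib]
      refine Finset.sum_le_sum fun v _ => ?_
      simp only [c']
      split_ifs <;> omega
  obtain ⟨y, d, hy, hd, hκ, hdiv⟩ := exists_flow_of_vertex_capacities c' κ (s := s) (t := t)
    (w := w) 2 (k + 1) (by
    intro A B hsA htA
    have hrest : A ⊆ B → cutCap c' A ≤ ∑ u ∈ B, ∑ v ∈ Aᶜ, c' u v := fun hAB =>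
      Finset.sum_le_sum_of_subset hAB
    have hsingle : ∀ v ∈ A \ B, κ v ≤ ∑ v ∈ A \ B, κ v := fun v hv =>
      Finset.single_le_sum (f := κ) (fun _ _ => Nat.zero_le _) hv
    have hks : κ s = k - 1 := by simp [κ]
    have hkn : ∀ v, v ≠ s → κ v = k := fun v hv => by simp [κ, hv]
    -- The cut consists of the capacities of the vertices in `A \ B`, of arcs from `B` out of `A`,
    -- and of 2 if `w ∉ A`. With `A ⊆ B` it is a cut of the original network. With one vertex `v ≠
    -- s` in `A \ B` there are `k` units plus the extra arc, or plus an arc that exists because `v`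
    -- does not separate. With `s` alone there are `k - 1` units plus 2, from the extra arc or from
    -- the cut of `D - s`. Two vertices give at least `2k - 1 ≥ k + 1`, as `k ≥ 2`.
    by_cases hsB : s ∈ B
    · by_cases hAB : A ⊆ B
      · have := hcut' A hsA htA
        have := hrest hAB
        omega
      · obtain ⟨v, hvA, hvB⟩ := Finset.not_subset.1 hAB
        have hvs : v ≠ s := fun e => hvB (e ▸ hsB)
        have h1 := hsingle v (by simp [hvA, hvB])
        rw [hkn v hvs] at h1
        by_cases hwA : w ∈ A
        · rw [if_pos hwA]
          by_cases hone : A.erase v ⊆ B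
          · have hvt : v ≠ t := fun e => htA (e ▸ hvA)
            have := hsep v hvs hvt
            simp only [Separates, not_exists, not_and, not_forall] at this
            obtain ⟨u, huA, huv, z, hz, hc⟩ := this A hsA hvA htA
            have huB : u ∈ B := hone (Finset.mem_erase.2 ⟨huv, huA⟩)
            have hzw : z ≠ w := fun e => hz (e ▸ hwA)
            have h2 : c' u z ≤ ∑ u ∈ B, ∑ v ∈ Aᶜ, c' u v :=
              (Finset.single_le_sum (f := fun z => c' u z) (fun _ _ => Nat.zero_le _)
                (Finset.mem_compl.2 hz)).trans
              (Finset.single_le_sum (f := fun u => ∑ v ∈ Aᶜ, c' u v) (fun _ _ => Nat.zero_le _) huB)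
            rw [hc' u z (.inr hzw)] at h2
            omega
          · obtain ⟨v', hv', hvB'⟩ := Finset.not_subset.1 hone
            obtain ⟨hne, hvA'⟩ := Finset.mem_erase.1 hv'
            have hvs' : v' ≠ s := fun e => hvB' (e ▸ hsB)
            have h2 : ∑ v ∈ {v, v'}, κ v ≤ ∑ v ∈ A \ B, κ v :=
              Finset.sum_le_sum_of_subset (by
                intro x hx
                simp only [Finset.mem_insert, Finset.mem_singleton] at hx
                rcases hx with rfl | rfl <;> simp [*])
            rw [Finset.sum_pair hne.symm, hkn v hvs, hkn v' hvs'] at h2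
            omega
        · rw [if_neg hwA]
          omega
    · have h1 := hsingle s (by simp [hsA, hsB])
      rw [hks] at h1
      by_cases hwA : w ∈ A
      · rw [if_pos hwA]
        have hws : w ≠ s := by
          rintro rfl
          have := hwcut {w} (by simp) (by simpa using hst.symm)
          have h0 : cutCap (deleteVertex c w) {w} = 0 := by simp [cutCap, deleteVertex]
          omega
        by_cases hone : A.erase s ⊆ B
        · have h2 := hwcut (A.erase s) (by simp [hws, hwA]) (by simp [htA])
          have h3 : cutCap (deleteVertex c s) (A.erase s) ≤ ∑ u ∈ B, ∑ v ∈ Aᶜ, c' u v := by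
            refine le_trans ?_ (Finset.sum_le_sum_of_subset hone)
            refine Finset.sum_le_sum fun u hu => ?_
            have hus : u ≠ s := (Finset.mem_erase.1 hu).1
            have : (A.erase s)ᶜ = insert s Aᶜ := by ext x; simp
            rw [this, Finset.sum_insert (by simpa using hsA)]
            have h0 : deleteVertex c s u s = 0 := by simp [deleteVertex]
            rw [h0, zero_add]
            refine Finset.sum_le_sum fun v hv => ?_
            rw [hc' u v (.inl hus), deleteVertex]
            split_ifs <;> omega
          omega
        · obtain ⟨v', hv', hvB'⟩ := Finset.not_subset.1 hone
          obtain ⟨hne, hvA'⟩ := Finset.mem_erase.1 hv'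
          have h2 : ∑ v ∈ {s, v'}, κ v ≤ ∑ v ∈ A \ B, κ v :=
            Finset.sum_le_sum_of_subset (by
              intro x hx
              simp only [Finset.mem_insert, Finset.mem_singleton] at hx
              rcases hx with rfl | rfl <;> simp [*])
          rw [Finset.sum_pair hne.symm, hks, hkn v' hne] at h2
          omega
      · rw [if_neg hwA]
        omega)
  have hx : ∀ a b, ((y a b + if a = s ∧ b = w then d else 0 : ℕ) : ℤ) =
      (y a b : ℤ) + d * unitArc s w a b := by
    intro a b
    simp only [unitArc]
    split_ifs <;> simp
  refine ⟨fun u v => y u v + if u = s ∧ v = w then d else 0, fun u v => ?_, fun v => ?_,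
    fun v => ?_⟩
  · have := hy u v
    simp only [c'] at this
    split_ifs at this ⊢ with h
    · obtain ⟨rfl, rfl⟩ := h
      omega
    · omega
  · simp only [hx]
    exact hdiv v
  · have h1 := (card_pos_le_sum (y v)).trans (hκ v)
    by_cases hv : v = s
    · have h2 : (Finset.univ.filter fun u => 0 < y v u + if v = s ∧ u = w then d else 0) ⊆
          insert w (Finset.univ.filter fun u => 0 < y v u) := by
        intro u hu
        by_cases huw : u = w
        · simp [huw]
        · simpa [huw] using hu
      have h3 := (Finset.card_le_card h2).trans (Finset.card_insert_le _ _)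
      simp only [κ, hv, if_true] at h1 h3 ⊢
      omega
    · simpa [hv, κ] using h1

/-- Induction on the number of vertices with an outgoing arc of positive capacity. At a separating
vertex `b` the network is cut in two; the hypotheses on cuts and on double arcs pass to both parts,
and no vertex emits flow in both. -/
theorem exists_isDegreeBoundedFlow {k : ℕ} (hk : 2 ≤ k) (c : V → V → ℕ) {s t : V} (hst : s ≠ t)
    (hcut : ∀ X, s ∈ X → t ∉ X → k + 1 ≤ cutCap c X)
    (hdbl : ∀ a, a ≠ t → Separates c s t a → HasDoubleArc c t a) :
    ∃ x, IsDegreeBoundedFlow c s t k x := by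
  obtain ⟨r, hr⟩ : ∃ r, (Finset.univ.filter fun u => ∃ v, 0 < c u v).card = r := ⟨_, rfl⟩
  induction r using Nat.strong_induction_on generalizing c s t with
  | _ r ih =>
  by_cases hsep : ∀ a, a ≠ s → a ≠ t → ¬ Separates c s t a
  · refine exists_isDegreeBoundedFlow_of_not_separates hk hst hcut (hdbl s hst ?_) hsep
    -- The source itself always separates, so the hypothesis on double arcs applies to it.
    exact ⟨{s}, by simp, by simp, by simpa using hst.symm, fun u hu hne =>
      absurd (Finset.mem_singleton.1 hu) hne⟩
  push Not at hsep
  obtain ⟨b, hbs, hbt, X, hsX, hbX, htX, hX⟩ := hsep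
  have hpos : ∀ Y, s ∈ Y → t ∉ Y → ∃ u ∈ Y, ∃ v ∉ Y, 0 < c u v := fun Y h1 h2 =>
    exists_of_cutCap_pos (by have := hcut Y h1 h2; omega)
  -- With `R = X \ {b}`, the first part has the arcs with tail in `R`, whose heads lie in `X`; the
  -- second has the arcs with tail outside `R` and head outside `X`. Arcs returning into `X` are
  -- dropped.
  let c₁ : V → V → ℕ := fun u v => if u ∈ X.erase b then c u v else 0
  let c₂ : V → V → ℕ := fun u v => if u ∉ X.erase b ∧ v ∉ X then c u v else 0
  have hR : ∀ {u v}, u ∈ X.erase b → 0 < c u v → v ∈ X := by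
    intro u v hu h0
    by_contra hv
    have := hX u (Finset.mem_of_mem_erase hu) (Finset.ne_of_mem_erase hu) v hv
    omega
  have hc₁ : ∀ {u v}, u ∈ X.erase b → c₁ u v = c u v := fun hu => if_pos hu
  have hc₂ : ∀ {u v}, u ∉ X.erase b → v ∉ X → c₂ u v = c u v := fun hu hv => if_pos ⟨hu, hv⟩
  have hsR : s ∈ X.erase b := Finset.mem_erase.2 ⟨hbs.symm, hsX⟩
  have htR : t ∉ X.erase b := fun h => htX (Finset.mem_of_mem_erase h)
  -- The first part loses the tail of an arc leaving `X`, the second loses `s`.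
  have rank : ∀ c' : V → V → ℕ, (∀ u v, c' u v ≤ c u v) → (∃ u, (∃ v, 0 < c u v) ∧
      ∀ v, c' u v = 0) → (Finset.univ.filter fun u => ∃ v, 0 < c' u v).card < r := by
    rintro c' hle ⟨u, hu, hu0⟩
    rw [← hr]
    refine Finset.card_lt_card ⟨?_, fun hsub => ?_⟩
    · intro z hz
      simp only [Finset.mem_filter, Finset.mem_univ, true_and] at hz ⊢
      obtain ⟨v, hv⟩ := hz
      exact ⟨v, hv.trans_le (hle z v)⟩
    · have := hsub (by simpa using hu : u ∈ _)
      simp [hu0] at this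
  -- A cut `Y` of the first part corresponds to the cut `Y ∩ R` of the whole network, and below a
  -- cut `Y` of the second part to `Y ∪ R`.
  have left : ∀ {Y u v}, b ∉ Y → u ∈ Y ∩ X.erase b → v ∉ Y ∩ X.erase b → 0 < c u v →
      u ∈ Y ∧ u ∈ X.erase b ∧ v ∉ Y := by
    intro Y u v hb hu hv h0
    rw [Finset.mem_inter] at hu hv
    refine ⟨hu.1, hu.2, fun hvY => hv ⟨hvY, Finset.mem_erase.2 ⟨fun e => hb (e ▸ hvY), ?_⟩⟩⟩
    exact hR hu.2 h0
  have right : ∀ {Y u v}, b ∈ Y → u ∈ Y ∪ X.erase b → v ∉ Y ∪ X.erase b → 0 < c u v →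
      u ∈ Y ∧ u ∉ X.erase b ∧ v ∉ Y ∧ v ∉ X := by
    intro Y u v hb hu hv h0
    rw [Finset.mem_union, not_or] at hv
    have hvX : v ∉ X := fun h => hv.2 (Finset.mem_erase.2 ⟨fun e => hv.1 (e ▸ hb), h⟩)
    have huR : u ∉ X.erase b := fun h => hvX (hR h h0)
    exact ⟨(Finset.mem_union.1 hu).resolve_right huR, huR, hv.1, hvX⟩
  obtain ⟨x₁, hx₁⟩ := ih _ (rank c₁ (fun u v => by simp only [c₁]; split_ifs <;> omega) (by
      obtain ⟨u, hu, v, hv, h0⟩ := hpos X hsX htX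
      refine ⟨u, ⟨v, h0⟩, fun z => if_neg fun h => hv (hR h h0)⟩)) c₁ (s := s) (t := b)
    hbs.symm (by
      intro Y hsY hbY
      refine (hcut (Y ∩ X.erase b) (Finset.mem_inter.2 ⟨hsY, hsR⟩)
        (fun h => htR (Finset.mem_inter.1 h).2)).trans (cutCap_le fun u hu v hv h0 => ?_)
      obtain ⟨h1, h2, h3⟩ := left hbY hu hv h0
      exact ⟨h1, h3, (hc₁ h2).ge⟩) (by
      rintro a hab ⟨Y, hsY, haY, hbY, hY⟩
      have key : ∀ u ∈ Y ∩ X.erase b, ∀ v ∉ Y ∩ X.erase b, 0 < c u v → u = a := by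
        intro u hu v hv h0
        by_contra hne
        obtain ⟨h1, h2, h3⟩ := left hbY hu hv h0
        have := hY u h1 hne v h3
        rw [hc₁ h2] at this
        omega
      have htYR : t ∉ Y ∩ X.erase b := fun h => htR (Finset.mem_inter.1 h).2
      obtain ⟨u, hu, v, hv, h0⟩ := hpos (Y ∩ X.erase b) (Finset.mem_inter.2 ⟨hsY, hsR⟩) htYR
      have hua := key u hu v hv h0
      rw [hua] at hu
      have haR := (Finset.mem_inter.1 hu).2
      obtain ⟨w, hw, hwcut⟩ := hdbl a (fun e => htR (e ▸ haR)) ⟨Y ∩ X.erase b,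
        Finset.mem_inter.2 ⟨hsY, hsR⟩, hu, htYR, fun u hu hne v hv => by
          by_contra h0
          exact hne (key u hu v hv (Nat.pos_of_ne_zero h0))⟩
      refine ⟨w, by rwa [hc₁ haR], fun Z hwZ hbZ => ?_⟩
      have hwR : w ∈ X.erase b :=
        Finset.mem_erase.2 ⟨fun e => hbZ (e ▸ hwZ), hR haR (by omega)⟩
      refine (hwcut (Z ∩ X.erase b) (Finset.mem_inter.2 ⟨hwZ, hwR⟩)
        (fun h => htR (Finset.mem_inter.1 h).2)).trans (cutCap_le fun u hu v hv h0 => ?_)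
      have hle : deleteVertex c a u v ≤ c u v := by
        rw [deleteVertex]; split_ifs <;> omega
      obtain ⟨h1, h2, h3⟩ := left hbZ hu hv (by omega)
      refine ⟨h1, h3, ?_⟩
      simp only [deleteVertex, hc₁ h2, le_refl]) rfl
  obtain ⟨x₂, hx₂⟩ := ih _ (rank c₂ (fun u v => by simp only [c₂]; split_ifs <;> omega) (by
      obtain ⟨u, hu, v, hv, h0⟩ := hpos {s} (by simp) (by simpa using hst.symm)
      rw [Finset.mem_singleton] at hu
      subst hu
      exact ⟨u, ⟨v, h0⟩, fun z => if_neg fun h => h.1 hsR⟩)) c₂ (s := b) (t := t) hbt (by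
      intro Y hbY htY
      refine (hcut (Y ∪ X.erase b) (Finset.mem_union.2 (.inr hsR))
        (fun h => (Finset.mem_union.1 h).elim htY htR)).trans (cutCap_le fun u hu v hv h0 => ?_)
      obtain ⟨h1, h2, h3, h4⟩ := right hbY hu hv h0
      exact ⟨h1, h3, (hc₂ h2 h4).ge⟩) (by
      rintro a hat ⟨Y, hbY, haY, htY, hY⟩
      have key : ∀ u ∈ Y ∪ X.erase b, ∀ v ∉ Y ∪ X.erase b, 0 < c u v → u = a := by
        intro u hu v hv h0
        by_contra hne
        obtain ⟨h1, h2, h3, h4⟩ := right hbY hu hv h0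
        have := hY u h1 hne v h3
        rw [hc₂ h2 h4] at this
        omega
      have hsYR : s ∈ Y ∪ X.erase b := Finset.mem_union.2 (.inr hsR)
      have htYR : t ∉ Y ∪ X.erase b := fun h => (Finset.mem_union.1 h).elim htY htR
      obtain ⟨u, hu, v, hv, h0⟩ := hpos (Y ∪ X.erase b) hsYR htYR
      have haR := (right hbY hu hv h0).2.1
      rw [key u hu v hv h0] at haR
      obtain ⟨w, hw, hwcut⟩ := hdbl a hat ⟨Y ∪ X.erase b, hsYR,
        Finset.mem_union.2 (.inl haY), htYR, fun u hu hne v hv => by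
          by_contra h0
          exact hne (key u hu v hv (Nat.pos_of_ne_zero h0))⟩
      have pos_of_delete : ∀ {u v}, 0 < deleteVertex c a u v → u ≠ a ∧ v ≠ a ∧ 0 < c u v := by
        intro u v h
        rw [deleteVertex] at h
        split_ifs at h with h1
        · omega
        · push Not at h1
          exact ⟨h1.1, h1.2, h⟩
      -- All arcs leaving `Y ∪ R` start at `a`, so in `D - a` this set has an empty cut; `w`, from
      -- which two units can reach `t`, cannot be in it.
      have hwYR : w ∉ Y ∪ X.erase b := by
        intro hwY
        obtain ⟨u, hu, v, hv, h0⟩ := exists_of_cutCap_pos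
          (lt_of_lt_of_le Nat.zero_lt_two (hwcut _ hwY htYR))
        obtain ⟨h1, h2, h3⟩ := pos_of_delete h0
        exact h1 (key u hu v hv h3)
      have hwX : w ∉ X := fun h => hwYR (by
        by_cases e : w = b
        · exact Finset.mem_union.2 (.inl (e ▸ hbY))
        · exact Finset.mem_union.2 (.inr (Finset.mem_erase.2 ⟨e, h⟩)))
      refine ⟨w, by rwa [hc₂ haR hwX], fun Z hwZ htZ => ?_⟩
      -- Adding `Y` and `R` to `Z` creates no new arcs in the cut: what leaves `Y ∪ R` starts at the
      -- deleted vertex `a`.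
      refine (hwcut (Z ∪ Y ∪ X.erase b) (by simp [hwZ]) (fun h => (Finset.mem_union.1 h).elim
        (fun h => (Finset.mem_union.1 h).elim htZ htY) htR)).trans
        (cutCap_le fun u hu v hv h0 => ?_)
      obtain ⟨hua, hva, hc⟩ := pos_of_delete h0
      obtain ⟨h1, h2, h3, h4⟩ := right (Finset.mem_union.2 (.inr hbY)) hu hv hc
      have huY : u ∉ Y := fun h => hua (key u (Finset.mem_union.2 (.inl h)) v
        (fun h' => hv (by
          rw [Finset.union_assoc]
          exact Finset.mem_union.2 (.inr h'))) hc)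
      refine ⟨(Finset.mem_union.1 h1).resolve_right huY,
        fun h => h3 (Finset.mem_union.2 (.inl h)), ?_⟩
      simp only [deleteVertex, hc₂ h2 h4, le_refl]) rfl
  have zero₁ : ∀ {u} v, u ∉ X.erase b → x₁ u v = 0 := fun {u} v hu => by
    have := hx₁.le u v
    rw [show c₁ u v = 0 from if_neg hu] at this
    omega
  have zero₂ : ∀ {u} v, u ∈ X.erase b → x₂ u v = 0 := fun {u} v hu => by
    have := hx₂.le u v
    rw [show c₂ u v = 0 from if_neg fun h => h.1 hu] at this
    omega
  refine ⟨fun u v => x₁ u v + x₂ u v, fun u v => ?_, fun v => ?_, fun v => ?_⟩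
  · by_cases hu : u ∈ X.erase b
    · have := hx₁.le u v
      rw [hc₁ hu] at this
      simpa only [zero₂ v hu, add_zero] using this
    · have := hx₂.le u v
      simp only [zero₁ v hu, zero_add]
      refine this.trans ?_
      simp only [c₂]
      split_ifs <;> omega
  · push_cast
    have h1 := hx₁.netOut_eq v
    have h2 := hx₂.netOut_eq v
    push_cast at h1 h2
    rw [netOut_add, h1, h2]
    ring
  · by_cases hv : v ∈ X.erase b
    · simpa only [zero₂ _ hv, add_zero] using hx₁.degree_le v
    · simpa only [zero₁ _ hv, zero_add] using hx₂.degree_le v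

/-- If there is no double arc, each head `w` of a heavy arc at `a` lies in a set `Y w` that avoids
`t` and has cut capacity at most 1 in `D - a`. The union of these sets with `X` is a cut carrying at
most one unit for every support arc at `a`, hence at most `k` units. -/
theorem hasDoubleArc_of_flow {c x : V → V → ℕ} {s t a : V} {k : ℕ} (hle : ∀ u v, x u v ≤ c u v)
    (hcut : ∀ X, s ∈ X → t ∉ X → k + 1 ≤ cutCap x X)
    (hdeg : ∀ v, (Finset.univ.filter fun u => 0 < x v u).card ≤ k)
    (ha : Separates c s t a) : HasDoubleArc c t a := by
  obtain ⟨X, hsX, haX, htX, hX⟩ := ha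
  by_contra hno
  simp only [HasDoubleArc, not_exists, not_and, not_forall, not_le] at hno
  have hY : ∀ w, ∃ Y : Finset V, 2 ≤ c a w →
      w ∈ Y ∧ t ∉ Y ∧ cutCap (deleteVertex c a) Y ≤ 1 := by
    intro w
    by_cases hw : 2 ≤ c a w
    · obtain ⟨Y, h1, h2, h3⟩ := hno w hw
      exact ⟨Y, fun _ => ⟨h1, h2, by omega⟩⟩
    · exact ⟨∅, fun h => absurd h hw⟩
  choose Y hY using hY
  let W := Finset.univ.filter fun v => 0 < x a v
  let H := W.filter fun v => 2 ≤ x a v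
  have hH : ∀ w ∈ H, w ∈ Y w ∧ t ∉ Y w ∧ cutCap (deleteVertex c a) (Y w) ≤ 1 := fun w hw =>
    hY w ((Finset.mem_filter.1 hw).2.trans (hle a w))
  let Z := X ∪ H.biUnion Y
  have htZ : t ∉ Z := by
    simp only [Z, Finset.mem_union, Finset.mem_biUnion, not_or, not_exists, not_and]
    exact ⟨htX, fun w hw => (hH w hw).2.1⟩
  have h1 := hcut Z (Finset.mem_union.2 (.inl hsX)) htZ
  -- An arc with flow out of `Z` either starts at `a` and carries one unit to a light head, or
  -- leaves some `Y w` and avoids `a`; it cannot start in `X \ {a}`, by separation.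
  have h2 : cutCap x Z ≤ ∑ u, ∑ v, ((if u = a ∧ v ∈ W \ H then 1 else 0) +
      ∑ w ∈ H, if u ∈ Y w ∧ v ∉ Y w then deleteVertex c a u v else 0) := by
    rw [cutCap_eq]
    refine Finset.sum_le_sum fun u _ => Finset.sum_le_sum fun v _ => ?_
    split_ifs with huv hua
    · obtain ⟨rfl, hv⟩ := hua
      simp only [H, Finset.mem_sdiff, Finset.mem_filter, not_and, not_le] at hv
      have := hv.2 hv.1
      omega
    · rcases Nat.eq_zero_or_pos (x u v) with h0 | h0
      · omega
      obtain ⟨hu, hv⟩ := huv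
      simp only [Z, Finset.mem_union, Finset.mem_biUnion, not_or, not_exists, not_and] at hu hv
      have hc := hle u v
      have hune : u ≠ a := by
        rintro rfl
        have hvW : v ∈ W := by simpa [W] using h0
        refine hua ⟨rfl, Finset.mem_sdiff.2 ⟨hvW, fun hvH => ?_⟩⟩
        exact hv.2 v hvH (hH v hvH).1
      rcases hu with hu | ⟨w, hw, hu⟩
      · have := hX u hu hune v hv.1
        omega
      · have hva : v ≠ a := fun e => hv.1 (e ▸ haX)
        have h3 := Finset.single_le_sum (f := fun w => if u ∈ Y w ∧ v ∉ Y w then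
          deleteVertex c a u v else 0) (fun _ _ => Nat.zero_le _) hw
        simp only [hu, hv.2 w hw, not_false_eq_true, and_self, if_true] at h3
        rw [show deleteVertex c a u v = c u v by simp [deleteVertex, hune, hva]] at h3 ⊢
        omega
    · exact Nat.zero_le _
    · exact Nat.zero_le _
  have h3 : ∑ u, ∑ v, ((if u = a ∧ v ∈ W \ H then 1 else 0) +
      ∑ w ∈ H, if u ∈ Y w ∧ v ∉ Y w then deleteVertex c a u v else 0) ≤
      (W \ H).card + H.card := by
    simp only [Finset.sum_add_distrib]
    refine add_le_add (le_of_eq ?_) ?_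
    · rw [Finset.sum_eq_single a]
      · rw [Finset.card_eq_sum_ones, ← Finset.sum_filter]
        congr 1
        ext; simp
      · intro u _ hu
        simp [hu]
      · simp
    · have : ∀ u, ∑ v, ∑ w ∈ H, (if u ∈ Y w ∧ v ∉ Y w then deleteVertex c a u v else 0) =
          ∑ w ∈ H, ∑ v, (if u ∈ Y w ∧ v ∉ Y w then deleteVertex c a u v else 0) := fun u =>
        Finset.sum_comm
      simp only [this]
      rw [Finset.sum_comm]
      simp only [← cutCap_eq]
      calc ∑ w ∈ H, cutCap (deleteVertex c a) (Y w) ≤ ∑ w ∈ H, 1 :=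
            Finset.sum_le_sum fun w hw => (hH w hw).2.2
        _ = H.card := by simp
  have h4 : (W \ H).card + H.card = W.card :=
    Finset.card_sdiff_add_card_eq_card (Finset.filter_subset _ _)
  have h5 : W.card ≤ k := hdeg a
  omega

/-- The flow is followed from `s`. `Z` is the part traversed and `z` its only vertex sending flow
out; the one support arc at `z` carries the whole cut, at least 2. If no arc leaving `X` had
capacity 2, the head of that arc would lie in `X` and could be added to `Z`. -/
theorem exists_wide_arc_of_flow {c x : V → V → ℕ} {s t : V} (hle : ∀ u v, x u v ≤ c u v)
    (hcut : ∀ X, s ∈ X → t ∉ X → 2 ≤ cutCap x X)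
    (hdeg : ∀ v, (Finset.univ.filter fun u => 0 < x v u).card ≤ 1) (X : Finset V) (hs : s ∈ X)
    (ht : t ∉ X) : ∃ u ∈ X, ∃ v ∉ X, 2 ≤ c u v := by
  by_contra! hX
  obtain ⟨Z, ⟨hZX, hsZ, z, hz, hZ⟩, hmax⟩ := exists_maximal_insert (fun Z => Z ⊆ X ∧ s ∈ Z ∧
    ∃ z ∈ Z, ∀ u ∈ Z, u ≠ z → ∀ v ∉ Z, x u v = 0) (Z := {s}) ⟨by simpa using hs, by simp, s, by simp,
      fun u hu hne => absurd (Finset.mem_singleton.1 hu) hne⟩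
  have h2 := hcut Z hsZ fun h => ht (hZX h)
  obtain ⟨u, hu, v, hv, h0⟩ := exists_of_cutCap_pos (lt_of_lt_of_le Nat.zero_lt_two h2)
  have huz : u = z := by
    by_contra hne
    have := hZ u hu hne v hv
    omega
  subst huz
  have uniq : ∀ v', 0 < x u v' → v' = v := fun v' h' =>
    Finset.card_le_one.1 (hdeg u) v' (by simpa using h') v (by simpa using h0)
  have h3 : cutCap x Z = x u v := by
    rw [cutCap, Finset.sum_eq_single u, Finset.sum_eq_single v]
    · intro v' _ hne
      by_contra h
      exact hne (uniq v' (Nat.pos_of_ne_zero h))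
    · intro h
      exact absurd (Finset.mem_compl.2 hv) h
    · intro u' hu' hne
      exact Finset.sum_eq_zero fun v' hv' => hZ u' hu' hne v' (Finset.mem_compl.1 hv')
    · intro h
      exact absurd hu h
  have hvX : v ∈ X := by
    by_contra hvX
    have := hX u (hZX hu) v hvX
    have := hle u v
    omega
  refine hmax v hv ⟨Finset.insert_subset hvX hZX, Finset.mem_insert_of_mem hsZ, v,
    Finset.mem_insert_self _ _, fun u' hu' hne v' hv' => ?_⟩
  simp only [Finset.mem_insert, not_or] at hu' hv'
  by_cases e : u' = u
  · subst e
    by_contra h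
    exact hv'.1 (uniq v' (Nat.pos_of_ne_zero h))
  · exact hZ u' (hu'.resolve_left hne) e v' hv'.2

/-- A unit flow with unit vertex capacities on the arcs of capacity at least 2, doubled. The extra
arc gets capacity 0. -/
theorem exists_isDegreeBoundedFlow_one {c : V → V → ℕ} {s t : V}
    (h : ∀ X : Finset V, s ∈ X → t ∉ X → ∃ u ∈ X, ∃ v ∉ X, 2 ≤ c u v) :
    ∃ x, IsDegreeBoundedFlow c s t 1 x := by
  let c' : V → V → ℕ := fun u v => if 2 ≤ c u v then 1 else 0
  obtain ⟨y, d, hy, hd, hκ, hdiv⟩ := exists_flow_of_vertex_capacities c' (fun _ => 1) (s := s)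
    (t := t) (w := t) 0 1 (by
      intro A B hs ht
      by_cases hAB : A ⊆ B
      · obtain ⟨u, hu, v, hv, h2⟩ := h A hs ht
        have h1 : c' u v ≤ ∑ u ∈ B, ∑ v ∈ Aᶜ, c' u v :=
          (le_cutCap c' hu hv).trans (Finset.sum_le_sum_of_subset hAB)
        simp only [c', h2, if_true] at h1 ⊢
        omega
      · obtain ⟨v, hvA, hvB⟩ := Finset.not_subset.1 hAB
        have : 0 < (A \ B).card := Finset.card_pos.2 ⟨v, by simp [hvA, hvB]⟩
        simp only [Finset.sum_const, smul_eq_mul, mul_one]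
        omega)
  obtain rfl : d = 0 := by omega
  refine ⟨fun u v => 2 * y u v, fun u v => ?_, fun v => ?_, fun v => ?_⟩
  · have := hy u v
    simp only [c'] at this
    split_ifs at this <;> omega
  · have := hdiv v
    simp only [netOut, Nat.cast_zero, zero_mul, add_zero] at this ⊢
    push_cast
    rw [← Finset.mul_sum, ← Finset.mul_sum, ← mul_sub, this]
    push_cast
    ring
  · have := (card_pos_le_sum (y v)).trans (hκ v)
    simpa using this

end Characterization

/-! ### The characterization, stated for flow networks. -/

namespace FlowNetwork

variable {n : ℕ} (N : FlowNetwork n)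

/-- The net flow out of any cut is the value, so conservation and value can be replaced by lower
bounds on cuts. This also covers values above `k + 1`. -/
theorem exists_of_hasDegreeBoundedFlow {N : FlowNetwork n} {k : ℕ}
    (h : HasDegreeBoundedFlow N k 1) : ∃ x : Fin n → Fin n → ℕ,
      (∀ u v, x u v ≤ N.capEntry u v) ∧
      (∀ X, N.s ∈ X → N.t ∉ X → k + 1 ≤ cutCap x X) ∧
      ∀ v, (Finset.univ.filter fun u => 0 < x v u).card ≤ k := by
  classical
  obtain ⟨x, hx, hdeg, hval⟩ := h
  refine ⟨x, fun u v => ?_, fun X hs ht => ?_, fun v => ?_⟩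
  · rw [capEntry]
    split_ifs with h
    · exact hx.le_cap u v h
    · exact (hx.eq_zero_of_not_adj u v h).le
  · have h1 := sum_netOut (fun a b => (x a b : ℤ)) X
    have h2 : ∑ v ∈ X, netOut (fun a b => (x a b : ℤ)) v = N.value x := by
      rw [Finset.sum_eq_single N.s]
      · rfl
      · intro v hv hne
        have := hx.conservation v hne fun e => ht (e ▸ hv)
        simp only [netOut]
        rw [sub_eq_zero]
        exact_mod_cast this.symm
      · exact fun h => absurd hs h
    have h3 : 0 ≤ ∑ u ∈ Xᶜ, ∑ v ∈ X, (x u v : ℤ) :=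
      Finset.sum_nonneg fun _ _ => Finset.sum_nonneg fun _ _ => by positivity
    have h4 : ∑ u ∈ X, ∑ v ∈ Xᶜ, (x u v : ℤ) = (cutCap x X : ℤ) := by
      rw [cutCap]
      push_cast
      rfl
    rw [h2, h4] at h1
    omega
  · have h1 := Finset.le_sup (f := fun v => {w | (N.support x).Adj v w}.ncard) (Finset.mem_univ v)
    refine le_trans (le_of_eq ?_) (h1.trans hdeg)
    rw [← Set.ncard_coe_finset]
    congr 1
    ext w
    simp only [Finset.coe_filter, Finset.mem_univ, true_and, Set.mem_ofPred_eq, support]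
    refine ⟨fun h => ⟨?_, h⟩, fun h => h.2⟩
    by_contra hadj
    have := hx.eq_zero_of_not_adj v w hadj
    omega

theorem hasDegreeBoundedFlow_of_isDegreeBoundedFlow {N : FlowNetwork n} {k : ℕ}
    {x : Fin n → Fin n → ℕ} (hx : IsDegreeBoundedFlow N.capEntry N.s N.t k x) :
    HasDegreeBoundedFlow N k 1 := by
  refine ⟨x, ⟨fun u v h => ?_, fun u v h => ?_, fun v hs ht => ?_⟩, ?_, ?_⟩
  · have := hx.le u v
    simpa [capEntry, h] using this
  · have := hx.le u v
    simpa [capEntry, h] using this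
  · have := hx.netOut_eq v
    simp only [hs, ht, if_false, mul_zero, sub_zero, netOut] at this
    have h2 := sub_eq_zero.1 this
    exact_mod_cast h2.symm
  · refine Finset.sup_le fun v _ => le_trans (le_of_eq ?_) (hx.degree_le v)
    rw [← Set.ncard_coe_finset]
    congr 1
    ext w
    simp only [Finset.coe_filter, Finset.mem_univ, true_and, Set.mem_ofPred_eq, support]
    refine ⟨fun h => h.2, fun h => ⟨?_, h⟩⟩
    by_contra hadj
    have := hx.le v w
    simp only [capEntry, hadj, if_false] at this
    omega
  · have := hx.netOut_eq N.s
    simp only [if_true, N.s_ne_t, if_false, mul_one, mul_zero, sub_zero, netOut] at this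
    exact this.ge

theorem not_hasDegreeBoundedFlow_zero : ¬ HasDegreeBoundedFlow N 0 1 := by
  intro h
  obtain ⟨x, -, hcut, hdeg⟩ := exists_of_hasDegreeBoundedFlow h
  obtain ⟨u, -, v, -, h0⟩ := exists_of_cutCap_pos
    (hcut {N.s} (by simp) (by simpa using N.s_ne_t.symm))
  have := hdeg u
  rw [Nat.le_zero, Finset.card_eq_zero, Finset.filter_eq_empty_iff] at this
  exact this (Finset.mem_univ v) h0

theorem hasDegreeBoundedFlow_one_iff : HasDegreeBoundedFlow N 1 1 ↔
    ∀ X : Finset (Fin n), N.s ∈ X → N.t ∉ X → ∃ u ∈ X, ∃ v ∉ X, 2 ≤ N.capEntry u v := by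
  constructor
  · intro h
    obtain ⟨x, hle, hcut, hdeg⟩ := exists_of_hasDegreeBoundedFlow h
    exact exists_wide_arc_of_flow hle hcut hdeg
  · intro h
    obtain ⟨x, hx⟩ := exists_isDegreeBoundedFlow_one h
    exact hasDegreeBoundedFlow_of_isDegreeBoundedFlow hx

theorem hasDegreeBoundedFlow_iff {k : ℕ} (hk : 2 ≤ k) : HasDegreeBoundedFlow N k 1 ↔
    (∀ X, N.s ∈ X → N.t ∉ X → k + 1 ≤ cutCap N.capEntry X) ∧
    ∀ a, a ≠ N.t → Separates N.capEntry N.s N.t a → HasDoubleArc N.capEntry N.t a := by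
  constructor
  · intro h
    obtain ⟨x, hle, hcut, hdeg⟩ := exists_of_hasDegreeBoundedFlow h
    exact ⟨fun X hs ht => (hcut X hs ht).trans
      (cutCap_le fun u hu v hv _ => ⟨hu, hv, hle u v⟩),
      fun a _ ha => hasDoubleArc_of_flow hle hcut hdeg ha⟩
  · rintro ⟨hcut, hdbl⟩
    obtain ⟨x, hx⟩ := exists_isDegreeBoundedFlow hk N.capEntry N.s_ne_t hcut hdbl
    exact hasDegreeBoundedFlow_of_isDegreeBoundedFlow hx

end FlowNetwork

/-! ## Backward search -/

namespace WordRAM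

open Exp Cmd

/-- Fill the array `m`; the expression may refer to the row `4` and the column `5`. -/
def fill (m : ℕ) (e : Exp) : Cmd := .loop 4 (.loop 5 (.put m (var 4) (var 5) e))

/-- Fill the row `0` of the array `m`; the expression may refer to the column `5`. -/
def fillRow (m : ℕ) (e : Exp) : Cmd := .loop 5 (.put m (lit 0) (var 5) e)

theorem wp_fillRow {w : ℕ} {S : Env} {m : ℕ} {e : Exp} (f : ℕ → ℕ)
    (he : ∀ S', Frame [5] [m] S S' → S'.var 5 < S.var 0 → e.Fits w S' ∧ e.eval S' = f (S'.var 5)) :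
    WP w (fillRow m e) S (fun S' => ∀ v < S.var 0, S'.mat m 0 v = f v) := by
  refine WP.loop (fun j S' => ∀ v < j, S'.mat m 0 v = f v) (by simp) ?_ (fun S' _ _ h => h)
  intro j S' hj hv hfr hI
  obtain ⟨h1, h2⟩ := he S' hfr (by omega)
  have h0 := hfr.var 0 (by simp [writes])
  simp only [WP.put, h1, h2, h0, hv, hj, true_and, and_true, Exp.eval, Exp.Fits]
  refine ⟨⟨by positivity, by omega⟩, fun v hvj => ?_⟩
  simp only [Env.setVar, Env.setMat, true_and]
  split_ifs with h
  · rw [h]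
  · exact hI v (by omega)

theorem wp_fill {w : ℕ} {S : Env} {m : ℕ} {e : Exp} (f : ℕ → ℕ → ℕ)
    (he : ∀ S', Frame [4, 5] [m] S S' → S'.var 4 < S.var 0 → S'.var 5 < S.var 0 →
      e.Fits w S' ∧ e.eval S' = f (S'.var 4) (S'.var 5)) :
    WP w (fill m e) S (fun S' => ∀ u < S.var 0, ∀ v < S.var 0, S'.mat m u v = f u v) := by
  refine WP.loop (fun i S' => ∀ u < i, ∀ v < S.var 0, S'.mat m u v = f u v) (by simp) ?_
    (fun S' _ _ h => h)
  intro i S₁ hi hu hfr₁ hI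
  have h01 := hfr₁.var 0 (by simp [writes])
  refine WP.loop (fun j S' => (∀ u < i, ∀ v < S.var 0, S'.mat m u v = f u v) ∧
    ∀ v < j, S'.mat m i v = f i v) ⟨hI, by simp⟩ ?_ ?_
  · rintro j S₂ hj hv hfr₂ ⟨hI₁, hI₂⟩
    have h4 : S₂.var 4 = i := by rw [hfr₂.var 4 (by simp [writes]), hu]
    have h0 : S₂.var 0 = S.var 0 := by rw [hfr₂.var 0 (by simp [writes]), h01]
    obtain ⟨h1, h2⟩ := he S₂ ⟨fun r hr => by
        rw [hfr₂.var r (by simp_all [writes]), hfr₁.var r (by simp_all [writes])], fun x hx => by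
        rw [hfr₂.mat x (by simpa [banks] using hx), hfr₁.mat x (by simpa [banks] using hx)]⟩
      (by omega) (by omega)
    simp only [WP.put, h1, h2, h0, h4, hv, hi, true_and, Exp.eval,
      Exp.Fits]
    refine ⟨by omega, fun u hui v hv' => ?_, fun v hvj => ?_⟩
    · simp only [Env.setVar, Env.setMat, true_and]
      rw [if_neg (by omega)]
      exact hI₁ u hui v hv'
    · simp only [Env.setVar, Env.setMat, true_and]
      split_ifs with h
      · rw [h]
      · exact hI₂ v (by omega)
  · rintro S₂ - - ⟨h1, h2⟩ u hui v hv
    rcases Nat.lt_succ_iff_lt_or_eq.1 hui with h | rfl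
    · exact h1 u h v hv
    · exact h2 v (by omega)

/-- Search backwards from the vertex `2` along the positive entries of the array `5`. The row `0`
of the array `6` marks the vertices found, array `7` is the queue, with length in `11`, and the
array `p` holds the next vertex on the way to the target. -/
def search (p : ℕ) : Cmd :=
  fillRow 6 (.ifEq (var 5) (var 2) (lit 1) (lit 0)) ;;
  .put 7 (lit 0) (lit 0) (var 2) ;;
  .set 11 (lit 1) ;;
  .loop 12 (.ifLt (var 12) (var 11)
    (.set 13 (get 7 (lit 0) (var 12)) ;;
      .loop 14 (.ifLt (lit 0) (get 5 (var 14) (var 13))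
        (.ifEq (get 6 (lit 0) (var 14)) (lit 0)
          (.put 6 (lit 0) (var 14) (lit 1) ;;
            .put p (lit 0) (var 14) (var 13) ;;
            .put 7 (lit 0) (var 11) (var 14) ;;
            .set 11 (plus (var 11) (lit 1)))
          .skip)
        .skip))
    .skip)

/-- `seen` marks the vertices from which `t` can be reached along positive entries of `H`, and
`next` describes paths to `t`. -/
structure SearchResult (n t : ℕ) (H : ℕ → ℕ → ℕ) (seen next : ℕ → ℕ) : Prop where
  zero_or_one : ∀ v < n, seen v = 0 ∨ seen v = 1
  target : seen t = 1
  closed : ∀ u < n, ∀ v < n, seen v = 1 → 0 < H u v → seen u = 1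
  next_lt : ∀ v < n, seen v = 1 → v ≠ t → next v < n
  tree : ∀ X : Set ℕ, ∀ v < n, v ∈ X → t ∉ X → seen v = 1 →
    ∃ u < n, u ∈ X ∧ next u < n ∧ next u ∉ X ∧ 0 < H u (next u)

/-- The loop invariant of the search; `L` is the length of the queue `q`. -/
structure SearchInv (n t : ℕ) (H : ℕ → ℕ → ℕ) (seen next q : ℕ → ℕ) (L : ℕ) : Prop where
  zero_or_one : ∀ v < n, seen v = 0 ∨ seen v = 1
  target : seen t = 1
  queue : ∀ i < L, q i < n ∧ seen (q i) = 1
  queued : ∀ v < n, seen v = 1 → ∃ i < L, q i = v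
  inj : ∀ i < L, ∀ j < L, q i = q j → i = j
  tree : ∀ X : Set ℕ, ∀ v < n, v ∈ X → t ∉ X → seen v = 1 →
    ∃ u < n, u ∈ X ∧ seen u = 1 ∧ next u < n ∧ next u ∉ X ∧ 0 < H u (next u)

theorem SearchInv.length_le {n t : ℕ} {H : ℕ → ℕ → ℕ} {seen next q : ℕ → ℕ} {L : ℕ}
    (h : SearchInv n t H seen next q L) : L ≤ n := by
  have := Finset.card_le_card_of_injOn (s := Finset.range L) (t := Finset.range n) q
    (fun i hi => by simpa using (h.queue i (by simpa using hi)).1)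
    (fun i hi j hj e => h.inj i (by simpa using hi) j (by simpa using hj) e)
  simpa using this

theorem SearchInv.length_lt {n t : ℕ} {H : ℕ → ℕ → ℕ} {seen next q : ℕ → ℕ} {L u : ℕ}
    (h : SearchInv n t H seen next q L) (hu : u < n) (hs : seen u = 0) : L < n := by
  have := Finset.card_le_card_of_injOn (s := Finset.range L) (t := (Finset.range n).erase u) q
    (fun i hi => by
      obtain ⟨h1, h2⟩ := h.queue i (by simpa using hi)
      simp only [Finset.coe_erase, Set.mem_sdiff, Finset.coe_range, Set.mem_Iio,
        Set.mem_singleton_iff]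
      exact ⟨h1, fun e => by rw [e] at h2; omega⟩)
    (fun i hi j hj e => h.inj i (by simpa using hi) j (by simpa using hj) e)
  rw [Finset.card_erase_of_mem (by simpa using hu)] at this
  simp at this
  omega

theorem SearchInv.push {n t : ℕ} {H : ℕ → ℕ → ℕ} {seen next q : ℕ → ℕ} {L u v : ℕ}
    (h : SearchInv n t H seen next q L) (hu : u < n) (hs : seen u = 0) (hv : v < n)
    (hsv : seen v = 1) (hH : 0 < H u v) :
    SearchInv n t H (fun x => if x = u then 1 else seen x) (fun x => if x = u then v else next x)
      (fun i => if i = L then u else q i) (L + 1) := by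
  have hut : t ≠ u := fun e => by rw [← e, h.target] at hs; omega
  have hvu : v ≠ u := fun e => by rw [e, hs] at hsv; omega
  refine ⟨fun x hx => ?_, ?_, fun i hi => ?_, fun x hx hsx => ?_, fun i hi j hj e => ?_,
    fun X x hx hxX htX hsx => ?_⟩
  · split_ifs
    · exact .inr rfl
    · exact h.zero_or_one x hx
  · simpa [hut] using h.target
  · by_cases hiL : i = L
    · simp [hiL, hu]
    · obtain ⟨h1, h2⟩ := h.queue i (by omega)
      simp only [hiL, if_false, h1, h2, true_and]
      split_ifs <;> rfl
  · by_cases hxu : x = u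
    · exact ⟨L, by omega, by simp [hxu]⟩
    · simp only [hxu, if_false] at hsx
      obtain ⟨i, hi, e⟩ := h.queued x hx hsx
      exact ⟨i, by omega, by rw [if_neg (by omega), e]⟩
  · have hne : ∀ i < L, q i ≠ u := fun i hi e => by
      have := (h.queue i hi).2
      rw [e, hs] at this
      omega
    by_cases hiL : i = L <;> by_cases hjL : j = L
    · omega
    · simp only [hiL, hjL, if_true, if_false] at e
      exact absurd e.symm (hne j (by omega))
    · simp only [hiL, hjL, if_true, if_false] at e
      exact absurd e (hne i (by omega))
    · simp only [hiL, hjL, if_false] at e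
      exact h.inj i (by omega) j (by omega) e
  · have old : ∀ x < n, x ∈ X → seen x = 1 → ∃ z < n, z ∈ X ∧
        (if z = u then 1 else seen z) = 1 ∧ (if z = u then v else next z) < n ∧
        (if z = u then v else next z) ∉ X ∧ 0 < H z (if z = u then v else next z) := by
      intro x hx hxX hsx
      obtain ⟨z, hz, hzX, hsz, h1, h2, h3⟩ := h.tree X x hx hxX htX hsx
      have hzu : z ≠ u := fun e => by rw [e, hs] at hsz; omega
      exact ⟨z, hz, hzX, by simp [hsz], by simpa [hzu] using h1, by simpa [hzu] using h2,
        by simpa [hzu] using h3⟩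
    -- For the new vertex `u` either its arc to `v` already leaves `X`, or `v` is in `X` and the old
    -- tree applies to `v`.
    by_cases hxu : x = u
    · by_cases hvX : v ∈ X
      · exact old v hv hvX hsv
      · subst hxu
        exact ⟨x, hx, hxX, by simp, by simpa using hv, by simpa using hvX, by simpa using hH⟩
    · simp only [hxu, if_false] at hsx
      exact old x hx hxX hsx

theorem SearchInv.result {n t : ℕ} {H : ℕ → ℕ → ℕ} {seen next q : ℕ → ℕ} {L : ℕ}
    (h : SearchInv n t H seen next q L)
    (hc : ∀ i < L, ∀ u < n, 0 < H u (q i) → seen u = 1) : SearchResult n t H seen next := by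
  refine ⟨h.zero_or_one, h.target, fun u hu v hv hs hH => ?_, fun v hv hs hne => ?_,
    fun X v hv hvX htX hs => ?_⟩
  · obtain ⟨i, hi, rfl⟩ := h.queued v hv hs
    exact hc i hi u hu hH
  · obtain ⟨u, -, hu, -, h1, -⟩ := h.tree {v} v hv rfl (fun e => hne (Eq.symm e)) hs
    obtain rfl : u = v := hu
    exact h1
  · obtain ⟨u, hu, hX, -, h1⟩ := h.tree X v hv hvX htX hs
    exact ⟨u, hu, hX, h1⟩

/-- After `j` rounds all in-neighbours of the first `j` entries of the queue are marked. Nothing is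
assumed about the old contents of the array `p`; entries at vertices not found remain stale. -/
theorem wp_search {w : ℕ} {S : Env} {p : ℕ} (hp : p ≠ 5 ∧ p ≠ 6 ∧ p ≠ 7) (ht : S.var 2 < S.var 0)
    (hw : S.var 0 + 1 < 2 ^ w) :
    WP w (search p) S (fun S' =>
      SearchResult (S.var 0) (S.var 2) (S.mat 5) (S'.mat 6 0) (S'.mat p 0)) := by
  obtain ⟨hp5, hp6, hp7⟩ := hp
  have h1w : 1 < 2 ^ w := by omega
  have h0w : 0 < 2 ^ w := by omega
  rw [search, WP.seq]
  refine (wp_fillRow (fun v => if v = S.var 2 then 1 else 0) ?_).mono ?_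
  · intro S' hfr _
    have h2 := hfr.var 2 (by simp)
    simp only [Exp.Fits, Exp.eval, h2, true_and]
    split_ifs <;> simp only [h1w, h0w, and_self]
  intro S₁ hfr hseen
  have v0 : S₁.var 0 = S.var 0 := hfr.var 0 (by decide)
  have v2 : S₁.var 2 = S.var 2 := hfr.var 2 (by decide)
  have m5 : S₁.mat 5 = S.mat 5 := hfr.mat 5 (by simp [fillRow, banks])
  have hn : 0 < S.var 0 := by omega
  simp only [WP.seq, WP.put, WP.set, Exp.Fits, Exp.eval, v0, v2, Env.setMat, true_and, h0w, h1w, hn]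
  generalize hS₂ : Env.setVar _ 11 1 = S₂
  have v0' : S₂.var 0 = S.var 0 := by simp [← hS₂, Env.setVar, v0]
  have m5' : S₂.mat 5 = S.mat 5 := by simp [← hS₂, Env.setVar, m5]
  have start : SearchInv (S.var 0) (S.var 2) (S.mat 5) (S₂.mat 6 0) (S₂.mat p 0) (S₂.mat 7 0)
      (S₂.var 11) := by
    have e6 : ∀ v < S.var 0, S₂.mat 6 0 v = if v = S.var 2 then 1 else 0 := by
      intro v hv
      simpa [← hS₂, Env.setVar] using hseen v hv
    have e7 : S₂.mat 7 0 0 = S.var 2 := by simp [← hS₂, Env.setVar]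
    have e11 : S₂.var 11 = 1 := by simp [← hS₂, Env.setVar]
    rw [e11]
    refine ⟨fun v hv => ?_, by simp [e6 _ ht], fun i hi => ?_, fun v hv hs => ?_,
      fun i hi j hj _ => by omega, fun X v hv hvX htX hs => ?_⟩
    · rw [e6 v hv]
      split_ifs <;> simp
    · obtain rfl : i = 0 := by omega
      rw [e7]
      exact ⟨ht, by simp [e6 _ ht]⟩
    · rw [e6 v hv] at hs
      split_ifs at hs with h
      exact ⟨0, by omega, by rw [e7, h]⟩
    · rw [e6 v hv] at hs
      split_ifs at hs with h
      exact absurd (h ▸ hvX) htX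
  clear hS₂
  refine WP.loop (fun j S' => SearchInv (S.var 0) (S.var 2) (S.mat 5) (S'.mat 6 0) (S'.mat p 0)
      (S'.mat 7 0) (S'.var 11) ∧ ∀ i < S'.var 11, i < j → ∀ u < S.var 0,
        0 < S.mat 5 u (S'.mat 7 0 i) → S'.mat 6 0 u = 1) ⟨?_, by simp⟩ ?_ ?_
  · simpa [Env.setVar] using start
  · rintro j S₃ hj hv12 hfr₃ ⟨hI, hcl⟩
    have w0 : S₃.var 0 = S.var 0 := by rw [hfr₃.var 0 (by simp [writes]), v0']
    rw [v0'] at hj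
    simp only [WP.ifLt, WP.seq, WP.set, WP.skip, Exp.Fits, Exp.eval, true_and, h0w, w0, hn, hv12,
      hj]
    refine ⟨fun hlt => ?_, fun hge => ⟨hI, fun i hi hij => ?_⟩⟩
    · obtain ⟨hcur, hscur⟩ := hI.queue j hlt
      refine WP.loop (fun u S' => SearchInv (S.var 0) (S.var 2) (S.mat 5) (S'.mat 6 0) (S'.mat p 0)
        (S'.mat 7 0) (S'.var 11) ∧ (∀ i < S'.var 11, i < j → ∀ u < S.var 0,
        0 < S.mat 5 u (S'.mat 7 0 i) → S'.mat 6 0 u = 1) ∧ j < S'.var 11 ∧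
        S'.mat 7 0 j = S₃.mat 7 0 j ∧
        ∀ x < u, 0 < S.mat 5 x (S₃.mat 7 0 j) → S'.mat 6 0 x = 1) ⟨?_, ?_, ?_, rfl, by simp⟩ ?_ ?_
      · simpa [Env.setVar] using hI
      · simpa [Env.setVar] using hcl
      · simpa [Env.setVar] using hlt
      · rintro u S₄ hu hv14 hfr₄ ⟨hJ, hcl', hjL, hq, hdone⟩
        have w0' : S₄.var 0 = S.var 0 := by
          rw [hfr₄.var 0 (by simp [writes])]
          simpa [Env.setVar] using w0
        have w13 : S₄.var 13 = S₃.mat 7 0 j := by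
          rw [hfr₄.var 13 (by simp [writes])]
          simp [Env.setVar]
        have w5 : S₄.mat 5 = S.mat 5 := by
          rw [hfr₄.mat 5 (by simp [banks]; omega)]
          change S₃.mat 5 = _
          rw [hfr₃.mat 5 (by simp [banks]; omega), m5']
        replace hu : u < S.var 0 := by simpa [Env.setVar, w0] using hu
        simp only [WP.ifLt, WP.ifEq, WP.seq, WP.set, WP.put, WP.skip, Exp.Fits, Exp.eval, true_and,
          h0w, h1w, w0', hn, hv14, hu, w13, hcur, w5, Env.setMat, Env.setVar, and_true]
        refine ⟨fun hH => ⟨fun hs => ?_, fun hs => ?_⟩, fun hH => ?_⟩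
        · have hL := hJ.length_lt hu hs
          have hne : S₄.var 11 ≠ j := by omega
          have hpush := hJ.push hu hs hcur (by rw [← hq]; exact (hJ.queue j hjL).2) hH
          have eq6 : (fun x => if x = u then 1 else S₄.mat 6 0 x) = fun j' =>
              (if 6 = 7 ∧ 0 = 0 ∧ j' = S₄.var 11 then u else
                if 6 = p ∧ 0 = 0 ∧ j' = u then S₃.mat 7 0 j else
                if 6 = 6 ∧ 0 = 0 ∧ j' = u then 1 else S₄.mat 6 0 j') := by
            funext x; simp [Ne.symm hp6]
          have eqp : (fun x => if x = u then S₃.mat 7 0 j else S₄.mat p 0 x) = fun j' =>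
              (if p = 7 ∧ 0 = 0 ∧ j' = S₄.var 11 then u else
                if p = p ∧ 0 = 0 ∧ j' = u then S₃.mat 7 0 j else
                if p = 6 ∧ 0 = 0 ∧ j' = u then 1 else S₄.mat p 0 j') := by
            funext x; simp [hp6, hp7]
          have eq7 : (fun i => if i = S₄.var 11 then u else S₄.mat 7 0 i) = fun j' =>
              (if 7 = 7 ∧ 0 = 0 ∧ j' = S₄.var 11 then u else
                if 7 = p ∧ 0 = 0 ∧ j' = u then S₃.mat 7 0 j else
                if 7 = 6 ∧ 0 = 0 ∧ j' = u then 1 else S₄.mat 7 0 j') := by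
            funext x; simp [Ne.symm hp7]
          rw [eq6, eqp, eq7] at hpush
          refine ⟨hL, by omega, ?_, ?_, ?_, ?_, ?_⟩
          · simpa using hpush
          · intro i hi hij x hx h
            simp [Ne.symm hp7, Ne.symm hp6] at h hi ⊢
            intro _
            rw [if_neg (by omega)] at h
            exact hcl' i (by omega) hij x hx h
          · simp; omega
          · simp [Ne.symm hne, Ne.symm hp7, hq]
          · intro x hx h
            simp [Ne.symm hp6]
            intro hxu
            exact hdone x (by omega) h
        · refine ⟨by simpa using hJ, by simpa using hcl', by simpa using hjL, hq,
            fun x hx h => ?_⟩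
          rcases Nat.lt_succ_iff_lt_or_eq.1 hx with h' | rfl
          · exact hdone x h' h
          · exact (hJ.zero_or_one x hu).resolve_left hs
        · refine ⟨by simpa using hJ, by simpa using hcl', by simpa using hjL, hq,
            fun x hx h => ?_⟩
          rcases Nat.lt_succ_iff_lt_or_eq.1 hx with h' | rfl
          · exact hdone x h' h
          · exact absurd h hH
      · rintro S₄ - - ⟨hJ, hcl', hjL, hq, hdone⟩
        refine ⟨by simpa [Env.setVar] using hJ, fun i hi hij x hx h => ?_⟩
        have hi' : i < S₄.var 11 := by simpa [Env.setVar] using hi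
        change 0 < S.mat 5 x (S₄.mat 7 0 i) at h
        change S₄.mat 6 0 x = 1
        rcases Nat.lt_succ_iff_lt_or_eq.1 hij with h' | rfl
        · exact hcl' i hi' h' x hx h
        · rw [hq] at h
          exact hdone x (by simpa [Env.setVar, w0] using hx) h
    · have hi' : i < S₃.var 11 := by simpa [Env.setVar] using hi
      exact hcl i hi' (by omega)
  · rintro S₃ - - ⟨hI, hcl⟩
    refine hI.result fun i hi => hcl i hi ?_
    -- The queue has no repetitions, so `n` rounds treat all of it.
    have := hI.length_le
    omega

end WordRAM

/-! ## Reachability and two disjoint paths -/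

section Reach

variable {V : Type*} [Fintype V] [DecidableEq V]

/-- There is a path from `w` to `t`. -/
def CanReach (c : V → V → ℕ) (t w : V) : Prop :=
  ∀ Y : Finset V, w ∈ Y → t ∉ Y → 0 < cutCap c Y

def deleteArc (c : V → V → ℕ) (a b u v : V) : ℕ := if u = a ∧ v = b then 0 else c u v

/-- An empty cut of `D - a` becomes a witness of separation when `a` is added to it. -/
theorem separates_iff_not_canReach {c : V → V → ℕ} {s t a : V} (ha : a ≠ t) :
    Separates c s t a ↔ ¬ CanReach (deleteVertex c a) t s := by
  simp only [CanReach, not_forall, not_lt, Nat.le_zero]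
  constructor
  · rintro ⟨X, hs, -, ht, hX⟩
    refine ⟨X, hs, ht, ?_⟩
    by_contra h
    obtain ⟨u, hu, v, hv, h0⟩ := exists_of_cutCap_pos (Nat.pos_of_ne_zero h)
    rw [deleteVertex] at h0
    split_ifs at h0 with h1
    · omega
    · push Not at h1
      rw [hX u hu h1.1 v hv] at h0
      omega
  · rintro ⟨Y, hs, ht, h0⟩
    refine ⟨insert a Y, Finset.mem_insert_of_mem hs, Finset.mem_insert_self _ _, ?_,
      fun u hu hne v hv => ?_⟩
    · simp [ht, ha.symm]
    · simp only [Finset.mem_insert, not_or] at hu hv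
      have := le_cutCap (deleteVertex c a) (hu.resolve_left hne) hv.2
      rw [h0, deleteVertex, if_neg (by tauto)] at this
      omega

theorem cutCap_le_deleteArc (c : V → V → ℕ) (a b : V) (Y : Finset V) :
    cutCap c Y ≤ cutCap (deleteArc c a b) Y + c a b := by
  have h : c a b = ∑ u, ∑ v, if u = a ∧ v = b then c a b else 0 := by
    rw [Finset.sum_eq_single a, Finset.sum_eq_single b] <;> simp +contextual
  rw [h, cutCap_eq, cutCap_eq, ← Finset.sum_add_distrib]
  refine Finset.sum_le_sum fun u _ => ?_
  rw [← Finset.sum_add_distrib]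
  refine Finset.sum_le_sum fun v _ => ?_
  simp only [deleteArc]
  by_cases h1 : u = a ∧ v = b
  · obtain ⟨rfl, rfl⟩ := h1
    simp only [and_self, if_true]
    split_ifs <;> omega
  · simp only [h1, if_false]
    omega

theorem deleteArc_add_le_cutCap (c : V → V → ℕ) {a b : V} {Y : Finset V} (ha : a ∈ Y)
    (hb : b ∉ Y) : cutCap (deleteArc c a b) Y + c a b ≤ cutCap c Y := by
  have h : c a b = ∑ u, ∑ v, if u = a ∧ v = b then c a b else 0 := by
    rw [Finset.sum_eq_single a, Finset.sum_eq_single b] <;> simp +contextual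
  rw [h, cutCap_eq, cutCap_eq, ← Finset.sum_add_distrib]
  refine Finset.sum_le_sum fun u _ => ?_
  rw [← Finset.sum_add_distrib]
  refine Finset.sum_le_sum fun v _ => ?_
  simp only [deleteArc]
  by_cases h1 : u = a ∧ v = b
  · obtain ⟨rfl, rfl⟩ := h1
    simp [ha, hb]
  · simp only [h1, if_false]
    omega

end Reach

namespace WordRAM

open Exp Cmd

/-- The matrix stored in an array. -/
def matrixOf (n : ℕ) (A : ℕ → ℕ → ℕ) (u v : Fin n) : ℕ := A u v

theorem SearchResult.exists_arc {n : ℕ} {t : Fin n} {H : ℕ → ℕ → ℕ} {seen next : ℕ → ℕ}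
    (h : SearchResult n t H seen next) {Y : Finset (Fin n)} {w : Fin n} (hw : w ∈ Y) (ht : t ∉ Y)
    (hs : seen w = 1) :
    ∃ u ∈ Y, ∃ v ∉ Y, next u = (v : Fin n) ∧ 0 < matrixOf n H u v := by
  obtain ⟨u, hu, ⟨u', hu', rfl⟩, h1, h2, h3⟩ := h.tree ((fun v : Fin n => (v : ℕ)) '' Y) w w.2
    ⟨w, hw, rfl⟩ (by
      rintro ⟨z, hz, e⟩
      exact ht (Fin.ext e ▸ hz)) hs
  refine ⟨u', hu', ⟨next u', h1⟩, fun hmem => h2 ⟨_, hmem, rfl⟩, rfl, h3⟩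

theorem SearchResult.seen_iff {n : ℕ} {t : Fin n} {H : ℕ → ℕ → ℕ} {seen next : ℕ → ℕ}
    (h : SearchResult n t H seen next) (w : Fin n) :
    seen w = 1 ↔ CanReach (matrixOf n H) t w := by
  constructor
  · intro hs Y hw ht
    obtain ⟨u, hu, v, hv, -, h0⟩ := h.exists_arc hw ht hs
    exact h0.trans_le (le_cutCap _ hu hv)
  · intro hr
    by_contra hs
    -- The vertices not found form an empty cut, since the search is closed under in-neighbours.
    obtain ⟨u, hu, v, hv, h0⟩ := exists_of_cutCap_pos
      (hr (Finset.univ.filter fun v => seen v ≠ 1) (by simpa using hs) (by simp [h.target]))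
    simp only [Finset.mem_filter, Finset.mem_univ, true_and, not_not] at hu hv
    exact hu (h.closed u u.2 v v.2 hv h0)

/-- It suffices to delete the arcs of capacity one of the search tree. -/
theorem SearchResult.two_le_cutCap_iff {n : ℕ} {t : Fin n} {H : ℕ → ℕ → ℕ} {seen next : ℕ → ℕ}
    (h : SearchResult n t H seen next) (w : Fin n) :
    (seen w = 1 ∧ ∀ v p : Fin n, next v = p → H v p = 1 →
      CanReach (deleteArc (matrixOf n H) v p) t w) ↔
    ∀ Y : Finset (Fin n), w ∈ Y → t ∉ Y → 2 ≤ cutCap (matrixOf n H) Y := by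
  constructor
  · rintro ⟨hs, hdel⟩ Y hw ht
    obtain ⟨u, hu, v, hv, hn, h0⟩ := h.exists_arc hw ht hs
    -- The tree arc crossing the cut either has capacity 2 on its own, or has capacity 1 and
    -- something remains when it is deleted.
    by_cases h1 : H u v = 1
    · have h2 := hdel u v hn h1 Y hw ht
      have h3 := deleteArc_add_le_cutCap (matrixOf n H) hu hv
      omega
    · have := le_cutCap (matrixOf n H) hu hv
      have : matrixOf n H u v = H u v := rfl
      omega
  · intro hY
    -- Deletion of any arc of capacity 1 lowers a cut by at most 1. Tree membership is not needed
    -- here, so stale values of `next` do no harm.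
    refine ⟨(h.seen_iff w).2 fun Y hw ht => by have := hY Y hw ht; omega, fun v p _ h1 Y hw ht => ?_⟩
    have h2 := hY Y hw ht
    have h3 := cutCap_le_deleteArc (matrixOf n H) v p Y
    have : matrixOf n H v p = H v p := rfl
    omega

/-! ## The test of all separating vertices -/

def clearUnseen : Cmd :=
  .loop 17 (.ifEq (get 6 (lit 0) (var 17)) (lit 0) (.put 9 (lit 0) (var 17) (lit 0)) .skip)

/-- The searches write their trees to the array 10, so that the tree in 8 is kept. The first test
keeps stale entries within bounds, and a deleted entry can be restored as 1 because only arcs of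
capacity 1 are deleted. -/
def deleteArcs : Cmd :=
  .loop 16 (.ifLt (get 8 (lit 0) (var 16)) (var 0)
    (.ifEq (get 5 (var 16) (get 8 (lit 0) (var 16))) (lit 1)
      (.put 5 (var 16) (get 8 (lit 0) (var 16)) (lit 0) ;;
        search 10 ;;
        clearUnseen ;;
        .put 5 (var 16) (get 8 (lit 0) (var 16)) (lit 1))
      .skip)
    .skip)

def findArc : Cmd :=
  .set 18 (lit 0) ;;
  .loop 17 (.ifLt (lit 1) (get 1 (var 15) (var 17))
    (.ifEq (get 9 (lit 0) (var 17)) (lit 1) (.set 18 (lit 1)) .skip) .skip)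

/-- Set the variable `20` to `0` if a vertex separates `s` and `t` and has no double arc. -/
def checkVertices : Cmd :=
  .loop 15 (.ifEq (var 15) (var 2) .skip
    (fill 5 (.ifEq (var 4) (var 15) (lit 0) (.ifEq (var 5) (var 15) (lit 0)
        (get 1 (var 4) (var 5)))) ;;
      search 8 ;;
      .ifEq (get 6 (lit 0) (var 1)) (lit 0)
        (fillRow 9 (get 6 (lit 0) (var 5)) ;;
          deleteArcs ;;
          findArc ;;
          .ifEq (var 18) (lit 0) (.set 20 (lit 0)) .skip)
        .skip))

/-- The input of the algorithm is stored in `S`. -/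
structure Holds (n : ℕ) (c : Fin n → Fin n → ℕ) (s t : Fin n) (S : Env) : Prop where
  size : S.var 0 = n
  source : S.var 1 = s
  sink : S.var 2 = t
  cap : ∀ u v : Fin n, S.mat 1 u v = c u v

theorem Holds.frame {n : ℕ} {c : Fin n → Fin n → ℕ} {s t : Fin n} {S S' : Env} {vs ms : List ℕ}
    (h : Holds n c s t S) (hf : Frame vs ms S S') (h0 : 0 ∉ vs) (h1 : 1 ∉ vs) (h2 : 2 ∉ vs)
    (hm : 1 ∉ ms) : Holds n c s t S' :=
  ⟨(hf.var 0 h0).trans h.size, (hf.var 1 h1).trans h.source, (hf.var 2 h2).trans h.sink,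
    fun u v => by rw [hf.mat 1 hm, h.cap]⟩

theorem wp_clearUnseen {w n : ℕ} {S : Env} (hS : S.var 0 = n) :
    WP w clearUnseen S (fun S' => ∀ v < n, S'.mat 9 0 v =
      if S.mat 6 0 v = 0 then 0 else S.mat 9 0 v) := by
  refine WP.loop (fun i S' => ∀ v < n, S'.mat 9 0 v = if v < i ∧ S.mat 6 0 v = 0 then 0 else
    S.mat 9 0 v) (by simp [Env.setVar]) ?_ ?_
  · intro j S' hj hv hfr hI
    rw [hS] at hj
    have v0 : S'.var 0 = n := by rw [hfr.var 0 (by decide), hS]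
    have m6 : S'.mat 6 = S.mat 6 := hfr.mat 6 (by decide)
    have h0w : 0 < 2 ^ w := by positivity
    have hn : 0 < n := by omega
    simp only [WP.ifEq, WP.put, WP.skip, Exp.Fits, Exp.eval, hv, v0, hj, m6, h0w, hn, true_and,
      and_self, Env.setVar, Env.setMat]
    refine ⟨fun h v hvn => ?_, fun h v hvn => ?_⟩
    · by_cases e : v = j
      · simp [e, h]
      · have : v < j + 1 ↔ v < j := by omega
        simp only [if_neg e, hI v hvn, this]
    · rw [hI v hvn]
      by_cases e : v = j
      · simp [e, h]
      · have : v < j + 1 ↔ v < j := by omega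
        simp only [this]
  · intro S' _ _ hI v hv
    rw [hI v hv, hS]
    simp [hv]

theorem wp_deleteArcs {w n : ℕ} {S : Env} {t : Fin n} (hS : S.var 0 = n) (ht : S.var 2 = t)
    (hw : n + 1 < 2 ^ w) : WP w deleteArcs S (fun S' => ∀ x : Fin n, S'.mat 9 0 x = 1 ↔
      S.mat 9 0 x = 1 ∧ ∀ v p : Fin n, S.mat 8 0 v = p → S.mat 5 v p = 1 →
        CanReach (deleteArc (matrixOf n (S.mat 5)) v p) t x) := by
  refine WP.loop (fun i S' => S'.mat 5 = S.mat 5 ∧ ∀ x : Fin n, S'.mat 9 0 x = 1 ↔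
      S.mat 9 0 x = 1 ∧ ∀ v p : Fin n, (v : ℕ) < i → S.mat 8 0 v = p → S.mat 5 v p = 1 →
        CanReach (deleteArc (matrixOf n (S.mat 5)) v p) t x) ⟨rfl, by simp [Env.setVar]⟩ ?_ ?_
  · rintro i S₁ hi hv fr₁ ⟨h5, h9⟩
    rw [hS] at hi
    have v0 : S₁.var 0 = n := by rw [fr₁.var 0 (by decide), hS]
    have v2 : S₁.var 2 = t := by rw [fr₁.var 2 (by decide), ht]
    have m8 : S₁.mat 8 = S.mat 8 := fr₁.mat 8 (by decide)
    have h0w : 0 < 2 ^ w := by positivity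
    have h1w : 1 < 2 ^ w := by omega
    have hn : 0 < n := by omega
    have skip : ¬ (S.mat 8 0 i < n ∧ S.mat 5 i (S.mat 8 0 i) = 1) →
        ∀ x : Fin n, S₁.mat 9 0 x = 1 ↔
        S.mat 9 0 x = 1 ∧ ∀ v p : Fin n, (v : ℕ) < i + 1 → S.mat 8 0 v = p → S.mat 5 v p = 1 →
          CanReach (deleteArc (matrixOf n (S.mat 5)) v p) t x := by
      intro hno x
      rw [h9]
      refine and_congr_right fun _ => forall₂_congr fun v p => ?_
      refine ⟨fun h hvi e1 e2 => h ?_ e1 e2, fun h hvi => h (by omega)⟩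
      by_contra hc
      obtain rfl : (v : ℕ) = i := by omega
      exact hno ⟨by rw [e1]; exact p.2, by rw [e1]; exact e2⟩
    simp only [WP.ifLt, WP.ifEq, WP.seq, WP.put, WP.skip, Exp.Fits, Exp.eval, hv, v0, hi, m8, h0w,
      h1w, hn, h5, true_and, and_true]
    refine ⟨fun hp => ⟨hp, fun h1 => ⟨hp, ?_⟩, fun h1 => ⟨h5, skip fun h => h1 h.2⟩⟩,
      fun hp => ⟨h5, skip fun h => hp h.1⟩⟩
    generalize hS₂ : S₁.setMat 5 i (S.mat 8 0 i) 0 = S₂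
    have v0₂ : S₂.var 0 = n := by rw [← hS₂]; exact v0
    have v2₂ : S₂.var 2 = t := by rw [← hS₂]; exact v2
    have v16₂ : S₂.var 16 = i := by rw [← hS₂]; exact hv
    refine (wp_search (S := S₂) (p := 10) (by decide) (by rw [v0₂, v2₂]; exact t.2)
      (by rw [v0₂]; exact hw)).mono fun S₃ fr₃ res => ?_
    rw [v0₂, v2₂] at res
    have v0₃ : S₃.var 0 = n := by rw [fr₃.var 0 (by decide), v0₂]
    refine (wp_clearUnseen v0₃).mono fun S₄ fr₄ hclear => ?_
    have v0₄ : S₄.var 0 = n := by rw [fr₄.var 0 (by decide), v0₃]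
    have v16₄ : S₄.var 16 = i := by rw [fr₄.var 16 (by decide), fr₃.var 16 (by decide), v16₂]
    have m8₄ : S₄.mat 8 = S.mat 8 := by
      rw [fr₄.mat 8 (by decide), fr₃.mat 8 (by decide), ← m8, ← hS₂]
      simp [Env.setMat]
    have m9₃ : S₃.mat 9 = S₁.mat 9 := by
      rw [fr₃.mat 9 (by decide), ← hS₂]
      simp [Env.setMat]
    have m5₄ : S₄.mat 5 = S₂.mat 5 := by rw [fr₄.mat 5 (by decide), fr₃.mat 5 (by decide)]
    have m5₂ : S₂.mat 5 = fun a b => if a = i ∧ b = S.mat 8 0 i then 0 else S.mat 5 a b := by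
      rw [← hS₂]
      simp [Env.setMat, h5]
    simp only [v0₄, v16₄, m8₄, hi, hn, hp, true_and, and_true]
    refine ⟨?_, fun x => ?_⟩
    · funext a b
      simp only [Env.setMat, Env.setVar, true_and, m5₄, m5₂]
      split_ifs with h
      · rw [h.1, h.2, h1]
      · rfl
    · have e9 : ((S₄.setMat 5 i (S.mat 8 0 i) 1).setVar 16 (i + 1)).mat 9 = S₄.mat 9 := by
        simp [Env.setMat, Env.setVar]
      have hmat : matrixOf n (S₂.mat 5) =
          deleteArc (matrixOf n (S.mat 5)) ⟨i, hi⟩ ⟨S.mat 8 0 i, hp⟩ := by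
        funext a b
        simp only [matrixOf, m5₂, deleteArc, Fin.ext_iff]
      have hseen := res.seen_iff x
      rw [hmat] at hseen
      have h01 := res.zero_or_one x x.2
      rw [e9, hclear x x.2, m9₃]
      have hstep : (if S₃.mat 6 0 x = 0 then 0 else S₁.mat 9 0 x) = 1 ↔
          S₁.mat 9 0 x = 1 ∧ S₃.mat 6 0 x = 1 := by
        rcases h01 with h | h <;> simp [h]
      rw [hstep, h9, hseen, and_assoc]
      refine and_congr_right fun _ => ⟨fun ⟨ha, hb⟩ v p hvi e1 e2 => ?_, fun h =>
        ⟨fun v p hvi => h v p (Nat.lt_succ_of_lt hvi), h ⟨i, hi⟩ ⟨_, hp⟩ (by simp) rfl h1⟩⟩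
      rcases Nat.lt_succ_iff_lt_or_eq.1 hvi with h' | h'
      · exact ha v p h' e1 e2
      · have ev : v = ⟨i, hi⟩ := Fin.ext h'
        have ep : p = ⟨S.mat 8 0 i, hp⟩ := Fin.ext (by rw [← e1, h'])
        rw [ev, ep]
        exact hb
  · rintro S' - - ⟨-, h9⟩ x
    rw [h9, hS]
    simp

theorem wp_findArc {w n : ℕ} {S : Env} (hS : S.var 0 = n) (ha : S.var 15 < n) (hw : 1 < 2 ^ w) :
    WP w findArc S (fun S' => S'.var 18 = 0 ↔
      ¬ ∃ x : Fin n, 2 ≤ S.mat 1 (S.var 15) x ∧ S.mat 9 0 x = 1) := by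
  have h0w : 0 < 2 ^ w := by positivity
  simp only [findArc, WP.seq, WP.set, Exp.Fits, Exp.eval, h0w, true_and]
  refine WP.loop (fun i S' => S'.var 18 = 0 ↔
      ¬ ∃ x : Fin n, (x : ℕ) < i ∧ 2 ≤ S.mat 1 (S.var 15) x ∧ S.mat 9 0 x = 1)
    (by simp [Env.setVar]) ?_ ?_
  · intro i S' hi hv fr hI
    have hi' : i < n := by simpa [Env.setVar, hS] using hi
    have v0 : S'.var 0 = n := by rw [fr.var 0 (by decide), ← hS]; simp [Env.setVar]
    have v15 : S'.var 15 = S.var 15 := by rw [fr.var 15 (by decide)]; simp [Env.setVar]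
    have m1 : S'.mat 1 = S.mat 1 := fr.mat 1 (by decide)
    have m9 : S'.mat 9 = S.mat 9 := fr.mat 9 (by decide)
    have hn : 0 < n := by omega
    have skip : ¬ (2 ≤ S.mat 1 (S.var 15) i ∧ S.mat 9 0 i = 1) →
        (S'.var 18 = 0 ↔ ¬ ∃ x : Fin n, (x : ℕ) < i + 1 ∧ 2 ≤ S.mat 1 (S.var 15) x ∧
          S.mat 9 0 x = 1) := by
      intro hno
      rw [hI]
      refine not_congr (exists_congr fun x => ⟨fun h => ⟨by omega, h.2⟩, fun h => ⟨?_, h.2⟩⟩)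
      by_contra hc
      obtain rfl : (x : ℕ) = i := by omega
      exact hno h.2
    simp only [WP.ifLt, WP.ifEq, WP.set, WP.skip, Exp.Fits, Exp.eval, hv, v0, v15, m1, m9, hi',
      ha, hn, h0w, hw, true_and, and_true]
    refine ⟨fun h1 => ⟨fun h2 => ?_, fun h2 => ?_⟩, fun h1 => ?_⟩
    · have h18 : ((S'.setVar 18 1).setVar 17 (i + 1)).var 18 = 1 := by simp [Env.setVar]
      rw [h18]
      simp only [one_ne_zero, false_iff, not_not]
      exact ⟨⟨i, hi'⟩, by simp, h1, h2⟩
    · simpa [Env.setVar] using skip fun h => h2 h.2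
    · simpa [Env.setVar] using skip fun h => h1 h.1
  · intro S' _ _ hI
    rw [hI]
    simp [Env.setVar, hS]

theorem wp_checkVertices {w n : ℕ} {c : Fin n → Fin n → ℕ} {s t : Fin n} {S : Env}
    (hS : Holds n c s t S) (h20 : S.var 20 = 0 ∨ S.var 20 = 1) (hw : n + 1 < 2 ^ w) :
    WP w checkVertices S (fun S' => (S'.var 20 = 0 ∨ S'.var 20 = 1) ∧ (S'.var 20 = 1 ↔
      S.var 20 = 1 ∧ ∀ a, a ≠ t → Separates c s t a → HasDoubleArc c t a)) := by
  refine WP.loop (fun i S' => (S'.var 20 = 0 ∨ S'.var 20 = 1) ∧ (S'.var 20 = 1 ↔ S.var 20 = 1 ∧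
      ∀ a : Fin n, (a : ℕ) < i → a ≠ t → Separates c s t a → HasDoubleArc c t a))
    (by simpa [Env.setVar] using h20) ?_ ?_
  · rintro i S₁ hi hv fr₁ ⟨h01, hI⟩
    have hS₁ : Holds n c s t S₁ := hS.frame fr₁ (by decide) (by decide) (by decide) (by decide)
    rw [hS.size] at hi
    have h0w : 0 < 2 ^ w := by positivity
    have h1w : 1 < 2 ^ w := by omega
    have hn : 0 < n := by omega
    have skip : (∀ a : Fin n, (a : ℕ) = i → a ≠ t → Separates c s t a → HasDoubleArc c t a) →
        (S₁.var 20 = 1 ↔ S.var 20 = 1 ∧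
          ∀ a : Fin n, (a : ℕ) < i + 1 → a ≠ t → Separates c s t a → HasDoubleArc c t a) := by
      intro ha
      rw [hI]
      refine and_congr_right fun _ => forall_congr' fun a => ⟨fun h hai => ?_,
        fun h hai => h (by omega)⟩
      rcases Nat.lt_succ_iff_lt_or_eq.1 hai with h' | h'
      · exact h h'
      · exact ha a h'
    rw [WP.ifEq]
    simp only [Exp.Fits, Exp.eval, hv, hS₁.sink, true_and]
    refine ⟨fun hit => ?_, fun hit => ?_⟩
    · simp only [WP.skip]
      refine ⟨by simpa [Env.setVar] using h01, ?_⟩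
      have := skip fun a ha hat => absurd (Fin.ext (ha.trans hit)) hat
      simpa [Env.setVar] using this
    have hat : (⟨i, hi⟩ : Fin n) ≠ t := fun e => hit (congrArg Fin.val e)
    rw [WP.seq]
    refine (wp_fill (fun u v => if u = i then 0 else if v = i then 0 else S₁.mat 1 u v) ?_).mono ?_
    · intro S' fr h4 h5
      have e15 : S'.var 15 = i := by rw [fr.var 15 (by decide), hv]
      have e0 : S'.var 0 = S₁.var 0 := fr.var 0 (by decide)
      have e1 : S'.mat 1 = S₁.mat 1 := fr.mat 1 (by decide)
      simp only [Exp.Fits, Exp.eval, e15, e0, e1, h4, h5, h0w, and_self, ite_self]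
    intro S₂ fr₂ hfill
    rw [hS₁.size] at hfill
    have hS₂ : Holds n c s t S₂ := hS₁.frame fr₂ (by decide) (by decide) (by decide) (by decide)
    have hmat : matrixOf n (S₂.mat 5) = deleteVertex c ⟨i, hi⟩ := by
      funext u v
      have := hfill u u.2 v v.2
      simp only [matrixOf, this, deleteVertex, hS₁.cap, Fin.ext_iff]
      by_cases e1 : (u : ℕ) = i <;> by_cases e2 : (v : ℕ) = i <;> simp [e1, e2]
    rw [WP.seq]
    refine (wp_search (S := S₂) (p := 8) (by decide) (by rw [hS₂.size, hS₂.sink]; exact t.2)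
      (by rw [hS₂.size]; exact hw)).mono fun S₃ fr₃ res => ?_
    rw [hS₂.size, hS₂.sink] at res
    have hS₃ : Holds n c s t S₃ := hS₂.frame fr₃ (by decide) (by decide) (by decide) (by decide)
    have v15₃ : S₃.var 15 = i := by
      rw [fr₃.var 15 (by decide), fr₂.var 15 (by decide), hv]
    have v20₃ : S₃.var 20 = S₁.var 20 := by
      rw [fr₃.var 20 (by decide), fr₂.var 20 (by decide)]
    have m5₃ : S₃.mat 5 = S₂.mat 5 := fr₃.mat 5 (by decide)
    have hseen := res.seen_iff s
    rw [hmat, ← not_iff_not, ← separates_iff_not_canReach hat] at hseen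
    have hs01 := res.zero_or_one s s.2
    have hs := s.2
    rw [WP.ifEq]
    simp only [Exp.Fits, Exp.eval, hS₃.source, hS₃.size, hs, hn, h0w, true_and]
    refine ⟨fun h0 => ?_, fun h0 => ?_⟩
    · have hsep : Separates c s t ⟨i, hi⟩ := hseen.1 (by omega)
      rw [WP.seq]
      refine (wp_fillRow (fun v => S₃.mat 6 0 v) ?_).mono fun S₄ fr₄ hgood => ?_
      · intro S' fr h5
        have e0 : S'.var 0 = S₃.var 0 := fr.var 0 (by decide)
        have e6 : S'.mat 6 = S₃.mat 6 := fr.mat 6 (by decide)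
        simp only [Exp.Fits, Exp.eval, e0, e6, h0w, hS₃.size, hn, true_and, and_true]
        rw [hS₃.size] at h5
        exact h5
      rw [hS₃.size] at hgood
      have hS₄ : Holds n c s t S₄ := hS₃.frame fr₄ (by decide) (by decide) (by decide) (by decide)
      have m5₄ : S₄.mat 5 = S₂.mat 5 := by rw [fr₄.mat 5 (by decide), m5₃]
      have m8₄ : S₄.mat 8 = S₃.mat 8 := fr₄.mat 8 (by decide)
      rw [WP.seq]
      refine (wp_deleteArcs hS₄.size hS₄.sink hw).mono fun S₅ fr₅ hdel => ?_
      have hS₅ : Holds n c s t S₅ := hS₄.frame fr₅ (by decide) (by decide) (by decide) (by decide)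
      have v15₅ : S₅.var 15 = i := by rw [fr₅.var 15 (by decide), fr₄.var 15 (by decide), v15₃]
      have v20₅ : S₅.var 20 = S₁.var 20 := by
        rw [fr₅.var 20 (by decide), fr₄.var 20 (by decide), v20₃]
      -- Row 9 now marks the vertices from which two units can reach `t` in `D - a`.
      have h9 : ∀ x : Fin n, S₅.mat 9 0 x = 1 ↔
          ∀ Y : Finset (Fin n), x ∈ Y → t ∉ Y → 2 ≤ cutCap (deleteVertex c ⟨i, hi⟩) Y := by
        intro x
        rw [hdel, hgood x x.2, m5₄, m8₄, res.two_le_cutCap_iff x, hmat]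
      rw [WP.seq]
      refine (wp_findArc hS₅.size (by rw [v15₅]; exact hi) h1w).mono fun S₆ fr₆ hfind => ?_
      have v20₆ : S₆.var 20 = S₁.var 20 := by rw [fr₆.var 20 (by decide), v20₅]
      have hdbl : S₆.var 18 = 0 ↔ ¬ HasDoubleArc c t ⟨i, hi⟩ := by
        rw [hfind, HasDoubleArc]
        refine not_congr (exists_congr fun x => ?_)
        rw [v15₅, h9, hS₅.cap ⟨i, hi⟩ x]
      simp only [WP.ifEq, WP.set, WP.skip, Exp.Fits, Exp.eval, h0w, true_and]
      refine ⟨fun h18 => ?_, fun h18 => ?_⟩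
      · refine ⟨by simp [Env.setVar], ?_⟩
        simp [Env.setVar]
        exact fun _ => ⟨⟨i, hi⟩, le_rfl, hat, hsep, hdbl.1 h18⟩
      · rw [← v20₆] at h01 skip
        refine ⟨by simpa [Env.setVar] using h01, ?_⟩
        have := skip fun a ha _ _ => by
          rw [show a = ⟨i, hi⟩ from Fin.ext ha]
          exact not_not.1 fun h => h18 (hdbl.2 h)
        simpa [Env.setVar] using this
    · simp only [WP.skip]
      rw [← v20₃] at h01 skip
      refine ⟨by simpa [Env.setVar] using h01, ?_⟩
      have := skip fun a ha _ hsep => by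
        rw [show a = ⟨i, hi⟩ from Fin.ext ha] at hsep
        exact absurd (hs01.resolve_left h0) (hseen.2 hsep)
      simpa [Env.setVar] using this
  · rintro S' - - ⟨h1, h2⟩
    refine ⟨h1, h2.trans (and_congr_right fun _ => forall_congr' fun a => ?_)⟩
    rw [hS.size]
    exact ⟨fun h => h a.2, fun h _ => h⟩

end WordRAM

/-! ## Maximum flow by pushing and relabelling -/

theorem sum_range_update (f : ℕ → ℕ) {n w : ℕ} (hw : w < n) (y : ℕ) :
    (∑ u ∈ Finset.range n, if u = w then y else f u) + f w = (∑ u ∈ Finset.range n, f u) + y := by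
  have hm : w ∈ Finset.range n := by simpa using hw
  rw [← Finset.add_sum_erase _ _ hm, ← Finset.add_sum_erase _ f hm]
  have : ∑ x ∈ (Finset.range n).erase w, (if x = w then y else f x) =
      ∑ x ∈ (Finset.range n).erase w, f x :=
    Finset.sum_congr rfl fun x hx => if_neg (Finset.ne_of_mem_erase hx)
  rw [this, if_pos rfl]
  ring

/-- Residual capacities `r`, excesses `e` and a valid labelling `h` with labels at most `n`. -/
structure Preflow (n s t : ℕ) (c r : ℕ → ℕ → ℕ) (e h : ℕ → ℕ) : Prop where
  pair : ∀ u < n, ∀ v < n, r u v + r v u = c u v + c v u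
  balance : ∀ v < n, v ≠ s →
    ∑ u ∈ Finset.range n, r v u = e v + ∑ u ∈ Finset.range n, c v u
  saturated : ∀ v < n, r s v = 0
  source : h s = n
  sink : h t = 0
  label_le : ∀ v < n, h v ≤ n
  valid : ∀ u < n, ∀ v < n, 0 < r u v → h u ≤ h v + 1

/-- The vertices that have to be treated. -/
def Active (n s t : ℕ) (e h : ℕ → ℕ) (v : ℕ) : Prop :=
  v < n ∧ v ≠ s ∧ v ≠ t ∧ 0 < e v ∧ h v < n

/-! ### Pushes, relabellings and numerical bounds for preflows. -/

namespace Preflow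

variable {n s t : ℕ} {c r : ℕ → ℕ → ℕ} {e h : ℕ → ℕ}

/-- The reversed arc made residual is valid since `h v = h w + 1`. Nothing is pushed back into `s`,
whose label `n` is not below that of `v`; so the arcs out of `s` stay saturated. -/
theorem push (H : Preflow n s t c r e h) {v w δ : ℕ} (hv : v < n) (hw : w < n) (hvs : v ≠ s)
    (hvn : h v < n) (hh : h v = h w + 1) (hδe : δ ≤ e v) (hδr : δ ≤ r v w) :
    Preflow n s t c
      (fun a b => if a = w ∧ b = v then r w v + δ else if a = v ∧ b = w then r v w - δ else r a b)
      (fun x => if x = w then e w + δ else if x = v then e v - δ else e x) h := by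
  have hvw : v ≠ w := by rintro rfl; omega
  have hws : w ≠ s := by rintro rfl; rw [H.source] at hh; omega
  refine ⟨fun a ha b hb => ?_, fun x hx hxs => ?_, fun x hx => ?_, H.source, H.sink, H.label_le,
    fun a ha b hb => ?_⟩
  · have h1 := H.pair a ha b hb
    by_cases e1 : a = w ∧ b = v
    · obtain ⟨rfl, rfl⟩ := e1
      simp only [and_self, if_true, hvw, hvw.symm, if_false]
      omega
    · by_cases e2 : a = v ∧ b = w
      · obtain ⟨rfl, rfl⟩ := e2
        simp only [and_self, if_true, hvw, hvw.symm, if_false]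
        omega
      · have e3 : ¬ (b = w ∧ a = v) := fun h => e2 h.symm
        have e4 : ¬ (b = v ∧ a = w) := fun h => e1 h.symm
        simp only [e1, e2, e3, e4, if_false]
        exact h1
  · have h1 := H.balance x hx hxs
    by_cases e1 : x = w
    · subst e1
      have h2 := sum_range_update (fun u => r x u) hv (r x v + δ)
      simp only [true_and, hvw.symm, false_and, if_false, if_true]
      omega
    · by_cases e2 : x = v
      · subst e2
        have h2 := sum_range_update (fun u => r x u) hw (r x w - δ)
        simp only [true_and, e1, false_and, if_false, if_true]
        omega
      · simpa only [e1, e2, false_and, if_false] using h1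
  · simpa only [hws.symm, hvs.symm, false_and, if_false] using H.saturated x hx
  · have h1 := H.valid a ha b hb
    split_ifs with e1 e2
    · intro _
      rw [e1.1, e1.2]
      omega
    · intro h0
      rw [e2.1, e2.2]
      omega
    · exact h1

theorem relabel (H : Preflow n s t c r e h) {v : ℕ} (hvs : v ≠ s) (hvt : v ≠ t)
    (hvn : h v < n) (hno : ∀ w < n, 0 < r v w → h v ≠ h w + 1) :
    Preflow n s t c r e (fun x => if x = v then h v + 1 else h x) := by
  refine ⟨H.pair, H.balance, H.saturated, ?_, ?_, fun x hx => ?_, fun a ha b hb h0 => ?_⟩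
  · simp [hvs.symm, H.source]
  · simp [hvt.symm, H.sink]
  · have := H.label_le x hx
    split_ifs <;> omega
  · have h1 := H.valid a ha b hb h0
    by_cases ea : a = v <;> by_cases eb : b = v
    · simp only [ea, eb, if_true]
      omega
    · simp only [ea, eb, if_true, if_false]
      rw [ea] at h0 h1
      have := hno b hb h0
      omega
    · simp only [ea, eb, if_true, if_false]
      rw [eb] at h1
      omega
    · simp only [ea, eb, if_false]
      exact h1

theorem residual_le (H : Preflow n s t c r e h) {U : ℕ} (hU : ∀ u < n, ∀ v < n, c u v ≤ U) {u v : ℕ}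
    (hu : u < n) (hv : v < n) : r u v ≤ 2 * U := by
  have := H.pair u hu v hv
  have := hU u hu v hv
  have := hU v hv u hu
  omega

theorem excess_le (H : Preflow n s t c r e h) {U : ℕ} (hU : ∀ u < n, ∀ v < n, c u v ≤ U) {v : ℕ}
    (hv : v < n) (hvs : v ≠ s) : e v ≤ 2 * n * U := by
  have h1 := H.balance v hv hvs
  have h2 : ∑ u ∈ Finset.range n, r v u ≤ ∑ u ∈ Finset.range n, 2 * U :=
    Finset.sum_le_sum fun u hu => H.residual_le hU hv (by simpa using hu)
  simp only [Finset.sum_const, Finset.card_range, smul_eq_mul] at h2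
  have : n * (2 * U) = 2 * n * U := by ring
  omega

theorem sum_label_le (H : Preflow n s t c r e h) : ∑ v ∈ Finset.range n, h v ≤ n * n := by
  have : ∑ v ∈ Finset.range n, h v ≤ ∑ v ∈ Finset.range n, n :=
    Finset.sum_le_sum fun v hv => H.label_le v (by simpa using hv)
  simpa using this

end Preflow

open WordRAM in
-- The difference `r - c` is antisymmetric, so in the sum of the excesses over `Xᶜ` the arcs inside
-- `Xᶜ` cancel and only those between `X` and `Xᶜ` remain.
theorem Preflow.sum_excess_add_cutCap {n : ℕ} {s t : Fin n} {c r : ℕ → ℕ → ℕ} {e h : ℕ → ℕ}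
    (H : Preflow n s t c r e h) {X : Finset (Fin n)} (hs : s ∈ X) :
    ∑ v ∈ Xᶜ, e v + cutCap (matrixOf n r) X = cutCap (matrixOf n c) X := by
  let f : Fin n → Fin n → ℤ := fun v u => (r v u : ℤ) - c v u
  have anti : ∀ v u, f v u = - f u v := fun v u => by
    have := H.pair v v.2 u u.2
    simp only [f]
    omega
  have h0 : ∑ v ∈ Xᶜ, ∑ u ∈ Xᶜ, f v u = 0 := by
    have : ∑ v ∈ Xᶜ, ∑ u ∈ Xᶜ, f v u = - ∑ v ∈ Xᶜ, ∑ u ∈ Xᶜ, f v u := by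
      conv_lhs => rw [Finset.sum_comm]
      rw [← Finset.sum_neg_distrib]
      refine Finset.sum_congr rfl fun v _ => ?_
      rw [← Finset.sum_neg_distrib]
      exact Finset.sum_congr rfl fun u _ => anti u v
    omega
  have h1 : ∑ v ∈ Xᶜ, (e v : ℤ) = ∑ v ∈ Xᶜ, ∑ u, f v u := by
    refine Finset.sum_congr rfl fun v hv => ?_
    have hvs : (v : ℕ) ≠ s := fun he => (Finset.mem_compl.1 hv) (Fin.ext he ▸ hs)
    have := H.balance v v.2 hvs
    rw [Finset.sum_range, Finset.sum_range] at this
    simp only [f, Finset.sum_sub_distrib]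
    have h2 : (∑ u : Fin n, (r v u : ℤ)) = e v + ∑ u : Fin n, (c v u : ℤ) := by
      exact_mod_cast this
    omega
  have h2 : ∑ v ∈ Xᶜ, ∑ u, f v u = ∑ v ∈ Xᶜ, ∑ u ∈ X, f v u := by
    rw [← add_zero (∑ v ∈ Xᶜ, ∑ u ∈ X, f v u), ← h0, ← Finset.sum_add_distrib]
    exact Finset.sum_congr rfl fun v _ => (Finset.sum_add_sum_compl X _).symm
  have h3 : ∑ v ∈ Xᶜ, ∑ u ∈ X, f v u =
      (cutCap (matrixOf n c) X : ℤ) - cutCap (matrixOf n r) X := by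
    rw [Finset.sum_comm, cutCap, cutCap]
    push_cast
    rw [← Finset.sum_sub_distrib]
    refine Finset.sum_congr rfl fun u _ => ?_
    rw [← Finset.sum_sub_distrib]
    refine Finset.sum_congr rfl fun v _ => ?_
    rw [anti]
    simp only [f, matrixOf]
    ring
  have h4 : ((∑ v ∈ Xᶜ, e v : ℕ) : ℤ) = ∑ v ∈ Xᶜ, (e v : ℤ) := by push_cast; rfl
  omega

open WordRAM in
/-- Without active vertices the excess of the sink is the capacity of a minimum cut. -/
theorem Preflow.lt_excess_iff {n : ℕ} {s t : Fin n} (hst : s ≠ t) {c r : ℕ → ℕ → ℕ} {e h : ℕ → ℕ}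
    (H : Preflow n s t c r e h) (hact : ∀ v, ¬ Active n s t e h v) (k : ℕ) :
    k < e t ↔ ∀ X : Finset (Fin n), s ∈ X → t ∉ X → k + 1 ≤ cutCap (matrixOf n c) X := by
  constructor
  · intro hk X hs ht
    have h1 := H.sum_excess_add_cutCap hs
    have h2 : e t ≤ ∑ v ∈ Xᶜ, e v :=
      Finset.single_le_sum (f := fun v : Fin n => e v) (fun _ _ => Nat.zero_le _)
        (Finset.mem_compl.2 ht)
    omega
  · intro hk
    -- A gap: `n - 2` vertices cannot use all `n - 1` labels. By validity no residual arc leaves the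
    -- set of labels above the gap, and below it only the sink has excess.
    obtain ⟨l, hl, hgap⟩ : ∃ l ∈ Finset.Icc 1 (n - 1), l ∉ ((Finset.univ.erase s).erase t).image
        fun v : Fin n => h v := by
      refine Finset.exists_mem_notMem_of_card_lt_card (lt_of_le_of_lt Finset.card_image_le ?_)
      rw [Finset.card_erase_of_mem (by simp [hst.symm]), Finset.card_erase_of_mem (by simp)]
      have : (s : ℕ) ≠ t := fun e => hst (Fin.ext e)
      have := s.2
      have := t.2
      simp
      omega
    rw [Finset.mem_Icc] at hl
    have hne : ∀ v : Fin n, h v ≠ l := by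
      intro v hv
      by_cases e1 : v = s
      · rw [e1, H.source] at hv
        omega
      by_cases e2 : v = t
      · rw [e2, H.sink] at hv
        omega
      exact hgap (Finset.mem_image.2 ⟨v, by simp [e1, e2], hv⟩)
    let X : Finset (Fin n) := Finset.univ.filter fun v => l < h v
    have hsX : s ∈ X := by
      simp only [X, Finset.mem_filter, Finset.mem_univ, true_and, H.source]
      omega
    have htX : t ∉ X := by simp [X, H.sink]
    have h1 := H.sum_excess_add_cutCap hsX
    have h2 : cutCap (matrixOf n r) X = 0 := by
      by_contra h0
      obtain ⟨u, hu, v, hv, h0⟩ := exists_of_cutCap_pos (Nat.pos_of_ne_zero h0)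
      have h3 := H.valid u u.2 v v.2 h0
      have h4 := hne v
      simp only [X, Finset.mem_filter, Finset.mem_univ, true_and] at hu hv
      omega
    have h3 : ∑ v ∈ Xᶜ, e v = e t := by
      refine Finset.sum_eq_single t (fun v hv hvt => ?_) fun h => absurd (Finset.mem_compl.2 htX) h
      by_contra h0
      have hvX := Finset.mem_compl.1 hv
      have hvs : v ≠ s := fun e => hvX (e ▸ hsX)
      simp only [X, Finset.mem_filter, Finset.mem_univ, true_and] at hvX
      exact hact v ⟨v.2, fun e => hvs (Fin.ext e), fun e => hvt (Fin.ext e),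
        Nat.pos_of_ne_zero h0, by omega⟩
    have := hk X hsX htX
    omega

/-! ### The push-relabel program and the number of its passes. -/

namespace WordRAM

open Exp Cmd

def pushArc : Cmd :=
  .ifEq (get 4 (lit 0) (var 6)) (plus (get 4 (lit 0) (var 7)) (lit 1))
    (.set 8 (.ifLt (get 3 (lit 0) (var 6)) (get 2 (var 6) (var 7)) (get 3 (lit 0) (var 6))
        (get 2 (var 6) (var 7))) ;;
      .put 2 (var 6) (var 7) (minus (get 2 (var 6) (var 7)) (var 8)) ;;
      .put 2 (var 7) (var 6) (plus (get 2 (var 7) (var 6)) (var 8)) ;;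
      .put 3 (lit 0) (var 6) (minus (get 3 (lit 0) (var 6)) (var 8)) ;;
      .put 3 (lit 0) (var 7) (plus (get 3 (lit 0) (var 7)) (var 8)))
    .skip

def pushAll : Cmd := .loop 7 pushArc

def discharge : Cmd :=
  .ifEq (var 6) (var 1) .skip (.ifEq (var 6) (var 2) .skip
    (.ifLt (lit 0) (get 3 (lit 0) (var 6))
      (.ifLt (get 4 (lit 0) (var 6)) (var 0)
        (pushAll ;;
          .ifLt (lit 0) (get 3 (lit 0) (var 6))
            (.put 4 (lit 0) (var 6) (plus (get 4 (lit 0) (var 6)) (lit 1))) .skip)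
        .skip)
      .skip))

def pass : Cmd := .loop 6 discharge

/-- Residual capacities are in the array `2`, excesses in `3` and labels in `4`. -/
def maxFlow : Cmd :=
  fill 2 (.ifEq (var 4) (var 1) (lit 0) (.ifEq (var 5) (var 1)
    (plus (get 1 (var 4) (var 5)) (get 1 (var 5) (var 4))) (get 1 (var 4) (var 5)))) ;;
  fillRow 3 (get 1 (var 1) (var 5)) ;;
  fillRow 4 (.ifEq (var 5) (var 1) (var 0) (lit 0)) ;;
  .loop 19 (.loop 21 (pass ;; pass ;; pass))

/-- The arrays of `S` hold a preflow. -/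
structure FlowState (n s t : ℕ) (c : ℕ → ℕ → ℕ) (S : Env) : Prop where
  size : S.var 0 = n
  source : S.var 1 = s
  sink : S.var 2 = t
  preflow : Preflow n s t c (S.mat 2) (S.mat 3 0) (S.mat 4 0)

structure WordsFit (w n : ℕ) (c : ℕ → ℕ → ℕ) (U : ℕ) : Prop where
  cap_le : ∀ u < n, ∀ v < n, c u v ≤ U
  size_lt : n + 1 < 2 ^ w
  cap_lt : 2 * n * U < 2 ^ w

/-- A push exhausts the excess or the arc, and later pushes from `v` do not reopen the arc. So
leftover excess means that no admissible arc is left, which is what a relabelling needs. -/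
theorem wp_pushAll {w n s t U : ℕ} {c : ℕ → ℕ → ℕ} {S : Env} (hW : WordsFit w n c U)
    (hS : FlowState n s t c S) {v : ℕ} (h6 : S.var 6 = v)
    (hv : Active n s t (S.mat 3 0) (S.mat 4 0) v) :
    WP w pushAll S (fun S' => Preflow n s t c (S'.mat 2) (S'.mat 3 0) (S.mat 4 0) ∧
      (∀ x < n, x ≠ v → 0 < S'.mat 3 0 x → 0 < S.mat 3 0 x ∨ S.mat 4 0 x + 1 = S.mat 4 0 v) ∧
      (0 < S'.mat 3 0 v → ∀ x < n, 0 < S'.mat 2 v x → S.mat 4 0 v ≠ S.mat 4 0 x + 1)) := by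
  obtain ⟨hvn, hvs, hvt, -, hlab⟩ := hv
  have h0w : 0 < 2 ^ w := by positivity
  have h1w : 1 < 2 ^ w := by have := hW.size_lt; omega
  have hn : 0 < n := by omega
  refine WP.loop (fun i S' => Preflow n s t c (S'.mat 2) (S'.mat 3 0) (S.mat 4 0) ∧
      (∀ x < n, x ≠ v → 0 < S'.mat 3 0 x → 0 < S.mat 3 0 x ∨ S.mat 4 0 x + 1 = S.mat 4 0 v) ∧
      (0 < S'.mat 3 0 v → ∀ x < i, 0 < S'.mat 2 v x → S.mat 4 0 v ≠ S.mat 4 0 x + 1))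
    ⟨hS.preflow, fun x _ _ h => .inl h, by simp⟩ ?_ ?_
  · rintro i S₁ hi h7 fr ⟨hP, hnew, hdone⟩
    rw [hS.size] at hi
    have v0 : S₁.var 0 = n := by rw [fr.var 0 (by decide), hS.size]
    have v6 : S₁.var 6 = v := by rw [fr.var 6 (by decide), h6]
    have m4 : S₁.mat 4 = S.mat 4 := fr.mat 4 (by decide)
    have hlt : S.mat 4 0 i + 1 < 2 ^ w := by
      have := hS.preflow.label_le i hi
      have := hW.size_lt
      omega
    simp only [pushArc, WP.ifEq, WP.seq, WP.set, WP.put, WP.skip, Exp.Fits, Exp.eval, v0, v6, h7,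
      m4, hvn, hi, hn, h0w, h1w, hlt, true_and, and_self, Env.setVar, Env.setMat]
    refine ⟨fun hh => ?_, fun hh => ⟨by simpa using hP, by simpa using hnew, fun he x hx => ?_⟩⟩
    · generalize hδ : (if S₁.mat 3 0 v < S₁.mat 2 v i then S₁.mat 3 0 v else S₁.mat 2 v i) = δ
      have hδe : δ ≤ S₁.mat 3 0 v := by rw [← hδ]; split_ifs <;> omega
      have hδr : δ ≤ S₁.mat 2 v i := by rw [← hδ]; split_ifs <;> omega
      have hδ0 : S₁.mat 3 0 v - δ = 0 ∨ S₁.mat 2 v i - δ = 0 := by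
        rw [← hδ]; split_ifs <;> omega
      have hvi : v ≠ i := by rintro rfl; omega
      have his : i ≠ s := by rintro rfl; rw [hS.preflow.source] at hh; omega
      have hpush := hP.push hvn hi hvs hlab hh hδe hδr
      have hr := hpush.residual_le hW.cap_le hi hvn
      have he := hpush.excess_le hW.cap_le hi his
      simp only [and_self, if_true] at hr he
      have h2U : 2 * U ≤ 2 * n * U := by nlinarith
      have := hW.cap_lt
      have l1 : S₁.mat 2 i v + δ < 2 ^ w := by omega
      have l2 : S₁.mat 3 0 i + δ < 2 ^ w := by omega
      simp [v0, v6, h7, hvn, hi, hn, hvi, hvi.symm, l1, l2]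
      refine ⟨?_, fun x hx hxv hpos => ?_, fun hpos x hx hrx hx' => ?_⟩
      · convert hpush using 4
      · by_cases hxi : x = i
        · exact .inr (by rw [hxi]; exact hh.symm)
        · simp only [hxi, hxv, if_false] at hpos
          exact hnew x hx hxv hpos
      · by_cases hxi : x = i
        · simp only [hxi, if_true] at hrx
          omega
        · simp only [hxi, if_false] at hrx
          exact hdone (by omega) x (by omega) hrx hx'
    · rcases Nat.lt_succ_iff_lt_or_eq.1 hx with h | rfl
      · exact hdone (by simpa using he) x h
      · exact fun _ => hh
  · rintro S' - - ⟨h1, h2, h3⟩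
    rw [hS.size] at h3
    exact ⟨h1, h2, h3⟩

/-- `D` is the increase of the label of `v`. Either `v` becomes inactive or its label rises by 1,
and new excess appears only one level below `v`. -/
theorem wp_discharge {w n s t U : ℕ} {c : ℕ → ℕ → ℕ} {S : Env} (hW : WordsFit w n c U)
    (hS : FlowState n s t c S) {v : ℕ} (h6 : S.var 6 = v) (hv : v < n) :
    WP w discharge S (fun S' => FlowState n s t c S' ∧ ∃ D,
      (∀ x < n, S'.mat 4 0 x = S.mat 4 0 x + if x = v then D else 0) ∧
      (∀ x < n, x ≠ v → 0 < S'.mat 3 0 x → 0 < S.mat 3 0 x ∨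
        Active n s t (S.mat 3 0) (S.mat 4 0) v ∧ S.mat 4 0 x + 1 = S.mat 4 0 v) ∧
      (Active n s t (S'.mat 3 0) (S'.mat 4 0) v →
        Active n s t (S.mat 3 0) (S.mat 4 0) v ∧ D = 1)) := by
  have h0w : 0 < 2 ^ w := by positivity
  have h1w : 1 < 2 ^ w := by have := hW.size_lt; omega
  have hn : 0 < n := by omega
  have skip : ¬ Active n s t (S.mat 3 0) (S.mat 4 0) v → FlowState n s t c S ∧ ∃ D,
      (∀ x < n, S.mat 4 0 x = S.mat 4 0 x + if x = v then D else 0) ∧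
      (∀ x < n, x ≠ v → 0 < S.mat 3 0 x → 0 < S.mat 3 0 x ∨
        Active n s t (S.mat 3 0) (S.mat 4 0) v ∧ S.mat 4 0 x + 1 = S.mat 4 0 v) ∧
      (Active n s t (S.mat 3 0) (S.mat 4 0) v →
        Active n s t (S.mat 3 0) (S.mat 4 0) v ∧ D = 1) := fun hno =>
    ⟨hS, 0, by simp, fun x _ _ h => .inl h, fun h => absurd h hno⟩
  simp only [discharge, WP.ifEq, WP.ifLt, WP.seq, WP.skip, Exp.Fits, Exp.eval, hS.size, h6,
    hS.source, hS.sink, h0w, hn, hv, true_and, and_true]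
  refine ⟨fun e => skip fun h => h.2.1 e, fun hvs => ⟨fun e => skip fun h => h.2.2.1 e, fun hvt =>
    ⟨fun he => ⟨fun hh => ?_, fun hh => skip fun h => hh h.2.2.2.2⟩,
      fun he => skip fun h => he h.2.2.2.1⟩⟩⟩
  have hact : Active n s t (S.mat 3 0) (S.mat 4 0) v := ⟨hv, hvs, hvt, he, hh⟩
  refine (wp_pushAll hW hS h6 hact).mono fun S₁ fr ⟨hP, hnew, hdone⟩ => ?_
  have v0 : S₁.var 0 = n := by rw [fr.var 0 (by decide), hS.size]
  have v1 : S₁.var 1 = s := by rw [fr.var 1 (by decide), hS.source]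
  have v2 : S₁.var 2 = t := by rw [fr.var 2 (by decide), hS.sink]
  have v6 : S₁.var 6 = v := by rw [fr.var 6 (by decide), h6]
  have m4 : S₁.mat 4 = S.mat 4 := fr.mat 4 (by decide)
  have hlt : S.mat 4 0 v + 1 < 2 ^ w := by
    have := hW.size_lt
    omega
  simp only [WP.put, Exp.Fits, Exp.eval, v0, v6, m4, h0w, h1w, hn, hv, hlt, true_and, and_self]
  refine ⟨fun hpos => ?_, fun hpos => ?_⟩
  · have m4' : (S₁.setMat 4 0 v (S.mat 4 0 v + 1)).mat 4 0 =
        fun x => if x = v then S.mat 4 0 v + 1 else S.mat 4 0 x := by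
      funext x
      simp [Env.setMat, m4]
    have m3' : (S₁.setMat 4 0 v (S.mat 4 0 v + 1)).mat 3 = S₁.mat 3 := by simp [Env.setMat]
    have m2' : (S₁.setMat 4 0 v (S.mat 4 0 v + 1)).mat 2 = S₁.mat 2 := by simp [Env.setMat]
    refine ⟨⟨v0, v1, v2, ?_⟩, 1, fun x _ => ?_, fun x hx hxv h => ?_, fun _ => ⟨hact, rfl⟩⟩
    · rw [m4', m3', m2']
      exact hP.relabel hvs hvt hh (hdone hpos)
    · rw [m4']
      by_cases hxv : x = v <;> simp [hxv]
    · rw [m3'] at h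
      exact (hnew x hx hxv h).imp_right fun h => ⟨hact, h⟩
  · refine ⟨⟨v0, v1, v2, by rw [m4]; exact hP⟩, 0, fun x _ => by simp, fun x hx hxv h => ?_,
      fun h => absurd h.2.2.2.1 hpos⟩
    exact (hnew x hx hxv h).imp_right fun h => ⟨hact, h⟩

/-- Without relabelling, every active vertex hands all its excess to the level below, so the bound
`φ` on the active labels drops by 1. Each unit of label increase costs at most 2 of this gain. -/
theorem wp_pass {w n s t U : ℕ} {c : ℕ → ℕ → ℕ} {S : Env} (hW : WordsFit w n c U)
    (hS : FlowState n s t c S) (φ : ℤ)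
    (hφ : ∀ v, Active n s t (S.mat 3 0) (S.mat 4 0) v → (S.mat 4 0 v : ℤ) < φ) :
    WP w pass S (fun S' => FlowState n s t c S' ∧ ∀ v, Active n s t (S'.mat 3 0) (S'.mat 4 0) v →
      (S'.mat 4 0 v : ℤ) < φ - 1 + 2 * ((∑ v ∈ Finset.range n, S'.mat 4 0 v : ℕ) -
        (∑ v ∈ Finset.range n, S.mat 4 0 v : ℕ))) := by
  -- With `D` the increase of the labels so far in this pass, all active vertices satisfy the weak
  -- bound and those already treated the strong one. A vertex that receives excess from a vertex
  -- below `φ + D` is itself below `φ + D - 1`.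
  refine WP.loop (fun i S' => FlowState n s t c S' ∧ ∃ D : ℕ,
      ∑ v ∈ Finset.range n, S'.mat 4 0 v = ∑ v ∈ Finset.range n, S.mat 4 0 v + D ∧
      ∀ v, Active n s t (S'.mat 3 0) (S'.mat 4 0) v → (S'.mat 4 0 v : ℤ) < φ + D ∧
        (v < i → (S'.mat 4 0 v : ℤ) < φ - 1 + 2 * D)) ?_ ?_ ?_
  · refine ⟨⟨by simpa [Env.setVar] using hS.size, by simpa [Env.setVar] using hS.source,
      by simpa [Env.setVar] using hS.sink, hS.preflow⟩, 0, rfl, fun v hv => ⟨?_, by simp⟩⟩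
    simpa [Env.setVar] using hφ v hv
  · rintro i S₁ hi h6 fr ⟨hS₁, D, hsum, hD⟩
    rw [hS.size] at hi
    refine (wp_discharge hW hS₁ h6 hi).mono ?_
    rintro S₂ - ⟨hS₂, d, h4, h3, hact⟩
    refine ⟨⟨by simpa [Env.setVar] using hS₂.size, by simpa [Env.setVar] using hS₂.source,
      by simpa [Env.setVar] using hS₂.sink, hS₂.preflow⟩, D + d, ?_, fun x hx => ?_⟩
    · change ∑ v ∈ Finset.range n, S₂.mat 4 0 v = _
      rw [← add_assoc, ← hsum]
      have : ∀ v ∈ Finset.range n, S₂.mat 4 0 v = S₁.mat 4 0 v + if v = i then d else 0 :=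
        fun v hv => h4 v (by simpa using hv)
      rw [Finset.sum_congr rfl this, Finset.sum_add_distrib]
      simp [hi]
    · change (S₂.mat 4 0 x : ℤ) < _ ∧ (x < i + 1 → (S₂.mat 4 0 x : ℤ) < _)
      change Active n s t (S₂.mat 3 0) (S₂.mat 4 0) x at hx
      obtain ⟨hxn, hxs, hxt, hex, hlx⟩ := id hx
      have hx4 := h4 x hxn
      push_cast
      by_cases hxi : x = i
      · obtain ⟨ha, rfl⟩ := hact (hxi ▸ hx)
        rw [← hxi] at ha
        have := (hD x ha).1
        rw [if_pos hxi] at hx4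
        omega
      · rw [if_neg hxi, add_zero] at hx4
        rcases h3 x hxn hxi hex with h | ⟨ha, h⟩
        · have := hD x ⟨hxn, hxs, hxt, h, by omega⟩
          omega
        · have := hD i ha
          omega
  · rintro S' - - ⟨hS', D, hsum, hD⟩
    refine ⟨hS', fun v hv => ?_⟩
    have := (hD v hv).2 (by rw [hS.size]; exact hv.1)
    rw [hsum]
    push_cast at this ⊢
    linarith

/-- After `q` passes the labels of the active vertices are small. -/
def Progress (n s t q : ℕ) (S : Env) : Prop :=
  ∃ φ : ℤ, (∀ v, Active n s t (S.mat 3 0) (S.mat 4 0) v → (S.mat 4 0 v : ℤ) < φ) ∧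
    q + φ ≤ n * n + 2 * (∑ v ∈ Finset.range n, S.mat 4 0 v : ℕ)

theorem wp_pass_progress {w n s t U q : ℕ} {c : ℕ → ℕ → ℕ} {S : Env} (hW : WordsFit w n c U)
    (hS : FlowState n s t c S) (h : Progress n s t q S) :
    WP w pass S (fun S' => FlowState n s t c S' ∧ Progress n s t (q + 1) S') := by
  obtain ⟨φ, hφ, hq⟩ := h
  refine (wp_pass hW hS φ hφ).mono fun S' _ ⟨h1, h2⟩ => ⟨h1, _, h2, ?_⟩
  push_cast at hq ⊢
  linarith

theorem FlowState.setVar {n s t : ℕ} {c : ℕ → ℕ → ℕ} {S : Env} (h : FlowState n s t c S)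
    {r : ℕ} (hr : 3 ≤ r) (y : ℕ) : FlowState n s t c (S.setVar r y) := by
  have h0 : 0 ≠ r := by omega
  have h1 : 1 ≠ r := by omega
  have h2 : 2 ≠ r := by omega
  exact ⟨by simpa [Env.setVar, h0] using h.size, by simpa [Env.setVar, h1] using h.source,
    by simpa [Env.setVar, h2] using h.sink, h.preflow⟩

theorem wp_maxFlow {w n U : ℕ} {s t : Fin n} (hst : s ≠ t) {c : Fin n → Fin n → ℕ} {S : Env}
    (hS : Holds n c s t S) (hss : c s s = 0) (hW : WordsFit w n (S.mat 1) U) (k : ℕ) :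
    WP w maxFlow S (fun S' => k < S'.mat 3 0 t ↔
      ∀ X : Finset (Fin n), s ∈ X → t ∉ X → k + 1 ≤ cutCap c X) := by
  have h0w : 0 < 2 ^ w := by positivity
  have hs := s.2
  have ht := t.2
  have hn : 0 < n := by omega
  have hc : matrixOf n (S.mat 1) = c := by
    funext u v
    exact hS.cap u v
  rw [maxFlow, WP.seq]
  refine (wp_fill (fun u v => if u = (s : ℕ) then 0 else if v = (s : ℕ) then
    S.mat 1 u v + S.mat 1 v u else S.mat 1 u v) ?_).mono fun S₁ fr₁ h2 => ?_
  · intro S' fr h4 h5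
    have e0 : S'.var 0 = n := (fr.var 0 (by decide)).trans hS.size
    have e1 : S'.var 1 = s := (fr.var 1 (by decide)).trans hS.source
    have m1 : S'.mat 1 = S.mat 1 := fr.mat 1 (by decide)
    rw [hS.size] at h4 h5
    have hlt : S.mat 1 (S'.var 4) (S'.var 5) + S.mat 1 (S'.var 5) (S'.var 4) < 2 ^ w := by
      have := hW.cap_le _ h4 _ h5
      have := hW.cap_le _ h5 _ h4
      have := hW.cap_lt
      have : 2 * U ≤ 2 * n * U := by nlinarith
      omega
    simp only [Exp.Fits, Exp.eval, e0, e1, m1, h4, h5, h0w, hlt, and_self, ite_self]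
  have hS₁ : Holds n c s t S₁ := hS.frame fr₁ (by decide) (by decide) (by decide) (by decide)
  have m1₁ : S₁.mat 1 = S.mat 1 := fr₁.mat 1 (by decide)
  rw [hS.size] at h2
  rw [WP.seq]
  refine (wp_fillRow (fun v => S.mat 1 s v) ?_).mono fun S₂ fr₂ h3 => ?_
  · intro S' fr h5
    have e0 : S'.var 0 = n := (fr.var 0 (by decide)).trans hS₁.size
    have e1 : S'.var 1 = s := (fr.var 1 (by decide)).trans hS₁.source
    have m1 : S'.mat 1 = S.mat 1 := (fr.mat 1 (by decide)).trans m1₁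
    rw [hS₁.size] at h5
    simp only [Exp.Fits, Exp.eval, e0, e1, m1, h5, hs, and_self]
  have hS₂ : Holds n c s t S₂ := hS₁.frame fr₂ (by decide) (by decide) (by decide) (by decide)
  rw [hS₁.size] at h3
  rw [WP.seq]
  refine (wp_fillRow (fun v => if v = (s : ℕ) then n else 0) ?_).mono fun S₃ fr₃ h4 => ?_
  · intro S' fr h5
    have e0 : S'.var 0 = n := (fr.var 0 (by decide)).trans hS₂.size
    have e1 : S'.var 1 = s := (fr.var 1 (by decide)).trans hS₂.source
    simp only [Exp.Fits, Exp.eval, e0, e1, h0w, and_self, ite_self]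
  have hS₃ : Holds n c s t S₃ := hS₂.frame fr₃ (by decide) (by decide) (by decide) (by decide)
  rw [hS₂.size] at h4
  have m2₃ : S₃.mat 2 = S₁.mat 2 := by rw [fr₃.mat 2 (by decide), fr₂.mat 2 (by decide)]
  have m3₃ : S₃.mat 3 = S₂.mat 3 := fr₃.mat 3 (by decide)
  have hst' : (t : ℕ) ≠ s := fun e => hst (Fin.ext e.symm)
  have start : Preflow n s t (S.mat 1) (S₃.mat 2) (S₃.mat 3 0) (S₃.mat 4 0) := by
    rw [m2₃, m3₃]
    refine ⟨fun u hu v hv => ?_, fun v hv hvs => ?_, fun v hv => ?_, ?_, ?_, fun v hv => ?_,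
      fun u hu v hv h0 => ?_⟩
    · rw [h2 u hu v hv, h2 v hv u hu]
      have := hS.cap s s
      split_ifs with e1 e2 e2
      · rw [e1, e2]
        omega
      · omega
      · omega
      · omega
    · rw [h3 v hv, add_comm]
      have h5 : ∀ u ∈ Finset.range n, S₁.mat 2 v u =
          S.mat 1 v u + if u = (s : ℕ) then S.mat 1 s v else 0 := by
        intro u hu
        rw [h2 v hv u (by simpa using hu), if_neg hvs]
        split_ifs with e
        · rw [e]
        · rfl
      rw [Finset.sum_congr rfl h5, Finset.sum_add_distrib]
      simp
    · rw [h2 s hs v hv, if_pos rfl]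
    · rw [h4 s hs, if_pos rfl]
    · rw [h4 t ht, if_neg hst']
    · rw [h4 v hv]
      split_ifs <;> omega
    · rw [h2 u hu v hv] at h0
      rw [h4 u hu]
      split_ifs at h0 ⊢ <;> omega
  have hF : FlowState n s t (S.mat 1) S₃ := ⟨hS₃.size, hS₃.source, hS₃.sink, start⟩
  have hprog : Progress n s t 0 S₃ := by
    -- Active labels are below `n` by definition, and `n ≤ n²`.
    refine ⟨n, fun v hv => by exact_mod_cast hv.2.2.2.2, ?_⟩
    have : (n : ℤ) ≤ n * n := by nlinarith
    push_cast
    have : (0 : ℤ) ≤ ∑ v ∈ Finset.range n, (S₃.mat 4 0 v : ℤ) :=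
      Finset.sum_nonneg fun _ _ => by positivity
    linarith
  refine WP.loop (fun i S' => FlowState n s t (S.mat 1) S' ∧ Progress n s t (3 * (n * i)) S')
    ⟨hF.setVar (by decide) _, hprog⟩ ?_ ?_
  · rintro i S₄ - - - ⟨hF₄, hp₄⟩
    refine WP.loop (fun j S' => FlowState n s t (S.mat 1) S' ∧
      Progress n s t (3 * (n * i + j)) S') ⟨hF₄.setVar (by decide) _, hp₄⟩ ?_ ?_
    · rintro j S₅ - - - ⟨hF₅, hp₅⟩
      rw [WP.seq]
      refine (wp_pass_progress hW hF₅ hp₅).mono fun S₆ _ ⟨hF₆, hp₆⟩ => ?_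
      rw [WP.seq]
      refine (wp_pass_progress hW hF₆ hp₆).mono fun S₇ _ ⟨hF₇, hp₇⟩ => ?_
      refine (wp_pass_progress hW hF₇ hp₇).mono fun S₈ _ ⟨hF₈, hp₈⟩ => ?_
      exact ⟨hF₈.setVar (by decide) _, hp₈⟩
    · rintro S₅ - - ⟨hF₅, hp₅⟩
      refine ⟨hF₅.setVar (by decide) _, ?_⟩
      rw [hF₄.size] at hp₅
      exact hp₅
  · rintro S₄ - - ⟨hF₄, φ, hφ, hq⟩
    rw [hS₃.size] at hq
    rw [← hc]
    -- The label sum is at most `n²`, so after `3n²` passes `φ ≤ n² + 2n² - 3n² = 0`, and no label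
    -- is below `φ`.
    refine hF₄.preflow.lt_excess_iff hst (fun v hv => ?_) k
    have h1 := hφ v hv
    have h2 := hF₄.preflow.sum_label_le
    have h3 : ((∑ v ∈ Finset.range n, S₄.mat 4 0 v : ℕ) : ℤ) ≤ n * n := by exact_mod_cast h2
    push_cast at hq h3
    have h4 : (0 : ℤ) ≤ (S₄.mat 4 0 v : ℤ) := by positivity
    nlinarith

end WordRAM

/-! ## The decision procedure -/

namespace WordRAM

open Exp Cmd

/-- The variable `20` holds the answer at the end. -/
def decideFlow : Cmd :=
  .ifEq (var 3) (lit 0) (.set 20 (lit 0))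
    (.ifEq (var 3) (lit 1)
      (fill 5 (.ifLt (lit 1) (get 1 (var 4) (var 5)) (lit 1) (lit 0)) ;;
        search 8 ;;
        .set 20 (get 6 (lit 0) (var 1)))
      (maxFlow ;;
        .set 20 (.ifLt (var 3) (get 3 (lit 0) (var 2)) (lit 1) (lit 0)) ;;
        checkVertices))

theorem wp_decideFlow {w n k U : ℕ} (N : FlowNetwork n) {S : Env}
    (hS : Holds n N.capEntry N.s N.t S) (hk : S.var 3 = k) (hW : WordsFit w n (S.mat 1) U) :
    WP w decideFlow S (fun S' => S'.var 20 = 1 ∧ HasDegreeBoundedFlow N k 1 ∨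
      S'.var 20 = 0 ∧ ¬ HasDegreeBoundedFlow N k 1) := by
  have h0w : 0 < 2 ^ w := by positivity
  have h1w : 1 < 2 ^ w := by have := hW.size_lt; omega
  have hs := N.s.2
  have ht := N.t.2
  have hn : 0 < n := by omega
  rw [decideFlow, WP.ifEq]
  simp only [Exp.Fits, Exp.eval, hk, h0w, true_and]
  refine ⟨fun hk0 => ?_, fun hk0 => ?_⟩
  · subst hk0
    simp only [WP.set, Exp.Fits, Exp.eval, h0w, true_and]
    exact .inr ⟨by simp [Env.setVar], N.not_hasDegreeBoundedFlow_zero⟩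
  rw [WP.ifEq]
  simp only [Exp.Fits, Exp.eval, hk, h1w, true_and]
  refine ⟨fun hk1 => ?_, fun hk1 => ?_⟩
  · subst hk1
    rw [WP.seq]
    refine (wp_fill (fun u v => if 1 < S.mat 1 u v then 1 else 0) ?_).mono fun S₁ fr₁ h5 => ?_
    · intro S' fr h4 h5
      have e0 : S'.var 0 = S.var 0 := fr.var 0 (by decide)
      have e1 : S'.mat 1 = S.mat 1 := fr.mat 1 (by decide)
      simp only [Exp.Fits, Exp.eval, e0, e1, h4, h5, h0w, h1w, and_self, ite_self]
    have hS₁ := hS.frame fr₁ (by decide) (by decide) (by decide) (by decide)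
    rw [hS.size] at h5
    rw [WP.seq]
    refine (wp_search (S := S₁) (p := 8) (by decide) (by rw [hS₁.size, hS₁.sink]; exact ht)
      (by rw [hS₁.size]; exact hW.size_lt)).mono fun S₂ fr₂ res => ?_
    rw [hS₁.size, hS₁.sink] at res
    have hS₂ := hS₁.frame fr₂ (by decide) (by decide) (by decide) (by decide)
    simp only [WP.set, Exp.Fits, Exp.eval, hS₂.size, hS₂.source, hs, hn, h0w, true_and]
    have hiff : S₂.mat 6 0 N.s = 1 ↔ HasDegreeBoundedFlow N 1 1 := by
      rw [res.seen_iff N.s, N.hasDegreeBoundedFlow_one_iff]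
      have hval : ∀ u v : Fin n, matrixOf n (S₁.mat 5) u v =
          if 1 < N.capEntry u v then 1 else 0 := by
        intro u v
        simp only [matrixOf, h5 u u.2 v v.2, hS.cap]
      refine forall_congr' fun X => imp_congr_right fun _ => imp_congr_right fun _ =>
        ⟨fun h => ?_, fun ⟨u, hu, v, hv, h⟩ => ?_⟩
      · obtain ⟨u, hu, v, hv, h0⟩ := exists_of_cutCap_pos h
        refine ⟨u, hu, v, hv, ?_⟩
        rw [hval] at h0
        split_ifs at h0 with h1
        · exact h1
        · omega
      · refine lt_of_lt_of_le ?_ (le_cutCap _ hu hv)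
        rw [hval, if_pos (show 1 < N.capEntry u v from h)]
        exact Nat.zero_lt_one
    have h20 : (S₂.setVar 20 (S₂.mat 6 0 N.s)).var 20 = S₂.mat 6 0 N.s := by simp [Env.setVar]
    rw [h20, ← hiff]
    rcases res.zero_or_one N.s hs with h | h <;> simp [h]
  · rw [WP.seq]
    refine (wp_maxFlow N.s_ne_t hS (by simp [FlowNetwork.capEntry, N.loopless]) hW k).mono
      fun S₁ fr₁ hflow => ?_
    have hS₁ := hS.frame fr₁ (by decide) (by decide) (by decide) (by decide)
    have hk₁ : S₁.var 3 = k := by rw [fr₁.var 3 (by decide), hk]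
    rw [WP.seq]
    simp only [WP.set, Exp.Fits, Exp.eval, hS₁.size, hS₁.sink, ht, hn, h0w, h1w, true_and,
      ite_self, hk₁]
    generalize hx : (if k < S₁.mat 3 0 N.t then 1 else 0) = x
    have h20 : (S₁.setVar 20 x).var 20 = x := by simp [Env.setVar]
    have hS₂ : Holds n N.capEntry N.s N.t (S₁.setVar 20 x) :=
      hS₁.frame (vs := [20]) (ms := []) ⟨fun r hr => by
        have : r ≠ 20 := by simpa using hr
        simp [Env.setVar, this], fun _ _ => rfl⟩ (by decide) (by decide) (by decide) (by decide)
    refine (wp_checkVertices hS₂ (by rw [h20, ← hx]; split_ifs <;> simp) hW.size_lt).mono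
      fun S₃ _ ⟨h01, hiff⟩ => ?_
    have hmain : S₃.var 20 = 1 ↔ HasDegreeBoundedFlow N k 1 := by
      rw [hiff, h20, N.hasDegreeBoundedFlow_iff (by omega), ← hflow, ← hx]
      refine and_congr_left fun _ => ?_
      split_ifs with h <;> simp [h]
    rw [← hmain]
    omega

/-! ### Initial configuration and word length. -/

/-- The input, seen as two-dimensional arrays. -/
noncomputable def inputEnv {n : ℕ} (N : FlowNetwork n) (k : ℕ) : Env where
  var := (N.input k).reg
  mat m i j := (N.input k).mem m (j + n * i)

theorem rowMajor_apply {n : ℕ} (A : Fin n → Fin n → ℕ) (u v : Fin n) :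
    FlowNetwork.rowMajor A (v + n * u) = A u v := by
  have hlt : (v : ℕ) + n * u < n * n := (finProdFinEquiv (u, v)).2
  have he : (⟨v + n * u, hlt⟩ : Fin (n * n)) = finProdFinEquiv (u, v) := rfl
  rw [FlowNetwork.rowMajor, dif_pos hlt, he, Equiv.symm_apply_apply]

theorem rowMajor_le {n b : ℕ} {A : Fin n → Fin n → ℕ} (h : ∀ u v, A u v ≤ b) (a : ℕ) :
    FlowNetwork.rowMajor A a ≤ b := by
  rw [FlowNetwork.rowMajor]
  split_ifs
  · exact h _ _
  · exact Nat.zero_le _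

theorem capEntry_le_maxCap {n : ℕ} (N : FlowNetwork n) (u v : Fin n) :
    N.capEntry u v ≤ N.maxCap :=
  Finset.le_sup (f := fun e : Fin n × Fin n => N.capEntry e.1 e.2) (Finset.mem_univ (u, v))

theorem input_le {n : ℕ} (N : FlowNetwork n) (k : ℕ) :
    (∀ r, (N.input k).reg r ≤ n + k + N.maxCap) ∧
      ∀ m i, (N.input k).mem m i ≤ n + k + N.maxCap := by
  have hs := N.s.2
  have ht := N.t.2
  refine ⟨fun r => ?_, fun m i => ?_⟩
  · simp only [FlowNetwork.input]
    split_ifs <;> omega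
  · simp only [FlowNetwork.input]
    split_ifs
    · refine rowMajor_le (fun u v => ?_) i
      rw [FlowNetwork.adjEntry]
      split_ifs <;> omega
    · exact rowMajor_le (fun u v => (capEntry_le_maxCap N u v).trans (by omega)) i
    · exact Nat.zero_le _

/-- All inputs are below `B = 2 ^ b`. Indices up to `n²` and excesses up to `2nU` are below `2B² ≤
B⁴`; this is why four times the input length suffices. -/
theorem bounds_of_bitSize {n k U b : ℕ} (hn : 2 ≤ n) (hb : b = Nat.size (n + k + U)) :
    n + k + U < 2 ^ (4 * b) ∧ n + 1 < 2 ^ (4 * b) ∧ n * n < 2 ^ (4 * b) ∧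
      2 * n * U < 2 ^ (4 * b) := by
  have h1 : n + k + U < 2 ^ b := hb ▸ Nat.lt_size_self _
  have h2 : 2 ^ (4 * b) = (2 ^ b * 2 ^ b) * (2 ^ b * 2 ^ b) := by
    rw [← pow_add, ← pow_add]
    congr 1
    ring
  generalize 2 ^ b = B at *
  have h3 : (n + U + 1) * (n + U + 1) ≤ B * B := Nat.mul_le_mul (by omega) (by omega)
  have h4 : B * B * 2 ≤ (B * B) * (B * B) := Nat.mul_le_mul_left _ (by nlinarith)
  rw [h2]
  refine ⟨?_, ?_, ?_, ?_⟩ <;> nlinarith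

end WordRAM

/-- One program decides, for every network `N` and every `k` (both part of the input), whether `N`
has a flow `x` of value at least `k + 1` with `Δ⁺(D_x) ≤ k`. It runs on words of
`O(log (n + k + U))` bits and takes `O(n ^ 4)` steps, with a constant that does not depend on the
capacities or on `k`. Register `0` holds the answer at the end. -/
theorem mainTheorem7 :
    ∃ (P : WordRAM.Prog) (C d : ℕ), ∀ (n k : ℕ) (N : FlowNetwork n),
      ∃ (T : ℕ) (τ : WordRAM.State),
        WordRAM.Exec (d * N.bitSize k) P (N.input k) T τ ∧
        T ≤ C * n ^ 4 ∧
        (HasDegreeBoundedFlow N k 1 → τ.reg 0 = 1) ∧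
        (¬ HasDegreeBoundedFlow N k 1 → τ.reg 0 = 0) := by
  -- Register 0 holds `n` throughout, so the answer is moved there only at the very end; this is the
  -- additional 1 in the constant.
  refine ⟨.seq WordRAM.decideFlow.compile (.instr (.move 0 20)), WordRAM.decideFlow.coeff + 1, 4,
    fun n k N => ?_⟩
  have hn : 2 ≤ n := by
    have hs := N.s.2
    have ht := N.t.2
    have hst : (N.s : ℕ) ≠ N.t := fun e => N.s_ne_t (Fin.ext e)
    omega
  obtain ⟨b1, b2, b3, b4⟩ := WordRAM.bounds_of_bitSize (U := N.maxCap) hn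
    (rfl : N.bitSize k = Nat.size (n + k + N.maxCap))
  have hcap : ∀ u v : Fin n, (WordRAM.inputEnv N k).mat 1 u v = N.capEntry u v := fun u v =>
    WordRAM.rowMajor_apply N.capEntry u v
  have hS : WordRAM.Holds n N.capEntry N.s N.t (WordRAM.inputEnv N k) := ⟨rfl, rfl, rfl, hcap⟩
  have hW : WordRAM.WordsFit (4 * N.bitSize k) n ((WordRAM.inputEnv N k).mat 1) N.maxCap :=
    ⟨fun u hu v hv => (hcap ⟨u, hu⟩ ⟨v, hv⟩).trans_le (WordRAM.capEntry_le_maxCap N _ _), b2, b4⟩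
  obtain ⟨hfit, hpost⟩ := WordRAM.wp_decideFlow (k := k) N hS rfl hW
  obtain ⟨hr, hm⟩ := WordRAM.input_le N k
  obtain ⟨T, hT, τ, hex, hrep, hfits⟩ := WordRAM.decideFlow.exec_compile b3 (by omega)
    (by decide) hS.size hfit (σ := N.input k) ⟨fun _ _ => rfl, fun _ _ _ _ _ => rfl⟩
    ⟨fun r => (hr r).trans_lt b1, fun m i => (hm m i).trans_lt b1⟩
  have h20 : ((WordRAM.Instr.move 0 20).next τ).reg 0 =
      (WordRAM.decideFlow.eval (WordRAM.inputEnv N k)).var 20 := by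
    rw [← hrep.reg 20 (by decide)]
    simp [WordRAM.Instr.next, WordRAM.Instr.result, WordRAM.State.setReg]
  refine ⟨T + 1, _, .seq hex (.instr _ _ (hfits.reg 20)), ?_, fun h => ?_, fun h => ?_⟩
  · have h1 := WordRAM.decideFlow.cost_le (n := n) (by omega)
    have h2 : WordRAM.decideFlow.depth = 4 := by decide
    have h3 : 1 ≤ n ^ 4 := Nat.one_le_pow _ _ (by omega)
    rw [h2] at h1
    rw [add_mul, one_mul]
    omega
  · rw [h20]
    exact (hpost.resolve_right fun h' => h'.2 h).1
  · rw [h20]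
    exact (hpost.resolve_left fun h' => h h'.2).1
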